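/- Let $d\ge 2$, let $M$ be a smooth (finite-dimensional, Hausdorff, second countable) manifold and let $E\to M$ be a smooth real vector bundle of finite rank. **Definitions.** A Lie algebroid structure on $E$ consists of an anchor $\rho:E\to TM$ and a Lie bracket on $\Gamma(E)$ with $[\psi,f\psi']=f[\psi,\psi']+(\rho(\psi)f)\psi'$. Let $\mathcal S$ be a symmetric smooth section of $E^*\otimes E^*$ (of any signature) and $\mathcal S^\sharp:E\to E^*$, $a\mapsto\mathcal S(a,\cdot)$. For a smooth $d$-dimensional manifold $\Sigma$, a field is a smooth vector bundle morphism $T\Sigma\to E$, i.e. a map $X:\Sigma\to M$ together with a one-form $A$ on $\Sigma$ with values in $X^*E$. It is a solution if, in local frames $b_I$ of $E$ with $[b_J,b_K]=c_{JK}{}^I b_I$, $$dX^i-\rho^i_IA^I=0,\qquad dA^I+\tfrac12 c_{JK}{}^I A^J\wedge A^K=0 .$$ Its metric is $g(u,v)=\mathcal S(Au,Av)$; it is non-degenerate if $\det g\ne0$ everywhere. Two solutions on $\Sigma$ are gauge equivalent if they are joined by a smooth path of solutions with non-degenerate metrics along which the velocity is, at each time, an infinitesimal gauge transformation $$\delta_\varepsilon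 X^i=\varepsilon^I\rho^i_I,\qquad \delta_\varepsilon A^I=d\varepsilon^I+c_{KJ}{}^I A^K\varepsilon^J$$ with $\varepsilon\in\Gamma(X^*E)$ depending smoothly on time. A solution with non-degenerate metric is maximally extended if every geodesic of $g$ can be continued to infinite affine parameter, unless some scalar polynomial curvature invariant of $g$ (built algebraically from $g^{-1}$ and the Riemann tensor) diverges along it at a finite value of the parameter. The pair $(E,\mathcal S)$ defines an *admissible* (reasonable) theory of $E$-gravity in dimension $d$ if 1. for every $p\in M$ there is a solution on $\Sigma=\mathbb R^d$ with $p$ in the image of $X$ and with non-degenerate metric; 2. for every smooth $d$-manifold $\Sigma$ (Hausdorff, second countable) and any two gauge equivalent, maximally extended solutions on $\Sigma$ with non-degenerate metrics $g_{(1)},g_{(2)}$ there is a diffeomorphism $D:\Sigma\to\Sigma$ with $g_{(1)}=D^*g_{(2)}$. **Proposition.** Let $E$ be a bundle of abelian Lie algebras, i.e. a Lie algebroid with $\rho=0$ and $[\cdot,\cdot]=0$. Then $(E,\mathcal S)$ defines an admissible theory of $E$-gravity in dimension $d$ if and only if $\dim\operatorname{im}\mathcal S^\sharp_p=d$ for every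 $p\in M$. -/

import Mathlib

open Bundle Set Filter Topology Manifold
open scoped ContDiff Manifold Bundle

noncomputable section

namespace EGravity

/-- The derivative `v(f)` of a real function along the tangent vector `v` at `p`. -/
def dirDeriv {V : Type*} [NormedAddCommGroup V] [NormedSpace ℝ V] {N : Type*} [TopologicalSpace N]
    [ChartedSpace V N] (f : N → ℝ) (p : N) (v : TangentSpace 𝓘(ℝ, V) p) : ℝ :=
  mfderiv 𝓘(ℝ, V) 𝓘(ℝ, ℝ) f p v

/-! ### Calculus on a spacetime `S` modelled on `ℝ^d` -/

section Spacetime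

variable {d : ℕ} {S : Type} [TopologicalSpace S] [ChartedSpace (EuclideanSpace ℝ (Fin d)) S]

/-- The tangent vector at the point with coordinates `y` in the chart around `x₀` that has
the constant coordinate vector `w` in this chart. -/
def chartVec (x₀ : S) (y w : EuclideanSpace ℝ (Fin d)) :
    TangentSpace (𝓡 d) ((extChartAt (𝓡 d) x₀).symm y) :=
  mfderiv (𝓡 d) (𝓡 d) (extChartAt (𝓡 d) x₀).symm y w

/-- The exterior derivative at `x` of a one-form `α`, evaluated on the tangent vectors
with coordinates `w₁`, `w₂` in the chart around `x`. -/
def extDerivOneForm (α : ∀ x : S, TangentSpace (𝓡 d) x → ℝ) (x : S)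
    (w₁ w₂ : EuclideanSpace ℝ (Fin d)) : ℝ :=
  fderiv ℝ (fun y => α _ (chartVec x y w₂)) (extChartAt (𝓡 d) x x) w₁
    - fderiv ℝ (fun y => α _ (chartVec x y w₁)) (extChartAt (𝓡 d) x x) w₂

variable (d S) in
/-- A field of bilinear forms on the tangent spaces of `S`. -/
abbrev MetricField : Type :=
  ∀ x : S, TangentSpace (𝓡 d) x → TangentSpace (𝓡 d) x → ℝ

/-- Nondegeneracy of `g` everywhere on `S` (that is, `det g ≠ 0`). -/
def MetricField.Nondegenerate (g : MetricField d S) : Prop :=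
  ∀ (x : S) (v : TangentSpace (𝓡 d) x), (∀ u, g x v u = 0) → v = 0

/-- The matrix `g_{ij}` in the chart around `x₀`, at the point with coordinates `y`. -/
def MetricField.coord (g : MetricField d S) (x₀ : S) (y : EuclideanSpace ℝ (Fin d)) :
    Matrix (Fin d) (Fin d) ℝ :=
  Matrix.of fun i j => g _ (chartVec x₀ y (EuclideanSpace.single i 1))
    (chartVec x₀ y (EuclideanSpace.single j 1))

/-- The partial derivative `∂_i f` at `y`. -/
def partialD (i : Fin d) (f : EuclideanSpace ℝ (Fin d) → ℝ) (y : EuclideanSpace ℝ (Fin d)) : ℝ :=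
  fderiv ℝ f y (EuclideanSpace.single i 1)

/-- Christoffel symbols `Γ^k_{ij}` in the chart around `x₀`. -/
def MetricField.christoffel (g : MetricField d S) (x₀ : S) (k i j : Fin d)
    (y : EuclideanSpace ℝ (Fin d)) : ℝ :=
  (1 / 2) * ∑ l, (g.coord x₀ y)⁻¹ k l *
    (partialD i (fun z => g.coord x₀ z j l) y + partialD j (fun z => g.coord x₀ z i l) y
      - partialD l (fun z => g.coord x₀ z i j) y)

/-- Curvature components
`R^l_{kij} = ∂_i Γ^l_{jk} - ∂_j Γ^l_{ik} + Γ^l_{im} Γ^m_{jk} - Γ^l_{jm} Γ^m_{ik}`. -/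
def MetricField.riemannUp (g : MetricField d S) (x₀ : S) (l k i j : Fin d)
    (y : EuclideanSpace ℝ (Fin d)) : ℝ :=
  partialD i (g.christoffel x₀ l j k) y - partialD j (g.christoffel x₀ l i k) y
    + ∑ m, (g.christoffel x₀ l i m y * g.christoffel x₀ m j k y
      - g.christoffel x₀ l j m y * g.christoffel x₀ m i k y)

/-- Curvature components with lowered index `R_{nkij} = g_{nl} R^l_{kij}`. -/
def MetricField.riemann (g : MetricField d S) (x₀ : S) (n k i j : Fin d)
    (y : EuclideanSpace ℝ (Fin d)) : ℝ :=
  ∑ l, g.coord x₀ y n l * g.riemannUp x₀ l k i j y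

/-- `γ` is a smooth geodesic of `g` on the open set `J` of parameters:
`γ''^k + Γ^k_{ij} γ'^i γ'^j = 0` in coordinates. -/
def MetricField.IsGeodesicOn (g : MetricField d S) (γ : ℝ → S) (J : Set ℝ) : Prop :=
  ContMDiffOn 𝓘(ℝ, ℝ) (𝓡 d) ∞ γ J ∧
  ∀ t ∈ J, ∀ k : Fin d,
    (deriv (deriv (fun s => extChartAt (𝓡 d) (γ t) (γ s))) t) k
      + ∑ i, ∑ j, g.christoffel (γ t) k i j (extChartAt (𝓡 d) (γ t) (γ t))
        * (deriv (fun s => extChartAt (𝓡 d) (γ t) (γ s)) t) i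
        * (deriv (fun s => extChartAt (𝓡 d) (γ t) (γ s)) t) j = 0

/-- The values of the variables of a polynomial in the components `g^{ij}` and `R_{ijkl}`. -/
def curvatureValuation (H : Matrix (Fin d) (Fin d) ℝ) (R : Fin d → Fin d → Fin d → Fin d → ℝ) :
    (Fin d × Fin d) ⊕ (Fin d × Fin d × Fin d × Fin d) → ℝ :=
  Sum.elim (fun a => H a.1 a.2) (fun a => R a.1 a.2.1 a.2.2.1 a.2.2.2)

variable (d) in
/-- A scalar polynomial curvature invariant: a polynomial in the components of the inverse
metric and of the curvature tensor whose value does not depend on the choice of a basis. -/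
structure CurvatureInvariant where
  poly : MvPolynomial ((Fin d × Fin d) ⊕ (Fin d × Fin d × Fin d × Fin d)) ℝ
  invariant : ∀ (P G : Matrix (Fin d) (Fin d) ℝ) (R : Fin d → Fin d → Fin d → Fin d → ℝ),
    IsUnit P.det → G.IsSymm → IsUnit G.det →
    MvPolynomial.eval (curvatureValuation (P.transpose * G * P)⁻¹
      (fun i j k l => ∑ a, ∑ b, ∑ c, ∑ e, P a i * P b j * P c k * P e l * R a b c e)) poly
    = MvPolynomial.eval (curvatureValuation G⁻¹ R) poly

/-- The value of a curvature invariant of the metric `g` at the point `x`. -/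
def CurvatureInvariant.value (q : CurvatureInvariant d) (g : MetricField d S) (x : S) : ℝ :=
  MvPolynomial.eval (curvatureValuation (g.coord x (extChartAt (𝓡 d) x x))⁻¹
    (fun i j k l => g.riemann x i j k l (extChartAt (𝓡 d) x x))) q.poly

/-- `(S, g)` is maximally extended: every geodesic can be continued to all (positive) values
of its affine parameter unless some curvature invariant diverges along it at a finite value of
the parameter. -/
def MetricField.IsMaximallyExtended (g : MetricField d S) : Prop :=
  ∀ v : TangentBundle (𝓡 d) S, ∃ γ : ℝ → S,
    (⟨γ 0, mfderiv 𝓘(ℝ, ℝ) (𝓡 d) γ 0 (1 : ℝ)⟩ : TangentBundle (𝓡 d) S) = v ∧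
    ∃ δ > 0, g.IsGeodesicOn γ (Ioi (-δ)) ∨
      ∃ b > 0, g.IsGeodesicOn γ (Ioo (-δ) b) ∧
        ∃ q : CurvatureInvariant d, Tendsto (fun t => |q.value g (γ t)|) (𝓝[<] b) atTop

end Spacetime

/-! ### Lie algebroids, field equations and gauge symmetries -/

section Algebroid

variable {EM : Type*} [NormedAddCommGroup EM] [NormedSpace ℝ EM]
  {M : Type*} [TopologicalSpace M] [ChartedSpace EM M]
  {F : Type*} [NormedAddCommGroup F] [NormedSpace ℝ F]
  {E : M → Type*} [TopologicalSpace (TotalSpace F E)] [∀ p, TopologicalSpace (E p)]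
  [∀ p, AddCommGroup (E p)] [∀ p, Module ℝ (E p)]
  [∀ p, IsTopologicalAddGroup (E p)] [∀ p, ContinuousSMul ℝ (E p)]
  [FiberBundle F E] [VectorBundle ℝ F E]

variable (EM F E) in
/-- A symmetric smooth section of `E* ⊗ E*`. The map `a ↦ toFun p a` is `𝒮^♯ : E_p → E_p*`. -/
structure SymTensor where
  toFun : ∀ p : M, E p →L[ℝ] E p →L[ℝ] ℝ
  symm : ∀ (p : M) (a b : E p), toFun p a b = toFun p b a
  contMDiff : ContMDiff 𝓘(ℝ, EM) (𝓘(ℝ, EM).prod 𝓘(ℝ, F →L[ℝ] F →L[ℝ] ℝ)) ∞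
    (fun p => TotalSpace.mk' (F →L[ℝ] F →L[ℝ] ℝ) p (toFun p))

variable [IsManifold 𝓘(ℝ, EM) ∞ M]

variable (EM F E) in
/-- A Lie algebroid structure on the smooth vector bundle `E → M`. -/
structure LieAlgebroid where
  anchor : ∀ p : M, E p →L[ℝ] TangentSpace 𝓘(ℝ, EM) p
  contMDiff_anchor : ContMDiff 𝓘(ℝ, EM) (𝓘(ℝ, EM).prod 𝓘(ℝ, F →L[ℝ] EM)) ∞
    (fun p => TotalSpace.mk' (F →L[ℝ] EM) (E := fun p : M => E p →L[ℝ] TangentSpace 𝓘(ℝ, EM) p)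
      p (anchor p))
  bracket : Cₛ^∞⟮𝓘(ℝ, EM); F, E⟯ →ₗ[ℝ] Cₛ^∞⟮𝓘(ℝ, EM); F, E⟯ →ₗ[ℝ] Cₛ^∞⟮𝓘(ℝ, EM); F, E⟯
  bracket_self : ∀ ψ, bracket ψ ψ = 0
  jacobi : ∀ ψ₁ ψ₂ ψ₃, bracket ψ₁ (bracket ψ₂ ψ₃) + bracket ψ₂ (bracket ψ₃ ψ₁)
    + bracket ψ₃ (bracket ψ₁ ψ₂) = 0
  leibniz : ∀ (ψ ψ' χ : Cₛ^∞⟮𝓘(ℝ, EM); F, E⟯) (f : M → ℝ),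
    ContMDiff 𝓘(ℝ, EM) 𝓘(ℝ, ℝ) ∞ f → (∀ p, χ p = f p • ψ' p) →
    ∀ p, bracket ψ χ p = f p • bracket ψ ψ' p
      + dirDeriv f p (anchor p (ψ p)) • ψ' p

/-- `E` is a bundle of abelian Lie algebras: both the anchor and the bracket vanish. -/
def LieAlgebroid.IsAbelianBundle (L : LieAlgebroid EM F E) : Prop :=
  (∀ p, L.anchor p = 0) ∧ ∀ ψ ψ', L.bracket ψ ψ' = 0

variable (EM F E) in
/-- A local frame of `E` over an open set `U`, given by globally defined smooth sections
that form a basis of the fibres over the points of `U`. -/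
structure Frame where
  U : Set M
  isOpen : IsOpen U
  sec : Fin (Module.finrank ℝ F) → Cₛ^∞⟮𝓘(ℝ, EM); F, E⟯
  isFrame : IsLocalFrameOn 𝓘(ℝ, EM) F ∞ (fun I p => sec I p) U

/-- The `I`-th component of a vector in the fibre over `p ∈ U`. -/
def Frame.comp (b : Frame EM F E) (I : Fin (Module.finrank ℝ F)) (p : M) : E p →ₗ[ℝ] ℝ :=
  b.isFrame.coeff I p

/-- The structure functions `c_{JK}^I`, given by `[b_J, b_K] = c_{JK}^I b_I`. -/
def LieAlgebroid.structureFun (L : LieAlgebroid EM F E) (b : Frame EM F E)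
    (J K I : Fin (Module.finrank ℝ F)) (p : M) : ℝ :=
  b.comp I p (L.bracket (b.sec J) (b.sec K) p)

variable {d : ℕ}

variable (EM F E d) in
/-- A smooth vector bundle morphism `TS → E` with base map `base : S → M`; equivalently a base
map together with a one-form on `S` with values in the pullback of `E`. -/
structure BundleField (S : Type) [TopologicalSpace S]
    [ChartedSpace (EuclideanSpace ℝ (Fin d)) S] [IsManifold (𝓡 d) ∞ S] where
  base : S → M
  form : ∀ x : S, TangentSpace (𝓡 d) x →L[ℝ] E (base x)
  contMDiff : ContMDiff (𝓡 d).tangent (𝓘(ℝ, EM).prod 𝓘(ℝ, F)) ∞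
    (fun v : TangentBundle (𝓡 d) S => (⟨base v.1, form v.1 v.2⟩ : TotalSpace F E))

section Fields

variable {S : Type} [TopologicalSpace S] [ChartedSpace (EuclideanSpace ℝ (Fin d)) S]
  [IsManifold (𝓡 d) ∞ S]

/-- The field equations `dX^i - ρ^i_I A^I = 0` and `dA^I + ½ c_{JK}^I A^J ∧ A^K = 0`. -/
def LieAlgebroid.IsSolution (L : LieAlgebroid EM F E) (φ : BundleField EM F E d S) : Prop :=
  (∀ (x : S) (v : TangentSpace (𝓡 d) x),
    mfderiv (𝓡 d) 𝓘(ℝ, EM) φ.base x v = L.anchor (φ.base x) (φ.form x v)) ∧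
  ∀ (b : Frame EM F E) (x : S), φ.base x ∈ b.U →
    ∀ (I : Fin (Module.finrank ℝ F)) (w₁ w₂ : EuclideanSpace ℝ (Fin d)),
      let A : Fin (Module.finrank ℝ F) → ∀ x : S, TangentSpace (𝓡 d) x → ℝ :=
        fun J x v => b.comp J (φ.base x) (φ.form x v)
      let a : Fin (Module.finrank ℝ F) → EuclideanSpace ℝ (Fin d) → ℝ :=
        fun J w => A J _ (chartVec x (extChartAt (𝓡 d) x x) w)
      extDerivOneForm (A I) x w₁ w₂
        + (1 / 2) * ∑ J, ∑ K, L.structureFun b J K I (φ.base x) *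
          (a J w₁ * a K w₂ - a J w₂ * a K w₁) = 0

/-- The metric `g = ½ 𝒮_{IJ} A^I A^J` (symmetrized product), that is
`g(u, v) = 𝒮(A u, A v)`. -/
def SymTensor.metric (T : SymTensor EM F E) (φ : BundleField EM F E d S) : MetricField d S :=
  fun x u v => T.toFun (φ.base x) (φ.form x u) (φ.form x v)

/-- Two fields are gauge equivalent if they are joined by a smooth family of solutions with
nondegenerate metrics that moves, at each time `t`, by an infinitesimal gauge transformation
`δX^i = ε^I ρ_I^i`, `δA^I = dε^I + c_{KJ}^I A^K ε^J` with parameter `ε t`. -/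
def GaugeEquivalent (L : LieAlgebroid EM F E) (T : SymTensor EM F E)
    (φ₁ φ₂ : BundleField EM F E d S) : Prop :=
  ∃ (φ : ℝ → BundleField EM F E d S) (ε : ∀ (t : ℝ) (x : S), E ((φ t).base x)),
    φ 0 = φ₁ ∧ φ 1 = φ₂ ∧
    ContMDiff (𝓘(ℝ, ℝ).prod (𝓡 d).tangent) (𝓘(ℝ, EM).prod 𝓘(ℝ, F)) ∞
      (fun q : ℝ × TangentBundle (𝓡 d) S =>
        (⟨(φ q.1).base q.2.1, (φ q.1).form q.2.1 q.2.2⟩ : TotalSpace F E)) ∧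
    ContMDiff (𝓘(ℝ, ℝ).prod (𝓡 d)) (𝓘(ℝ, EM).prod 𝓘(ℝ, F)) ∞
      (fun q : ℝ × S => (⟨(φ q.1).base q.2, ε q.1 q.2⟩ : TotalSpace F E)) ∧
    (∀ t, L.IsSolution (φ t) ∧ (T.metric (φ t)).Nondegenerate) ∧
    (∀ t x, mfderiv 𝓘(ℝ, ℝ) 𝓘(ℝ, EM) (fun s : ℝ => (φ s).base x) t (1 : ℝ)
      = L.anchor ((φ t).base x) (ε t x)) ∧
    ∀ (b : Frame EM F E) (t : ℝ) (x : S), (φ t).base x ∈ b.U →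
      ∀ (I : Fin (Module.finrank ℝ F)) (v : TangentSpace (𝓡 d) x),
        HasDerivAt (fun s : ℝ => b.comp I ((φ s).base x) ((φ s).form x v))
          (dirDeriv (fun x' : S => b.comp I ((φ t).base x') (ε t x')) x v
            + ∑ K, ∑ J, L.structureFun b K J I ((φ t).base x) *
              b.comp K ((φ t).base x) ((φ t).form x v) * b.comp J ((φ t).base x) (ε t x)) t

end Fields

variable (d) in
/-- `(E, 𝒮)` defines a reasonable (admissible) theory of `E`-gravity in dimension `d`. -/
def IsReasonable (L : LieAlgebroid EM F E) (T : SymTensor EM F E) : Prop :=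
  (∀ p : M, ∃ φ : BundleField EM F E d (EuclideanSpace ℝ (Fin d)),
    L.IsSolution φ ∧ p ∈ range φ.base ∧ (T.metric φ).Nondegenerate) ∧
  ∀ (S : Type) [TopologicalSpace S] [ChartedSpace (EuclideanSpace ℝ (Fin d)) S]
    [IsManifold (𝓡 d) ∞ S] [T2Space S] [SecondCountableTopology S]
    (φ₁ φ₂ : BundleField EM F E d S),
    L.IsSolution φ₁ → L.IsSolution φ₂ →
    (T.metric φ₁).Nondegenerate → (T.metric φ₂).Nondegenerate →
    (T.metric φ₁).IsMaximallyExtended → (T.metric φ₂).IsMaximallyExtended →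
    GaugeEquivalent L T φ₁ φ₂ →
    ∃ D : S ≃ₘ^∞⟮𝓡 d, 𝓡 d⟯ S, ∀ (x : S) (u v : TangentSpace (𝓡 d) x),
      T.metric φ₁ x u v
        = T.metric φ₂ (D x) (mfderiv (𝓡 d) (𝓡 d) D x u) (mfderiv (𝓡 d) (𝓡 d) D x v)

end Algebroid

end EGravity

end

/-! With zero anchor and zero bracket, the field equations say that `X` is locally constant and that
`A` is a closed one-form with values in a fixed fibre `E_p`; a gauge transformation adds an exact
form. A non-degenerate metric forces `v ↦ 𝒮(Av, ·)` to be injective, so the rank of `𝒮` is at least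
`d`. The question is why rank exactly `d` is what admissibility demands.

Rank `d` suffices. Then `𝒮_p` is the pullback of a non-degenerate form `B` on `ℝ^d` by a surjection
`l : E_p → ℝ^d`, and `a = l ∘ A` is a closed invertible coframe with `g = B(a, a)`. Local primitives
of `a` are charts whose transition maps are translations. Hence `g` is flat, its curvature
invariants are locally constant, and maximal extension means that all straight lines are complete.
The straight lines then give an action of the group `ℝ^d`, transitive on each connected component
(`FlatAtlas.flow_add`, `FlatAtlas.exists_eq_flow_of_mem_connectedComponent`). Gauge equivalent
solutions have `a₁ - a₀ = dλ` with `λ` the time integral of `l(ε)`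
(`GaugeEquivalent.exists_primitive`). Moving each point `x` by `-λ(x)` along the straight lines of
`a₁` is a diffeomorphism pulling `a₁` back to `a₀` (`exists_diffeomorph_of_exact`), hence an
isometry.

Larger rank fails. Then `E_p` contains `d + 1` orthogonal vectors of square `±1`, two of them with
equal sign, and any smooth map `Y` from `ℝ^d` to their span gives the solution `dY`. Take for `Y`
the universal cover of a surface of revolution times a plane, and compare it with a cylinder times a
plane. The linear homotopy between them stays non-degenerate, so the solutions are gauge equivalent
(`gaugeEquivalent_exactField`). Both are geodesically complete, but only the second is flat
(`exists_nonisometric`). -/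

noncomputable section

set_option linter.unusedSectionVars false

namespace EGravity

/-! ### Atlases whose transition maps are translations -/

/-- An atlas of charts with values in a normed space `V`, one around each point, whose transition
maps are locally translations. -/
structure FlatAtlas (S V : Type*) [TopologicalSpace S] [NormedAddCommGroup V] where
  chart : S → OpenPartialHomeomorph S V
  mem_source : ∀ x, x ∈ (chart x).source
  compat : ∀ x z, z ∈ (chart x).source →
    ∀ᶠ y in 𝓝 z, chart z y - chart z z = chart x y - chart x z

namespace FlatAtlas

variable {S V : Type*} [TopologicalSpace S] [NormedAddCommGroup V] [NormedSpace ℝ V]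
  (A : FlatAtlas S V)

/-- The curve `c` is a straight line of velocity `w` near the time `t`. -/
def IsLineAt (c : ℝ → S) (w : V) (t : ℝ) : Prop :=
  ContinuousAt c t ∧ ∀ᶠ s in 𝓝 t, A.chart (c t) (c s) = A.chart (c t) (c t) + (s - t) • w

variable {A}

theorem IsLineAt.congr {c c' : ℝ → S} {w : V} {t : ℝ} (h : A.IsLineAt c w t)
    (hc : c' =ᶠ[𝓝 t] c) : A.IsLineAt c' w t := by
  refine ⟨h.1.congr hc.symm, ?_⟩
  filter_upwards [h.2, hc] with s h1 h2
  rw [hc.self_of_nhds, h2, h1]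

theorem IsLineAt.comp_add {c : ℝ → S} {w : V} {t a : ℝ} (h : A.IsLineAt c w (t + a)) :
    A.IsLineAt (fun s => c (s + a)) w t := by
  have ht : Tendsto (fun s : ℝ => s + a) (𝓝 t) (𝓝 (t + a)) := by
    exact (continuous_id.add continuous_const).continuousAt
  refine ⟨ContinuousAt.comp (g := c) (f := fun s : ℝ => s + a) h.1 ht, ?_⟩
  filter_upwards [ht.eventually h.2] with s hs
  rw [hs]; congr 2; ring

theorem IsLineAt.comp_mul {c : ℝ → S} {w : V} {t k : ℝ} (h : A.IsLineAt c w (k * t)) :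
    A.IsLineAt (fun s => c (k * s)) (k • w) t := by
  have ht : Tendsto (fun s : ℝ => k * s) (𝓝 t) (𝓝 (k * t)) := by
    exact (continuous_const.mul continuous_id).continuousAt
  refine ⟨ContinuousAt.comp (g := c) (f := fun s : ℝ => k * s) h.1 ht, ?_⟩
  filter_upwards [ht.eventually h.2] with s hs
  rw [hs, smul_smul]; congr 2; ring

theorem IsLineAt.of_chart {c : ℝ → S} {w : V} {t : ℝ} {x : S} (hc : ContinuousAt c t)
    (hx : c t ∈ (A.chart x).source)
    (h : ∀ᶠ s in 𝓝 t, A.chart x (c s) = A.chart x (c t) + (s - t) • w) : A.IsLineAt c w t := by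
  refine ⟨hc, ?_⟩
  filter_upwards [h, hc.eventually (A.compat x (c t) hx)] with s h1 h2
  rw [h1] at h2
  rw [← sub_eq_iff_eq_add', h2]; abel

theorem IsLineAt.eventuallyEq {c c' : ℝ → S} {w : V} {t : ℝ} (h : A.IsLineAt c w t)
    (h' : A.IsLineAt c' w t) (e : c t = c' t) : c =ᶠ[𝓝 t] c' := by
  have s1 := h.1.eventually ((A.chart (c t)).open_source.mem_nhds (A.mem_source _))
  have s2 := h'.1.eventually ((A.chart (c' t)).open_source.mem_nhds (A.mem_source _))
  filter_upwards [h.2, h'.2, s1, s2] with s h1 h2 m1 m2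
  rw [← e] at h2 m2
  exact (A.chart (c t)).injOn m1 m2 (h1.trans h2.symm)

/-- Agreement is an open condition because lines are determined locally by one point and the
velocity, and disagreement is open because the space is Hausdorff. So the truth value of `c t = c'
t` is locally constant on the connected set `J`. -/
theorem eqOn_of_isLineAt [T2Space S] {c c' : ℝ → S} {w : V} {J : Set ℝ} (hJ : IsPreconnected J)
    (h : ∀ t ∈ J, A.IsLineAt c w t) (h' : ∀ t ∈ J, A.IsLineAt c' w t) {t₀ : ℝ} (ht₀ : t₀ ∈ J)
    (e : c t₀ = c' t₀) : EqOn c c' J := by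
  have key : ∀ t ∈ J, ∀ᶠ s in 𝓝 t, (c s = c' s) = (c t = c' t) := by
    intro t ht
    by_cases hct : c t = c' t
    · filter_upwards [(h t ht).eventuallyEq (h' t ht) hct] with s hs
      simp [hs, hct]
    · filter_upwards [((h t ht).1.ne_iff_eventually_ne (h' t ht).1).1 hct] with s hs
      simp [hs, hct]
  have : PreconnectedSpace J := Subtype.preconnectedSpace hJ
  have hl : IsLocallyConstant (fun t : J => c t = c' t) := by
    rw [IsLocallyConstant.iff_eventually_eq]
    intro t
    exact continuous_subtype_val.continuousAt.eventually (key t t.2)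
  intro t ht
  have := hl.apply_eq_of_preconnectedSpace ⟨t, ht⟩ ⟨t₀, ht₀⟩
  simp only [e, eq_iff_iff, iff_true] at this
  exact this

variable (A)

/-- Every straight line extends to all times. -/
def Complete : Prop :=
  ∀ (x : S) (w : V), ∃ c : ℝ → S, c 0 = x ∧ ∀ t, A.IsLineAt c w t

variable {A}

/-- Maximal extension continues geodesics only towards positive parameters. The backward half comes
from the line of velocity `-w` run in reverse; both halves are defined near time `0` and agree there
by uniqueness. -/
theorem complete_of_forward [T2Space S]
    (h : ∀ (x : S) (w : V), ∃ c : ℝ → S, c 0 = x ∧ ∃ δ > 0, ∀ t > -δ, A.IsLineAt c w t) :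
    A.Complete := by
  intro x w
  obtain ⟨c, hc, δ, hδ, hl⟩ := h x w
  obtain ⟨c', hc', δ', hδ', hl'⟩ := h x (-w)
  have hr : ∀ t < δ', A.IsLineAt (fun s => c' (-1 * s)) w t := by
    intro t ht
    have := (hl' (-1 * t) (by linarith)).comp_mul
    simpa using this
  have heq : EqOn c (fun s => c' (-1 * s)) (Ioo (-δ) δ') :=
    eqOn_of_isLineAt isPreconnected_Ioo (fun t ht => hl t ht.1) (fun t ht => hr t ht.2)
      (show (0 : ℝ) ∈ Ioo (-δ) δ' from ⟨by linarith, hδ'⟩) (by simp [hc, hc'])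
  refine ⟨fun t => if -δ < t then c t else c' (-1 * t), by simp [hδ, hc], fun t => ?_⟩
  by_cases ht : -δ < t
  · refine (hl t ht).congr ?_
    filter_upwards [isOpen_Ioi.mem_nhds ht] with s hs
    rw [if_pos (mem_Ioi.1 hs)]
  · have ht' : t < δ' := by linarith
    refine (hr t ht').congr ?_
    filter_upwards [isOpen_Iio.mem_nhds ht'] with s hs
    split_ifs with h1
    · exact heq ⟨h1, hs⟩
    · rfl

/-- The point with coordinates `u` relative to `x`. -/
def move (A : FlatAtlas S V) (x : S) (u : V) : S := (A.chart x).symm (A.chart x x + u)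

theorem move_chart_sub (x y : S) (hy : y ∈ (A.chart x).source) :
    A.move x (A.chart x y - A.chart x x) = y := by
  rw [move, add_sub_cancel, (A.chart x).left_inv hy]

theorem continuousAt_move (x : S) : ContinuousAt (A.move x) 0 := by
  refine ContinuousAt.comp (g := (A.chart x).symm) (f := fun u => A.chart x x + u) ?_
    (by fun_prop)
  refine (A.chart x).continuousAt_symm ?_
  simpa using (A.chart x).map_source (A.mem_source x)

theorem move_zero (x : S) : A.move x 0 = x := by
  simp [move, (A.chart x).left_inv (A.mem_source x)]

theorem eventually_chart_move (x : S) :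
    ∀ᶠ u in 𝓝 (0 : V), A.chart x (A.move x u) = A.chart x x + u := by
  have : Tendsto (fun u : V => A.chart x x + u) (𝓝 0) (𝓝 (A.chart x x)) := by
    have : ContinuousAt (fun u : V => A.chart x x + u) 0 := by fun_prop
    simpa [ContinuousAt] using this
  filter_upwards [this.eventually ((A.chart x).open_target.mem_nhds
    ((A.chart x).map_source (A.mem_source x)))] with u hu
  exact (A.chart x).right_inv hu

/-- The flow of straight lines. -/
def flow (hA : A.Complete) (w : V) (x : S) : S := (hA x w).choose 1

/-! ### The action of the translation group on a complete flat atlas. -/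

section Flow

variable [T2Space S] (hA : A.Complete)

theorem IsLineAt.eq_flow {c : ℝ → S} {w : V} (hc : ∀ t, A.IsLineAt c w t) (t : ℝ) :
    c t = flow hA (t • w) (c 0) := by
  obtain ⟨h0, hl⟩ := (hA (c 0) (t • w)).choose_spec
  have := eqOn_of_isLineAt isPreconnected_univ (c := fun s => c (t * s))
    (fun s _ => (hc (t * s)).comp_mul) (fun s _ => hl s) (mem_univ (0 : ℝ)) (by simp [h0])
    (mem_univ 1)
  simpa [flow] using this

theorem isLineAt_flow (w : V) (x : S) (t : ℝ) :
    A.IsLineAt (fun s => flow hA (s • w) x) w t := by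
  obtain ⟨h0, hl⟩ := (hA x w).choose_spec
  refine (hl t).congr (Eventually.of_forall fun s => ?_)
  have := IsLineAt.eq_flow hA hl s
  rw [h0] at this
  exact this.symm

theorem flow_zero (x : S) : flow hA 0 x = x := by
  obtain ⟨h0, hl⟩ := (hA x 0).choose_spec
  have := IsLineAt.eq_flow hA hl 0
  rw [h0] at this
  simpa using this.symm

theorem flow_add_smul (s t : ℝ) (w : V) (x : S) :
    flow hA ((s + t) • w) x = flow hA (s • w) (flow hA (t • w) x) := by
  have := IsLineAt.eq_flow hA (c := fun s => flow hA ((s + t) • w) x) (w := w)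
    (fun s => (isLineAt_flow hA w x (s + t)).comp_add) s
  simpa using this

/-- Within a ball contained in a chart the flow is addition of coordinates. The point is that one
radius serves all starting points and displacements whose endpoints stay in the ball, since the
whole segment then stays there by convexity. -/
theorem exists_flow_move (x : S) : ∃ r > 0, ∀ u u' : V, ‖u‖ < r → ‖u + u'‖ < r →
    flow hA u' (A.move x u) = A.move x (u + u') := by
  obtain ⟨r, hr, hb⟩ := Metric.isOpen_iff.1 (A.chart x).open_target _
    ((A.chart x).map_source (A.mem_source x))
  refine ⟨r, hr, fun u u' hu hu' => ?_⟩
  set J : Set ℝ := {s | ‖u + s • u'‖ < r} with hJ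
  have hJc : Convex ℝ J := by
    have : J = (AffineMap.lineMap u (u + u') : ℝ →ᵃ[ℝ] V) ⁻¹' Metric.ball 0 r := by
      ext s
      simp [hJ, AffineMap.lineMap_apply, add_comm]
    rw [this]
    exact (convex_ball _ _).affine_preimage _
  have hJo : IsOpen J := isOpen_lt (by fun_prop) continuous_const
  have hmem : ∀ s ∈ J, A.chart x x + (u + s • u') ∈ (A.chart x).target := by
    intro s hs
    apply hb
    have hs' : ‖u + s • u'‖ < r := hs
    simpa [Metric.mem_ball, dist_eq_norm] using hs'
  have hl : ∀ s ∈ J, A.IsLineAt (fun s => A.move x (u + s • u')) u' s := by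
    intro s hs
    refine IsLineAt.of_chart (x := x) ?_ ?_ ?_
    · refine ContinuousAt.comp (g := (A.chart x).symm)
        (f := fun s : ℝ => A.chart x x + (u + s • u')) ?_ (by fun_prop)
      exact (A.chart x).continuousAt_symm (hmem s hs)
    · exact (A.chart x).map_target (hmem s hs)
    · filter_upwards [hJo.mem_nhds hs] with s' hs'
      rw [move, move, (A.chart x).right_inv (hmem s hs), (A.chart x).right_inv (hmem s' hs')]
      module
  have := eqOn_of_isLineAt hJc.isPreconnected hl
    (fun s _ => isLineAt_flow hA u' (A.move x u) s) (t₀ := 0) (by simpa [hJ] using hu)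
    (by simp [flow_zero hA]) (show (1 : ℝ) ∈ J by simpa [hJ] using hu')
  simpa using this.symm

theorem eventually_flow_eq_move (x : S) : ∀ᶠ u in 𝓝 (0 : V), flow hA u x = A.move x u := by
  obtain ⟨r, hr, h⟩ := exists_flow_move hA x
  filter_upwards [Metric.ball_mem_nhds (0 : V) hr] with u hu
  have := h 0 u (by simpa) (by simpa using hu)
  rwa [move_zero, zero_add] at this

/-- Long translations are not visible in one chart, so commutation with small translations is
propagated along the segment `s • u`. The set of good `s` is open and closed and contains `0`. -/
theorem eventually_flow_comm (u : V) (y : S) :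
    ∀ᶠ h in 𝓝 (0 : V), flow hA u (flow hA h y) = flow hA h (flow hA u y) := by
  set Q : ℝ → Prop := fun s =>
    ∀ᶠ h in 𝓝 (0 : V), flow hA (s • u) (flow hA h y) = flow hA h (flow hA (s • u) y) with hQ
  -- For `s` close to `s₀` everything takes place in the chart around the point reached at time
  -- `s₀`, where translations visibly commute. The bounds `r / 2` keep sums of two displacements in
  -- the ball of radius `r`.
  have key : ∀ s₀, ∀ᶠ s in 𝓝 s₀, (Q s ↔ Q s₀) := by
    intro s₀
    set z := flow hA (s₀ • u) y with hz
    obtain ⟨r, hr, hm⟩ := exists_flow_move hA z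
    have hc : ∀ᶠ s in 𝓝 s₀, ‖(s - s₀) • u‖ < r / 2 := by
      have : ContinuousAt (fun s : ℝ => ‖(s - s₀) • u‖) s₀ := by fun_prop
      exact this.eventually (Iio_mem_nhds (by simpa using hr))
    filter_upwards [hc] with s hs
    set δ := (s - s₀) • u with hδ
    have e1 : ∀ x, flow hA (s • u) x = flow hA δ (flow hA (s₀ • u) x) := by
      intro x
      rw [hδ, ← flow_add_smul]; congr 2; ring
    have e2 : ∀ x, flow hA (s₀ • u) x = flow hA (-δ) (flow hA (s • u) x) := by
      intro x
      rw [hδ, ← neg_smul, ← flow_add_smul]; congr 2; ring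
    have hball : ∀ᶠ h in 𝓝 (0 : V), ‖h‖ < r / 2 := by
      filter_upwards [Metric.ball_mem_nhds (0 : V) (half_pos hr)] with h hh
      simpa using hh
    have m1 : flow hA δ z = A.move z δ := by
      have := hm 0 δ (by simpa) (by rw [zero_add]; linarith)
      rwa [move_zero, zero_add] at this
    have m2 : ∀ h, ‖h‖ < r / 2 → flow hA h z = A.move z h := by
      intro h hh
      have := hm 0 h (by simpa) (by rw [zero_add]; linarith)
      rwa [move_zero, zero_add] at this
    have m3 : ∀ h, ‖h‖ < r / 2 → flow hA h (A.move z δ) = A.move z (δ + h) := fun h hh =>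
      hm δ h (by linarith) (by linarith [norm_add_le δ h])
    constructor
    · intro hs
      filter_upwards [hs, hball] with h h1 h2
      rw [e2, h1, e1, ← hz, m1, m3 h h2, hm (δ + h) (-δ) (by linarith [norm_add_le δ h])
        (by simpa using by linarith), m2 h h2]
      congr 1; abel
    · intro hs
      filter_upwards [hs, hball] with h h1 h2
      rw [e1, h1, e1, ← hz, m1, m3 h h2, m2 h h2, hm h δ (by linarith)
        (by linarith [norm_add_le h δ]), add_comm]
  have hclopen : IsClopen {s | Q s} := by
    constructor
    · rw [← isOpen_compl_iff, isOpen_iff_mem_nhds]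
      intro s hs
      filter_upwards [key s] with s' h' hq using hs (h'.1 hq)
    · rw [isOpen_iff_mem_nhds]
      intro s hs
      filter_upwards [key s] with s' h' using h'.2 hs
  have h0 : Q 0 := by
    refine Eventually.of_forall fun h => ?_
    simp [flow_zero hA]
  have : (1 : ℝ) ∈ {s | Q s} := by
    rw [hclopen.eq_univ ⟨0, h0⟩]; trivial
  simpa [hQ] using this

/-- The curve that flows by `s • w` and then by `s • u` is itself a straight line of velocity `u +
w`. Near a time `t` this needs only that the full translation by `t • u` commutes with the small one
by `(s - t) • w`; uniqueness of lines concludes. -/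
theorem flow_add (u w : V) (x : S) : flow hA (u + w) x = flow hA u (flow hA w x) := by
  have hl : ∀ t, A.IsLineAt (fun s => flow hA (s • u) (flow hA (s • w) x)) (u + w) t := by
    intro t
    set z := flow hA (t • u) (flow hA (t • w) x) with hz
    obtain ⟨r, hr, hm⟩ := exists_flow_move hA z
    have hlim : ∀ v : V, Tendsto (fun s : ℝ => (s - t) • v) (𝓝 t) (𝓝 0) := by
      intro v
      have : ContinuousAt (fun s : ℝ => (s - t) • v) t := by fun_prop
      simpa [ContinuousAt] using this
    have hev : ∀ᶠ s in 𝓝 t, flow hA (s • u) (flow hA (s • w) x) = A.move z ((s - t) • (u + w)) := by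
      filter_upwards [(hlim w).eventually (eventually_flow_comm hA (t • u) (flow hA (t • w) x)),
        (hlim w).eventually (Metric.ball_mem_nhds (0 : V) hr),
        (hlim (u + w)).eventually (Metric.ball_mem_nhds (0 : V) hr)] with s h1 h2 h3
      have e : ∀ (v : V) y, flow hA (s • v) y = flow hA ((s - t) • v) (flow hA (t • v) y) := by
        intro v y
        rw [← flow_add_smul]; congr 2; ring
      have e' : ∀ (v : V) y, flow hA (s • v) y = flow hA ((s - t) • v) (flow hA (t • v) y) := e
      have f1 : flow hA ((s - t) • w) z = A.move z ((s - t) • w) := by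
        have := hm 0 ((s - t) • w) (by simpa) (by simpa using h2)
        rwa [move_zero, zero_add] at this
      rw [e u, e w, h1, ← hz, f1, hm _ _ (by simpa using h2)]
      · congr 1; module
      · rw [← smul_add, add_comm w u]; simpa using h3
    have hz' : A.move z 0 = z := move_zero z
    refine IsLineAt.congr (c := fun s => A.move z ((s - t) • (u + w))) ?_ hev
    refine IsLineAt.of_chart (x := z) ?_ ?_ ?_
    · refine ContinuousAt.comp (g := A.move z) (f := fun s => (s - t) • (u + w)) ?_ (by fun_prop)
      simpa using continuousAt_move z
    · simpa [hz'] using A.mem_source z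
    · filter_upwards [(hlim (u + w)).eventually (eventually_chart_move z)] with s hs
      rw [hs]; simp [hz']
  have := IsLineAt.eq_flow hA hl 1
  simp only [one_smul, zero_smul, flow_zero] at this
  exact this.symm

theorem flow_neg_flow (w : V) (x : S) : flow hA (-w) (flow hA w x) = x := by
  rw [← flow_add, neg_add_cancel, flow_zero]

theorem continuous_flow_smul (w : V) (x : S) : Continuous fun s : ℝ => flow hA (s • w) x :=
  continuous_iff_continuousAt.2 fun t => (isLineAt_flow hA w x t).1

theorem flow_mem_connectedComponent (w : V) (x : S) : flow hA w x ∈ connectedComponent x := by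
  have := (isPreconnected_range (continuous_flow_smul hA w x)).subset_connectedComponent
    (x := x) ⟨0, by simp [flow_zero hA]⟩
  exact this ⟨1, by simp⟩

theorem eventually_eq_flow (x : S) : ∀ᶠ y in 𝓝 x, y = flow hA (A.chart x y - A.chart x x) x := by
  have hc : Tendsto (fun y => A.chart x y - A.chart x x) (𝓝 x) (𝓝 0) := by
    have : ContinuousAt (fun y => A.chart x y - A.chart x x) x :=
      ((A.chart x).continuousAt (A.mem_source x)).sub continuousAt_const
    simpa [ContinuousAt] using this
  filter_upwards [hc.eventually (eventually_flow_eq_move hA x),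
    (A.chart x).open_source.mem_nhds (A.mem_source x)] with y h1 h2
  rw [h1, move_chart_sub x y h2]

/-- Orbits are open because every nearby point is reached by a small translation, and their
complements are open for the same reason. -/
theorem exists_eq_flow_of_mem_connectedComponent {x y : S} (h : y ∈ connectedComponent x) :
    ∃ w, y = flow hA w x := by
  have hcl : IsClopen {y | ∃ w, y = flow hA w x} := by
    constructor
    · rw [← isOpen_compl_iff, isOpen_iff_mem_nhds]
      intro y hy
      filter_upwards [eventually_eq_flow hA y] with z hz
      rintro ⟨w, hw⟩
      refine hy ⟨-(A.chart y z - A.chart y y) + w, ?_⟩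
      have := congrArg (flow hA (-(A.chart y z - A.chart y y))) hz
      rw [flow_neg_flow] at this
      rw [flow_add, ← hw, this]
    · rw [isOpen_iff_mem_nhds]
      rintro y ⟨w, rfl⟩
      filter_upwards [eventually_eq_flow hA (flow hA w x)] with z hz
      exact ⟨_, hz.trans (flow_add hA _ _ _).symm⟩
  exact hcl.connectedComponent_subset (x := x) ⟨0, (flow_zero hA x).symm⟩ h

end Flow

/-! ### Maps that are translations in the charts -/

variable {A₀ A₁ : FlatAtlas S V}

/-- `D` is, in the charts of the two atlases, locally a translation. -/
def IsFlatMap (A₀ A₁ : FlatAtlas S V) (D : S → S) : Prop :=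
  ∀ x, ContinuousAt D x ∧ ∀ᶠ y in 𝓝 x,
    A₁.chart (D x) (D y) - A₁.chart (D x) (D x) = A₀.chart x y - A₀.chart x x

section FlatMap

variable [T2Space S] (h₀ : A₀.Complete) (h₁ : A₁.Complete)

/-- A flat map carries straight lines to straight lines of the same velocity, hence intertwines the
two actions. -/
theorem IsFlatMap.map_flow {D : S → S} (hD : IsFlatMap A₀ A₁ D) (w : V) (x : S) :
    D (flow h₀ w x) = flow h₁ w (D x) := by
  have hl : ∀ t, A₁.IsLineAt (fun s => D (flow h₀ (s • w) x)) w t := by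
    intro t
    obtain ⟨hc, hl⟩ := isLineAt_flow h₀ w x t
    obtain ⟨hDc, hDl⟩ := hD (flow h₀ (t • w) x)
    refine ⟨ContinuousAt.comp (g := D) hDc hc, ?_⟩
    filter_upwards [hl, hc.eventually hDl] with s h1 h2
    rw [← sub_eq_iff_eq_add', h2, h1]; abel
  have := IsLineAt.eq_flow h₁ hl 1
  simpa [flow_zero h₀] using this

/-- The translation by `-lam` along the straight lines. -/
def shift (h₁ : A₁.Complete) (lam : S → V) (x : S) : S := flow h₁ (-lam x) x

/-- The hypothesis says `d(chart₁) - d(lam) = d(chart₀)` in finite form. Moving by `-lam` subtracts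
`lam` from the coordinates of the second atlas, so the increments of the image are those of the
first atlas. The variation of `lam` is combined with the displacement by `flow_add`. -/
theorem isFlatMap_shift {lam : S → V}
    (hlam : ∀ x, ∀ᶠ y in 𝓝 x, A₁.chart x y - A₁.chart x x - (lam y - lam x)
      = A₀.chart x y - A₀.chart x x) : IsFlatMap A₀ A₁ (shift h₁ lam) := by
  intro x
  set z := shift h₁ lam x with hz
  have hc : Tendsto (fun y => A₀.chart x y - A₀.chart x x) (𝓝 x) (𝓝 0) := by
    have : ContinuousAt (fun y => A₀.chart x y - A₀.chart x x) x :=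
      ((A₀.chart x).continuousAt (A₀.mem_source x)).sub continuousAt_const
    simpa [ContinuousAt] using this
  have hev : ∀ᶠ y in 𝓝 x, shift h₁ lam y = A₁.move z (A₀.chart x y - A₀.chart x x) := by
    filter_upwards [hlam x, eventually_eq_flow h₁ x,
      hc.eventually (eventually_flow_eq_move h₁ z)] with y h1 h2 h3
    rw [← h3, ← h1]
    conv_lhs => rw [shift, h2]
    rw [hz, shift, ← flow_add, ← flow_add, ← h2]
    congr 1; abel
  have hmc : ContinuousAt (fun y => A₁.move z (A₀.chart x y - A₀.chart x x)) x := by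
    refine ContinuousAt.comp (g := A₁.move z) ?_ ?_
    · simpa using continuousAt_move z
    · exact ((A₀.chart x).continuousAt (A₀.mem_source x)).sub continuousAt_const
  refine ⟨hmc.congr (hev.mono fun _ h => h.symm), ?_⟩
  filter_upwards [hev, hc.eventually (eventually_chart_move z)] with y h1 h2
  rw [h1, h2]; abel

/-- The preimage is explicit: flow from `y` by `lam y` in the first atlas. The map turns this into
the flow by `lam y` in the second atlas, which cancels the shift of `y`. -/
theorem shift_surjective {lam : S → V} (hD : IsFlatMap A₀ A₁ (shift h₁ lam)) (h₀ : A₀.Complete) :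
    Function.Surjective (shift h₁ lam) := by
  intro y
  refine ⟨flow h₀ (lam y) y, ?_⟩
  rw [hD.map_flow h₀ h₁, shift, ← flow_add, add_neg_cancel, flow_zero]

theorem shift_bijective {lam : S → V}
    (hlam : ∀ x, ∀ᶠ y in 𝓝 x, A₁.chart x y - A₁.chart x x - (lam y - lam x)
      = A₀.chart x y - A₀.chart x x) (h₀ : A₀.Complete) :
    Function.Bijective (shift h₁ lam) := by
  have hD := isFlatMap_shift h₁ hlam
  refine ⟨fun x y hxy => ?_, shift_surjective h₁ hD h₀⟩
  -- The shift in the opposite direction is flat as well. It need not be the inverse map; it serves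
  -- to carry periods of the second action back to the first.
  have hD' : IsFlatMap A₁ A₀ (shift h₀ (-lam)) := isFlatMap_shift h₀ fun x => by
    filter_upwards [hlam x] with y hy
    rw [← hy]; simp; abel
  have hcc : connectedComponent x = connectedComponent y := by
    rw [connectedComponent_eq (flow_mem_connectedComponent h₁ (-lam x) x),
      connectedComponent_eq (flow_mem_connectedComponent h₁ (-lam y) y)]
    exact congrArg _ hxy
  -- Equal images make `w` a period of the image point for the second action. The opposite shift
  -- turns it into a period of some point in the component of `x` for the first action. Translations
  -- commute and are transitive there, so `w` is a period of `x` itself and the two points coincide.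
  obtain ⟨w, rfl⟩ := exists_eq_flow_of_mem_connectedComponent h₀
    (hcc ▸ mem_connectedComponent : y ∈ connectedComponent x)
  have e1 := hD.map_flow h₀ h₁ w x
  rw [← hxy] at e1
  have e2 := hD'.map_flow h₁ h₀ w (shift h₁ lam x)
  rw [← e1] at e2
  have hz : shift h₀ (-lam) (shift h₁ lam x) ∈ connectedComponent x := by
    rw [connectedComponent_eq (flow_mem_connectedComponent h₁ (-lam x) x)]
    exact flow_mem_connectedComponent h₀ _ _
  obtain ⟨v, hv⟩ := exists_eq_flow_of_mem_connectedComponent h₀ hz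
  rw [hv, ← flow_add, add_comm, flow_add] at e2
  have := congrArg (flow h₀ (-v)) e2
  rwa [flow_neg_flow, flow_neg_flow] at this

/-- The local form of the inverse of a bijective flat map. -/
theorem IsFlatMap.eventually_rightInverse {D G : S → S} (hD : IsFlatMap A₀ A₁ D)
    (hGD : Function.LeftInverse G D) (x : S) :
    ∀ᶠ y in 𝓝 (D x), G y = A₀.move x (A₁.chart (D x) y - A₁.chart (D x) (D x)) := by
  have hc : Tendsto (fun y => A₁.chart (D x) y - A₁.chart (D x) (D x)) (𝓝 (D x)) (𝓝 0) := by
    have : ContinuousAt (fun y => A₁.chart (D x) y - A₁.chart (D x) (D x)) (D x) :=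
      ((A₁.chart (D x)).continuousAt (A₁.mem_source _)).sub continuousAt_const
    simpa [ContinuousAt] using this
  have hm : Tendsto (fun y => A₀.move x (A₁.chart (D x) y - A₁.chart (D x) (D x)))
      (𝓝 (D x)) (𝓝 x) := by
    have := (continuousAt_move (A := A₀) x).tendsto.comp hc
    rwa [move_zero] at this
  have hDm : Tendsto (fun y => D (A₀.move x (A₁.chart (D x) y - A₁.chart (D x) (D x))))
      (𝓝 (D x)) (𝓝 (D x)) := (hD x).1.tendsto.comp hm
  filter_upwards [hm.eventually (hD x).2, hc.eventually (eventually_chart_move (A := A₀) x),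
    hDm.eventually ((A₁.chart (D x)).open_source.mem_nhds (A₁.mem_source _)),
    (A₁.chart (D x)).open_source.mem_nhds (A₁.mem_source _)] with y h1 h2 h3 h4
  rw [h2, add_sub_cancel_left, sub_left_inj] at h1
  have := (A₁.chart (D x)).injOn h3 h4 h1
  conv_lhs => rw [← this]
  exact hGD _

end FlatMap

end FlatAtlas

theorem two_le_infty : (2 : WithTop ℕ∞) ≤ ∞ :=
  WithTop.coe_le_coe.2 (le_top : (2 : ℕ∞) ≤ ⊤)

/-! ### Metrics with a closed coframe, in coordinates -/

section Coordinates

variable {d : ℕ} {S : Type} [TopologicalSpace S] [ChartedSpace (EuclideanSpace ℝ (Fin d)) S]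

theorem euclideanSpace_eq_sum (v : EuclideanSpace ℝ (Fin d)) :
    v = ∑ i, v i • EuclideanSpace.single i (1 : ℝ) := by
  have := (EuclideanSpace.basisFun (Fin d) ℝ).sum_repr v
  simpa using this.symm

theorem sum_smul_single_apply (c : Fin d → ℝ) (k : Fin d) :
    (∑ i, c i • EuclideanSpace.single i (1 : ℝ) : EuclideanSpace ℝ (Fin d)) k = c k := by
  simp [Finset.sum_apply, Pi.single_apply]

/-- Near the point `y`, the components `G` are those of the pullback of the constant bilinear form
`B` by the closed one-form `e`. -/
structure IsClosedCoframeAt (G : EuclideanSpace ℝ (Fin d) → Matrix (Fin d) (Fin d) ℝ)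
    (B : EuclideanSpace ℝ (Fin d) →L[ℝ] EuclideanSpace ℝ (Fin d) →L[ℝ] ℝ)
    (e : EuclideanSpace ℝ (Fin d) → EuclideanSpace ℝ (Fin d) →L[ℝ] EuclideanSpace ℝ (Fin d))
    (y : EuclideanSpace ℝ (Fin d)) : Prop where
  symm : ∀ v w, B v w = B w v
  nondeg : ∀ v, (∀ w, B v w = 0) → v = 0
  eq : ∀ᶠ z in 𝓝 y, ∀ i j,
    G z i j = B (e z (EuclideanSpace.single i 1)) (e z (EuclideanSpace.single j 1))
  eventually_contDiffAt : ∀ᶠ z in 𝓝 y, ContDiffAt ℝ ∞ e z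
  closed : ∀ᶠ z in 𝓝 y, ∀ v w, fderiv ℝ e z v w = fderiv ℝ e z w v
  injective : Function.Injective (e y)

namespace IsClosedCoframeAt

variable {G : EuclideanSpace ℝ (Fin d) → Matrix (Fin d) (Fin d) ℝ}
    {B : EuclideanSpace ℝ (Fin d) →L[ℝ] EuclideanSpace ℝ (Fin d) →L[ℝ] ℝ}
    {e : EuclideanSpace ℝ (Fin d) → EuclideanSpace ℝ (Fin d) →L[ℝ] EuclideanSpace ℝ (Fin d)}
    {y : EuclideanSpace ℝ (Fin d)}

theorem contDiffAt (h : IsClosedCoframeAt G B e y) : ContDiffAt ℝ ∞ e y :=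
  h.eventually_contDiffAt.self_of_nhds

theorem differentiableAt (h : IsClosedCoframeAt G B e y) : DifferentiableAt ℝ e y :=
  h.contDiffAt.differentiableAt (by simp)

theorem bijective (h : IsClosedCoframeAt G B e y) : Function.Bijective (e y) :=
  ⟨h.injective, (LinearMap.injective_iff_surjective (f := (e y).toLinearMap)).1 h.injective⟩

theorem eventually (h : IsClosedCoframeAt G B e y) :
    ∀ᶠ z in 𝓝 y, IsClosedCoframeAt G B e z := by
  have hinv : ∀ᶠ z in 𝓝 y, Function.Injective (e z) := by
    have : ∀ᶠ z in 𝓝 y, e z ∈ range ((↑) : (EuclideanSpace ℝ (Fin d) ≃L[ℝ]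
        EuclideanSpace ℝ (Fin d)) → _) := by
      refine h.differentiableAt.continuousAt.eventually (ContinuousLinearEquiv.nhds
        (ContinuousLinearEquiv.ofBijective (e y) ?_ ?_))
      · exact LinearMap.ker_eq_bot.2 h.injective
      · exact LinearMap.range_eq_top.2 h.bijective.2
    filter_upwards [this] with z hz
    obtain ⟨e', he'⟩ := hz
    rw [← he']
    exact e'.injective
  filter_upwards [h.eq.eventually_nhds, h.closed.eventually_nhds, hinv,
    h.eventually_contDiffAt.eventually_nhds] with z h1 h2 h3 h4
  exact ⟨h.symm, h.nondeg, h1, h4, h2, h3⟩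

theorem partialD_eq (h : IsClosedCoframeAt G B e y) (i j l : Fin d) :
    partialD i (fun z => G z j l) y
      = B (fderiv ℝ e y (EuclideanSpace.single i 1) (EuclideanSpace.single j 1))
          (e y (EuclideanSpace.single l 1))
        + B (e y (EuclideanSpace.single j 1))
          (fderiv ℝ e y (EuclideanSpace.single i 1) (EuclideanSpace.single l 1)) := by
  have h1 : (fun z => G z j l) =ᶠ[𝓝 y] fun z =>
      B (e z (EuclideanSpace.single j 1)) (e z (EuclideanSpace.single l 1)) := by
    filter_upwards [h.eq] with z hz using hz j l
  have he := h.differentiableAt.hasFDerivAt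
  have hv : ∀ w, HasFDerivAt (fun z => e z w) ((fderiv ℝ e y).flip w) y := fun w => by
    have := he.clm_apply (hasFDerivAt_const w y)
    refine this.congr_fderiv ?_
    ext; simp
  have h2 := B.hasFDerivAt_of_bilinear (hv (EuclideanSpace.single j 1))
    (hv (EuclideanSpace.single l 1))
  rw [partialD, h1.fderiv_eq, h2.fderiv]
  simp [add_comm]

/-- The Gram matrix of the coframe. -/
theorem coord_eq (h : IsClosedCoframeAt G B e y) :
    G y = (Matrix.of fun a i => e y (EuclideanSpace.single i 1) a).transpose *
      (Matrix.of fun a b => B (EuclideanSpace.single a 1) (EuclideanSpace.single b 1)) *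
      (Matrix.of fun a i => e y (EuclideanSpace.single i 1) a) := by
  ext i j
  rw [h.eq.self_of_nhds i j]
  conv_lhs => rw [euclideanSpace_eq_sum (e y (EuclideanSpace.single i 1)),
    euclideanSpace_eq_sum (e y (EuclideanSpace.single j 1))]
  simp only [map_sum, map_smul, ContinuousLinearMap.sum_apply, ContinuousLinearMap.smul_apply,
    smul_eq_mul, Matrix.mul_apply, Matrix.transpose_apply, Matrix.of_apply, Finset.sum_mul,
    Finset.mul_sum]
  refine Finset.sum_congr rfl fun a _ => Finset.sum_congr rfl fun b _ => ?_
  ring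

theorem isUnit_det_form (h : IsClosedCoframeAt G B e y) :
    IsUnit (Matrix.of fun a b => B (EuclideanSpace.single a 1)
      (EuclideanSpace.single b (1 : ℝ))).det := by
  rw [isUnit_iff_ne_zero]
  intro h0
  obtain ⟨v, hv, hv0⟩ := Matrix.exists_vecMul_eq_zero_iff.2 h0
  apply hv
  have : (∑ i, v i • EuclideanSpace.single i (1 : ℝ) : EuclideanSpace ℝ (Fin d)) = 0 := by
    apply h.nondeg
    intro w
    rw [euclideanSpace_eq_sum w, map_sum]
    refine Finset.sum_eq_zero fun b _ => ?_
    have := congrFun hv0 b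
    simp only [Matrix.vecMul, dotProduct, Matrix.of_apply, Pi.zero_apply] at this
    simp only [map_sum, map_smul, ContinuousLinearMap.sum_apply, ContinuousLinearMap.smul_apply,
      smul_eq_mul, this, mul_zero]
  ext k
  rw [← sum_smul_single_apply v k, this]; rfl

theorem isUnit_det_coframe (h : IsClosedCoframeAt G B e y) :
    IsUnit (Matrix.of fun a i => e y (EuclideanSpace.single i 1) a).det := by
  rw [isUnit_iff_ne_zero]
  intro h0
  obtain ⟨v, hv, hv0⟩ := Matrix.exists_mulVec_eq_zero_iff.2 h0
  apply hv
  have : (∑ i, v i • EuclideanSpace.single i (1 : ℝ) : EuclideanSpace ℝ (Fin d)) = 0 := by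
    apply h.injective
    rw [map_zero, map_sum]
    ext b
    have := congrFun hv0 b
    simp only [Matrix.mulVec, dotProduct, Matrix.of_apply, Pi.zero_apply] at this
    simpa [mul_comm] using this
  ext k
  rw [← sum_smul_single_apply v k, this]; rfl

theorem isUnit_det (h : IsClosedCoframeAt G B e y) : IsUnit (G y).det := by
  rw [h.coord_eq, Matrix.det_mul, Matrix.det_mul, Matrix.det_transpose]
  exact (h.isUnit_det_coframe.mul h.isUnit_det_form).mul h.isUnit_det_coframe

end IsClosedCoframeAt

variable {g : MetricField d S} {x₀ : S}
    {B : EuclideanSpace ℝ (Fin d) →L[ℝ] EuclideanSpace ℝ (Fin d) →L[ℝ] ℝ}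
    {e : EuclideanSpace ℝ (Fin d) → EuclideanSpace ℝ (Fin d) →L[ℝ] EuclideanSpace ℝ (Fin d)}
    {y : EuclideanSpace ℝ (Fin d)}

/-- A closed coframe is parallel. -/
theorem sum_christoffel_smul (h : IsClosedCoframeAt (g.coord x₀) B e y) (i j : Fin d) :
    ∑ k, g.christoffel x₀ k i j y • e y (EuclideanSpace.single k 1)
      = fderiv ℝ e y (EuclideanSpace.single i 1) (EuclideanSpace.single j 1) := by
  obtain ⟨c, hc⟩ := h.bijective.2
    (fderiv ℝ e y (EuclideanSpace.single i 1) (EuclideanSpace.single j 1))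
  have hcl := h.closed.self_of_nhds
  -- Koszul's formula: closedness makes the six products obtained from the derivatives of `B(e, e)`
  -- collapse to `2 B(∂_i e_j, e_l)`, and `c` is the coordinate vector with `e c = ∂_i e_j`.
  have key : ∀ k, g.christoffel x₀ k i j y = c k := by
    intro k
    have h1 : ∀ l, partialD i (fun z => g.coord x₀ z j l) y
        + partialD j (fun z => g.coord x₀ z i l) y - partialD l (fun z => g.coord x₀ z i j) y
        = 2 * ∑ m, g.coord x₀ y l m * c m := by
      intro l
      rw [h.partialD_eq, h.partialD_eq, h.partialD_eq,
        hcl (EuclideanSpace.single j 1) (EuclideanSpace.single i 1),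
        hcl (EuclideanSpace.single l 1) (EuclideanSpace.single i 1),
        hcl (EuclideanSpace.single l 1) (EuclideanSpace.single j 1),
        h.symm (e y (EuclideanSpace.single j 1)),
        ← hc]
      have : B (e y c) (e y (EuclideanSpace.single l 1)) = ∑ m, g.coord x₀ y l m * c m := by
        conv_lhs => rw [euclideanSpace_eq_sum c]
        simp only [map_sum, map_smul, ContinuousLinearMap.sum_apply,
          ContinuousLinearMap.smul_apply, smul_eq_mul]
        refine Finset.sum_congr rfl fun m _ => ?_
        rw [h.eq.self_of_nhds l m, h.symm, mul_comm]
      rw [this]; ring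
    rw [MetricField.christoffel]
    simp only [h1]
    have h2 : (g.coord x₀ y)⁻¹.mulVec ((g.coord x₀ y).mulVec (fun m => c m)) = fun m => c m := by
      rw [Matrix.mulVec_mulVec, Matrix.nonsing_inv_mul _ h.isUnit_det, Matrix.one_mulVec]
    have h3 := congrFun h2 k
    simp only [Matrix.mulVec, dotProduct] at h3
    rw [← h3, Finset.mul_sum]
    exact Finset.sum_congr rfl fun l _ => by ring
  simp only [key]
  rw [← hc]
  conv_rhs => rw [euclideanSpace_eq_sum c]
  simp

/-- The vector of Christoffel symbols is `e⁻¹(∂_i e_j)` near `y`, which is smooth because inversion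
of operators is; the inverse of the metric matrix need not be differentiated. -/
theorem differentiableAt_christoffel (h : IsClosedCoframeAt (g.coord x₀) B e y)
    (i j : Fin d) : DifferentiableAt ℝ (fun z => ∑ k, g.christoffel x₀ k i j z •
      (EuclideanSpace.single k 1 : EuclideanSpace ℝ (Fin d))) y := by
  have h1 : (fun z => ∑ k, g.christoffel x₀ k i j z •
      (EuclideanSpace.single k 1 : EuclideanSpace ℝ (Fin d))) =ᶠ[𝓝 y]
      fun z => (e z).inverse
        (fderiv ℝ e z (EuclideanSpace.single i 1) (EuclideanSpace.single j 1)) := by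
    filter_upwards [h.eventually] with z hz
    rw [← sum_christoffel_smul hz i j]
    have hi : (e z).IsInvertible :=
      ⟨ContinuousLinearEquiv.ofBijective (e z) (LinearMap.ker_eq_bot.2 hz.injective)
        (LinearMap.range_eq_top.2 hz.bijective.2), rfl⟩
    have := hi.inverse_apply_eq (x := ∑ k, g.christoffel x₀ k i j z •
      (EuclideanSpace.single k 1 : EuclideanSpace ℝ (Fin d))) (y := ∑ k, g.christoffel x₀ k i j z •
      e z (EuclideanSpace.single k 1))
    exact (this.2 (by simp)).symm
  have hi : (e y).IsInvertible :=
      ⟨ContinuousLinearEquiv.ofBijective (e y) (LinearMap.ker_eq_bot.2 h.injective)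
        (LinearMap.range_eq_top.2 h.bijective.2), rfl⟩
  have h2 : DifferentiableAt ℝ (fun z => (e z).inverse) y := by
    have := (hi.contDiffAt_map_inverse (n := 1)).differentiableAt (by simp)
    exact DifferentiableAt.comp y this h.differentiableAt
  have h3 : DifferentiableAt ℝ (fderiv ℝ e) y :=
    (h.contDiffAt.fderiv_right (m := 1) (one_add_one_eq_two.trans_le two_le_infty)).differentiableAt (by simp)
  refine DifferentiableAt.congr_of_eventuallyEq ?_ h1
  exact h2.clm_apply ((h3.clm_apply (differentiableAt_const _)).clm_apply
    (differentiableAt_const _))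

/-- A metric with a closed coframe is flat. -/
theorem riemannUp_eq_zero (h : IsClosedCoframeAt (g.coord x₀) B e y) (l k i j : Fin d) :
    g.riemannUp x₀ l k i j y = 0 := by
  set C : Fin d → Fin d → EuclideanSpace ℝ (Fin d) → EuclideanSpace ℝ (Fin d) := fun i j z =>
    ∑ k, g.christoffel x₀ k i j z • (EuclideanSpace.single k 1) with hC
  have hCk : ∀ i j z k, C i j z k = g.christoffel x₀ k i j z := fun i j z k =>
    sum_smul_single_apply (fun k => g.christoffel x₀ k i j z) k
  have hCe : ∀ z, IsClosedCoframeAt (g.coord x₀) B e z → ∀ i j, e z (C i j z)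
      = fderiv ℝ e z (EuclideanSpace.single i 1) (EuclideanSpace.single j 1) := by
    intro z hz i j
    rw [← sum_christoffel_smul hz, hC]; simp
  have h3 : DifferentiableAt ℝ (fderiv ℝ e) y :=
    (h.contDiffAt.fderiv_right (m := 1) (one_add_one_eq_two.trans_le two_le_infty)).differentiableAt (by simp)
  -- Differentiating `e(Γ_jk) = ∂_j e_k` along `i` shows that `∂_i Γ_jk + Γ_im Γ^m_jk` is the
  -- preimage under `e` of `∂_i ∂_j e_k`. Symmetry of second derivatives and injectivity of `e` then
  -- kill the curvature.
  have key : ∀ i j k, e y (fderiv ℝ (C j k) y (EuclideanSpace.single i 1)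
      + ∑ m, g.christoffel x₀ m j k y • C i m y)
      = fderiv ℝ (fderiv ℝ e) y (EuclideanSpace.single i 1) (EuclideanSpace.single j 1)
        (EuclideanSpace.single k 1) := by
    intro i j k
    have e1 : (fun z => e z (C j k z)) =ᶠ[𝓝 y] fun z =>
        fderiv ℝ e z (EuclideanSpace.single j 1) (EuclideanSpace.single k 1) := by
      filter_upwards [h.eventually] with z hz using hCe z hz j k
    have e2 := (h.differentiableAt.hasFDerivAt).clm_apply
      (differentiableAt_christoffel h j k).hasFDerivAt
    have e3 := ((h3.hasFDerivAt.clm_apply (hasFDerivAt_const (EuclideanSpace.single j (1 : ℝ)) y)).clm_apply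
      (hasFDerivAt_const (EuclideanSpace.single k (1 : ℝ)) y))
    have e4 := (e2.congr_of_eventuallyEq e1.symm).unique e3
    have e5 := DFunLike.congr_fun e4 (EuclideanSpace.single i (1 : ℝ))
    simp only [ContinuousLinearMap.add_apply, ContinuousLinearMap.coe_comp',
      Function.comp_apply, ContinuousLinearMap.flip_apply, ContinuousLinearMap.zero_apply,
      map_zero, zero_add] at e5
    rw [← e5, map_add]
    congr 1
    change e y (∑ m, g.christoffel x₀ m j k y • C i m y)
      = fderiv ℝ e y (EuclideanSpace.single i 1) (∑ m, g.christoffel x₀ m j k y •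
        (EuclideanSpace.single m 1 : EuclideanSpace ℝ (Fin d)))
    simp only [map_sum, map_smul, hCe y h]
  have hsymm : fderiv ℝ (fderiv ℝ e) y (EuclideanSpace.single i 1) (EuclideanSpace.single j 1)
      = fderiv ℝ (fderiv ℝ e) y (EuclideanSpace.single j 1) (EuclideanSpace.single i 1) :=
    (h.contDiffAt.isSymmSndFDerivAt (by simpa using two_le_infty)) _ _
  have h4 := key i j k
  rw [hsymm, ← key j i k] at h4
  have h5 := congrArg (fun v : EuclideanSpace ℝ (Fin d) => v l) (h.injective h4)
  have hp : ∀ i j k, partialD i (g.christoffel x₀ l j k) y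
      = (fderiv ℝ (C j k) y (EuclideanSpace.single i 1)) l := by
    intro i j k
    have e1 : g.christoffel x₀ l j k = fun z => (EuclideanSpace.proj l : EuclideanSpace ℝ (Fin d) →L[ℝ] ℝ) (C j k z) := by
      ext z; exact (hCk j k z l).symm
    rw [partialD, e1]
    have := (EuclideanSpace.proj l : EuclideanSpace ℝ (Fin d) →L[ℝ] ℝ).hasFDerivAt.comp y
      (differentiableAt_christoffel h j k).hasFDerivAt
    have e2 := this.fderiv
    rw [Function.comp_def] at e2
    rw [e2]; rfl
  rw [MetricField.riemannUp, hp, hp, Finset.sum_sub_distrib]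
  simp only [PiLp.add_apply, WithLp.ofLp_sum, Finset.sum_apply, PiLp.smul_apply, WithLp.ofLp_smul,
    Pi.smul_apply, hCk, smul_eq_mul] at h5
  have h6 : ∀ i j, ∑ m, g.christoffel x₀ l i m y * g.christoffel x₀ m j k y
      = ∑ m, g.christoffel x₀ m j k y * g.christoffel x₀ l i m y := fun i j =>
    Finset.sum_congr rfl fun m _ => mul_comm _ _
  rw [h6, h6]
  linarith

/-- The velocity of a geodesic has constant components in a closed coframe. -/
theorem hasDerivAt_coframe_velocity {c : ℝ → EuclideanSpace ℝ (Fin d)} {t : ℝ}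
    (h : IsClosedCoframeAt (g.coord x₀) B e (c t)) (hc : DifferentiableAt ℝ c t)
    (hc' : DifferentiableAt ℝ (deriv c) t)
    (hgeo : ∀ k, deriv (deriv c) t k + ∑ i, ∑ j, g.christoffel x₀ k i j (c t)
      * deriv c t i * deriv c t j = 0) :
    HasDerivAt (fun s => e (c s) (deriv c s)) 0 t := by
  have h1 := h.differentiableAt.hasFDerivAt.comp_hasDerivAt t hc.hasDerivAt
  have h2 := h1.clm_apply hc'.hasDerivAt
  refine h2.congr_deriv ?_
  have e1 : fderiv ℝ e (c t) (deriv c t) (deriv c t) = ∑ k, (∑ i, ∑ j,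
      g.christoffel x₀ k i j (c t) * deriv c t i * deriv c t j) •
      e (c t) (EuclideanSpace.single k 1) := by
    conv_lhs => rw [euclideanSpace_eq_sum (deriv c t)]
    simp only [map_sum, map_smul, ContinuousLinearMap.sum_apply, ContinuousLinearMap.smul_apply,
      ← sum_christoffel_smul h, Finset.smul_sum, Finset.sum_smul, smul_smul]
    rw [Finset.sum_congr rfl fun i _ => Finset.sum_comm]
    rw [Finset.sum_comm]
    refine Finset.sum_congr rfl fun k _ => ?_
    rw [Finset.sum_comm]
    refine Finset.sum_congr rfl fun i _ => Finset.sum_congr rfl fun j _ => ?_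
    congr 1; ring
  have e2 : e (c t) (deriv (deriv c) t) = ∑ k, (deriv (deriv c) t k) •
      e (c t) (EuclideanSpace.single k 1) := by
    conv_lhs => rw [euclideanSpace_eq_sum (deriv (deriv c) t)]
    simp
  simp only [Function.comp_apply]
  rw [e1, e2, ← Finset.sum_add_distrib]
  refine Finset.sum_eq_zero fun k _ => ?_
  rw [← add_smul, add_comm, hgeo k, zero_smul]

end Coordinates

/-! ### Closed coframes on a manifold -/

theorem eventually_eq_of_hasMFDerivAt_zero {V : Type*} [NormedAddCommGroup V] [NormedSpace ℝ V]
    {N : Type*} [TopologicalSpace N] [ChartedSpace V N] [IsManifold 𝓘(ℝ, V) ∞ N]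
    {W : Type*} [NormedAddCommGroup W] [NormedSpace ℝ W] {f : N → W} {x : N}
    (h : ∀ᶠ y in 𝓝 x, HasMFDerivAt 𝓘(ℝ, V) 𝓘(ℝ, W) f y 0) : ∀ᶠ y in 𝓝 x, f y = f x := by
  set ψ := extChartAt 𝓘(ℝ, V) x with hψ
  have ht : IsOpen ψ.target := isOpen_extChartAt_target x
  have hxt : ψ x ∈ ψ.target := mem_extChartAt_target x
  have hc : ContinuousAt ψ.symm (ψ x) := continuousAt_extChartAt_symm x
  have hc' : Tendsto ψ.symm (𝓝 (ψ x)) (𝓝 x) := by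
    have := hc.tendsto
    rwa [extChartAt_to_inv] at this
  have h1 : ∀ᶠ z in 𝓝 (ψ x), HasFDerivAt (f ∘ ψ.symm) (0 : V →L[ℝ] W) z := by
    filter_upwards [hc'.eventually h, ht.mem_nhds hxt] with z hz hzt
    have h2 : MDifferentiableAt 𝓘(ℝ, V) 𝓘(ℝ, V) ψ.symm z :=
      ((contMDiffOn_extChartAt_symm (n := ∞) x).contMDiffAt (ht.mem_nhds hzt)).mdifferentiableAt
        (by simp)
    have h3 := hz.comp z h2.hasMFDerivAt
    rw [ContinuousLinearMap.zero_comp] at h3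
    exact hasMFDerivAt_iff_hasFDerivAt.1 h3
  obtain ⟨r, hr, hb⟩ := Metric.eventually_nhds_iff_ball.1 h1
  have h2 : ∀ z ∈ Metric.ball (ψ x) r, f (ψ.symm z) = f (ψ.symm (ψ x)) := by
    intro z hz
    exact (convex_ball _ _).is_const_of_fderivWithin_eq_zero (𝕜 := ℝ) (f := f ∘ ψ.symm)
      (fun z hz => (hb z hz).differentiableAt.differentiableWithinAt)
      (fun z hz => by rw [fderivWithin_of_isOpen Metric.isOpen_ball hz, (hb z hz).fderiv]) hz
      (Metric.mem_ball_self hr)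
  have hcx : Tendsto ψ (𝓝 x) (𝓝 (ψ x)) := continuousAt_extChartAt x
  filter_upwards [hcx.eventually (Metric.ball_mem_nhds _ hr),
    extChartAt_source_mem_nhds (I := 𝓘(ℝ, V)) x] with y hy hys
  have := h2 _ hy
  rwa [ψ.left_inv hys, extChartAt_to_inv] at this

section Coframe

variable {d : ℕ} {S : Type} [TopologicalSpace S] [ChartedSpace (EuclideanSpace ℝ (Fin d)) S]

/-- A vector-valued one-form in the chart around `x₀`. -/
def pull (a : S → EuclideanSpace ℝ (Fin d) →L[ℝ] EuclideanSpace ℝ (Fin d)) (x₀ : S)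
    (y : EuclideanSpace ℝ (Fin d)) : EuclideanSpace ℝ (Fin d) →L[ℝ] EuclideanSpace ℝ (Fin d) :=
  (a ((extChartAt (𝓡 d) x₀).symm y)).comp (mfderiv (𝓡 d) (𝓡 d) (extChartAt (𝓡 d) x₀).symm y)

/-- A smooth closed one-form with values in `ℝ^d` that is invertible at each point. -/
structure IsClosedCoframe (a : S → EuclideanSpace ℝ (Fin d) →L[ℝ] EuclideanSpace ℝ (Fin d)) :
    Prop where
  contDiffOn : ∀ x, ContDiffOn ℝ ∞ (pull a x) (extChartAt (𝓡 d) x).target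
  closed_center : ∀ x v w, fderiv ℝ (pull a x) (extChartAt (𝓡 d) x x) v w
    = fderiv ℝ (pull a x) (extChartAt (𝓡 d) x x) w v
  injective : ∀ x, Function.Injective (a x)

variable [IsManifold (𝓡 d) ∞ S]

/-- The coordinate expression of `a` along a map `f`. It is applied both to inverse charts, giving
the change of coordinates, and to curves, giving velocities. -/
theorem form_mfderiv_eq (a : S → EuclideanSpace ℝ (Fin d) →L[ℝ] EuclideanSpace ℝ (Fin d)) (x₀ : S)
    {V : Type*} [NormedAddCommGroup V] [NormedSpace ℝ V]
    {f : V → S} {n : V} (hf : MDifferentiableAt 𝓘(ℝ, V) (𝓡 d) f n)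
    (hx : f n ∈ (extChartAt (𝓡 d) x₀).source) (v : V) :
    a (f n) (mfderiv 𝓘(ℝ, V) (𝓡 d) f n v)
      = pull a x₀ (extChartAt (𝓡 d) x₀ (f n)) (fderiv ℝ (extChartAt (𝓡 d) x₀ ∘ f) n v) := by
  set ψ := extChartAt (𝓡 d) x₀ with hψ
  have ht : ψ.target ∈ 𝓝 (ψ (f n)) :=
    (isOpen_extChartAt_target x₀).mem_nhds (ψ.map_source hx)
  have h1 : MDifferentiableAt (𝓡 d) (𝓡 d) ψ.symm (ψ (f n)) :=
    ((contMDiffOn_extChartAt_symm (n := ∞) x₀).contMDiffAt ht).mdifferentiableAt (by simp)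
  have hx' : f n ∈ (chartAt (EuclideanSpace ℝ (Fin d)) x₀).source := by
    rwa [hψ, extChartAt_source] at hx
  have h2 : MDifferentiableAt (𝓡 d) (𝓡 d) ψ (f n) :=
    (contMDiffAt_extChartAt' (n := ∞) hx').mdifferentiableAt (by simp)
  have h3 : MDifferentiableAt 𝓘(ℝ, V) (𝓡 d) (ψ ∘ f) n := h2.comp n hf
  have h4 : f =ᶠ[𝓝 n] ψ.symm ∘ (ψ ∘ f) := by
    filter_upwards [hf.continuousAt.eventually
      ((isOpen_extChartAt_source (I := 𝓡 d) x₀).mem_nhds hx)] with m hm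
    exact (ψ.left_inv hm).symm
  have h5 : mfderiv 𝓘(ℝ, V) (𝓡 d) f n v = mfderiv 𝓘(ℝ, V) (𝓡 d) (ψ.symm ∘ (ψ ∘ f)) n v := by
    rw [h4.mfderiv_eq]; rfl
  have h6 := mfderiv_comp_apply n (g := ψ.symm) (f := ψ ∘ f) h1 h3 v
  have h7 : a (ψ.symm (ψ (f n))) = a (f n) := by rw [ψ.left_inv hx]
  have h8 : mfderiv 𝓘(ℝ, V) (𝓡 d) (ψ ∘ f) n = fderiv ℝ (ψ ∘ f) n := mfderiv_eq_fderiv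
  change _ = a (ψ.symm (ψ (f n))) (mfderiv (𝓡 d) (𝓡 d) ψ.symm (ψ (f n)) _)
  rw [h7, ← h8]
  exact congrArg (a (f n)) (h5.trans h6)

/-- The exterior derivative commutes with pullback: the only additional term in the derivative of
`β(τ) ∘ τ'` contains the second derivative of `τ`, which is symmetric. -/
theorem fderiv_pullback_symm {V W : Type*} [NormedAddCommGroup V] [NormedSpace ℝ V]
    [NormedAddCommGroup W] [NormedSpace ℝ W]
    {β : V → V →L[ℝ] W} {τ : V → V} {β' : V → V →L[ℝ] W} {y : V}
    (hβ : DifferentiableAt ℝ β (τ y)) (hτ : ContDiffAt ℝ 2 τ y)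
    (hsymm : ∀ v w, fderiv ℝ β (τ y) v w = fderiv ℝ β (τ y) w v)
    (h : β' =ᶠ[𝓝 y] fun z => (β (τ z)).comp (fderiv ℝ τ z)) (v w : V) :
    fderiv ℝ β' y v w = fderiv ℝ β' y w v := by
  have h1 : DifferentiableAt ℝ (fderiv ℝ τ) y :=
    (hτ.fderiv_right (m := 1) one_add_one_eq_two.le).differentiableAt (by simp)
  have h2 := (hβ.hasFDerivAt.comp y (hτ.differentiableAt (by simp)).hasFDerivAt)
  have h3 := (h2.clm_comp h1.hasFDerivAt)
  have h4 : fderiv ℝ (fderiv ℝ τ) y v w = fderiv ℝ (fderiv ℝ τ) y w v :=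
    (hτ.isSymmSndFDerivAt (by simp)) v w
  rw [h.fderiv_eq]
  have h5 := h3.fderiv
  simp only [Function.comp_apply] at h5
  rw [h5]
  simp [h4, hsymm]

theorem pull_eventuallyEq (a : S → EuclideanSpace ℝ (Fin d) →L[ℝ] EuclideanSpace ℝ (Fin d))
    (x₀ x : S) {y : EuclideanSpace ℝ (Fin d)} (hy : y ∈ (extChartAt (𝓡 d) x₀).target)
    (hx : (extChartAt (𝓡 d) x₀).symm y ∈ (extChartAt (𝓡 d) x).source) :
    pull a x₀ =ᶠ[𝓝 y] fun z =>
      (pull a x (((extChartAt (𝓡 d) x) ∘ (extChartAt (𝓡 d) x₀).symm) z)).comp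
        (fderiv ℝ ((extChartAt (𝓡 d) x) ∘ (extChartAt (𝓡 d) x₀).symm) z) := by
  have ht := (isOpen_extChartAt_target (I := 𝓡 d) x₀)
  have hc : ContinuousAt (extChartAt (𝓡 d) x₀).symm y := continuousAt_extChartAt_symm'' hy
  filter_upwards [ht.mem_nhds hy, hc.eventually
    ((isOpen_extChartAt_source (I := 𝓡 d) x).mem_nhds hx)] with z hz hzx
  ext1 v
  exact form_mfderiv_eq a x (((contMDiffOn_extChartAt_symm (n := ∞) x₀).contMDiffAt
    (ht.mem_nhds hz)).mdifferentiableAt (by simp)) hzx v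

theorem contDiffAt_extChartAt_comp_symm (x₀ x : S) {y : EuclideanSpace ℝ (Fin d)}
    (hy : y ∈ (extChartAt (𝓡 d) x₀).target)
    (hx : (extChartAt (𝓡 d) x₀).symm y ∈ (extChartAt (𝓡 d) x).source) :
    ContDiffAt ℝ ∞ ((extChartAt (𝓡 d) x) ∘ (extChartAt (𝓡 d) x₀).symm) y := by
  rw [← contMDiffAt_iff_contDiffAt]
  refine ContMDiffAt.comp y (contMDiffAt_extChartAt' ?_) ((contMDiffOn_extChartAt_symm
    (n := ∞) x₀).contMDiffAt ((isOpen_extChartAt_target x₀).mem_nhds hy))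
  rwa [extChartAt_source] at hx

variable {a : S → EuclideanSpace ℝ (Fin d) →L[ℝ] EuclideanSpace ℝ (Fin d)}

namespace IsClosedCoframe

theorem contDiffAt (ha : IsClosedCoframe a) {x : S} {y : EuclideanSpace ℝ (Fin d)}
    (hy : y ∈ (extChartAt (𝓡 d) x).target) : ContDiffAt ℝ ∞ (pull a x) y :=
  (ha.contDiffOn x).contDiffAt ((isOpen_extChartAt_target x).mem_nhds hy)

/-- The field equations give closedness only at the centre of each preferred chart. Every point is
the centre of its own chart, and a change of chart preserves closedness. -/
theorem closed (ha : IsClosedCoframe a) {x : S} {y : EuclideanSpace ℝ (Fin d)}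
    (hy : y ∈ (extChartAt (𝓡 d) x).target) (v w : EuclideanSpace ℝ (Fin d)) :
    fderiv ℝ (pull a x) y v w = fderiv ℝ (pull a x) y w v := by
  have hx := mem_extChartAt_source (I := 𝓡 d) ((extChartAt (𝓡 d) x).symm y)
  refine fderiv_pullback_symm ?_ ((contDiffAt_extChartAt_comp_symm x _ hy hx).of_le two_le_infty)
    (fun v w => ha.closed_center _ v w) (pull_eventuallyEq a x _ hy hx) v w
  exact (ha.contDiffAt (mem_extChartAt_target _)).differentiableAt (by simp)

theorem injective_pull (ha : IsClosedCoframe a) {x : S} {y : EuclideanSpace ℝ (Fin d)}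
    (hy : y ∈ (extChartAt (𝓡 d) x).target) : Function.Injective (pull a x y) := by
  have h := isInvertible_mfderivWithin_extChartAt_symm (I := 𝓡 d) hy
  have hr : range (𝓡 d) = univ := by simp
  rw [hr, mfderivWithin_univ] at h
  exact (ha.injective _).comp h.injective

/-- A closed coframe is locally the derivative of a chart. -/
theorem exists_chart (ha : IsClosedCoframe a) (x : S) :
    ∃ e : OpenPartialHomeomorph S (EuclideanSpace ℝ (Fin d)), x ∈ e.source ∧
      ContMDiffOn (𝓡 d) (𝓡 d) ∞ e e.source ∧ ContMDiffOn (𝓡 d) (𝓡 d) ∞ e.symm e.target ∧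
      ∀ y ∈ e.source, HasMFDerivAt (𝓡 d) (𝓡 d) e y (a y) := by
  set ψ := extChartAt (𝓡 d) x with hψ
  obtain ⟨r, hr, hb⟩ := Metric.isOpen_iff.1 (isOpen_extChartAt_target (I := 𝓡 d) x) _
    (mem_extChartAt_target x)
  set U := Metric.ball (ψ x) r with hU
  have hUo : IsOpen U := Metric.isOpen_ball
  have hd : DifferentiableOn ℝ (pull a x) U :=
    ((ha.contDiffOn x).mono hb).differentiableOn (by simp)
  -- Poincaré lemma on the convex ball `U`. Since the derivative of the primitive `f` is invertible,
  -- the inverse function theorem below turns it into a chart.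
  obtain ⟨f, hf⟩ := (convex_ball (ψ x) r).exists_forall_hasFDerivAt_of_fderiv_symmetric hUo hd
    (fun z hz v w => ha.closed (hb hz) v w)
  have hfs : ContDiffOn ℝ ∞ f U := by
    rw [contDiffOn_infty_iff_fderiv_of_isOpen hUo]
    refine ⟨fun z hz => (hf z hz).differentiableAt.differentiableWithinAt, ?_⟩
    exact ((ha.contDiffOn x).mono hb).congr fun z hz => (hf z hz).fderiv
  have hequiv : ∀ z ∈ U, ∃ L : EuclideanSpace ℝ (Fin d) ≃L[ℝ] EuclideanSpace ℝ (Fin d),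
      (L : _ →L[ℝ] _) = pull a x z := fun z hz =>
    ⟨ContinuousLinearEquiv.ofBijective (pull a x z)
      (LinearMap.ker_eq_bot.2 (ha.injective_pull (hb hz)))
      (LinearMap.range_eq_top.2 ((LinearMap.injective_iff_surjective
        (f := (pull a x z).toLinearMap)).1 (ha.injective_pull (hb hz)))), rfl⟩
  have hxU : ψ x ∈ U := Metric.mem_ball_self hr
  obtain ⟨L, hL⟩ := hequiv _ hxU
  have hfx : HasFDerivAt f (L : EuclideanSpace ℝ (Fin d) →L[ℝ] EuclideanSpace ℝ (Fin d)) (ψ x) :=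
    hL ▸ hf _ hxU
  have hcx := hfs.contDiffAt (hUo.mem_nhds hxU)
  set e₁ := (hcx.toOpenPartialHomeomorph f hfx (by simp)).restrOpen U hUo with he₁
  have he₁U : e₁.source ⊆ U := fun z hz => hz.2
  have he₁f : ∀ z, e₁ z = f z := fun z => rfl
  set e := (chartAt (EuclideanSpace ℝ (Fin d)) x).trans e₁ with he
  have hes : ∀ y ∈ e.source, y ∈ ψ.source ∧ ψ y ∈ e₁.source := by
    intro y hy
    have := hy
    rw [he, OpenPartialHomeomorph.trans_source] at this
    exact ⟨by rw [hψ, extChartAt_source]; exact this.1, this.2⟩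
  have hef : ∀ y, e y = f (ψ y) := fun y => rfl
  refine ⟨e, ?_, ?_, ?_, ?_⟩
  · rw [he, OpenPartialHomeomorph.trans_source]
    exact ⟨mem_chart_source _ _, hcx.mem_toOpenPartialHomeomorph_source hfx _, hxU⟩
  · intro y hy
    obtain ⟨h1, h2⟩ := hes y hy
    have h3 : ContMDiffAt (𝓡 d) (𝓡 d) ∞ f (ψ y) :=
      (hfs.contDiffAt (hUo.mem_nhds (he₁U h2))).contMDiffAt
    refine (ContMDiffAt.comp y h3 (contMDiffAt_extChartAt' ?_)).contMDiffWithinAt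
    rwa [hψ, extChartAt_source] at h1
  · intro z hz
    have h1 : z ∈ e₁.target ∧ e₁.symm z ∈ ψ.target := by
      rw [he, OpenPartialHomeomorph.trans_target] at hz
      refine ⟨hz.1, ?_⟩
      exact hb (he₁U (e₁.map_target hz.1))
    have h2 : e₁.symm z ∈ U := he₁U (e₁.map_target h1.1)
    obtain ⟨L', hL'⟩ := hequiv _ h2
    have h3 : ContDiffAt ℝ ∞ e₁.symm z := by
      refine e₁.contDiffAt_symm (f₀' := L') h1.1 ?_ ?_
      · rw [hL']; exact hf _ h2
      · exact hfs.contDiffAt (hUo.mem_nhds h2)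
    have h4 : ContMDiffAt (𝓡 d) (𝓡 d) ∞ ψ.symm (e₁.symm z) :=
      (contMDiffOn_extChartAt_symm (n := ∞) x).contMDiffAt
        ((isOpen_extChartAt_target x).mem_nhds h1.2)
    exact (ContMDiffAt.comp z h4 h3.contMDiffAt).contMDiffWithinAt
  · intro y hy
    obtain ⟨h1, h2⟩ := hes y hy
    have hy' : y ∈ (chartAt (EuclideanSpace ℝ (Fin d)) x).source := by
      rwa [hψ, extChartAt_source] at h1
    have hm : MDifferentiableAt (𝓡 d) (𝓡 d) ψ y :=
      (contMDiffAt_extChartAt' (n := ∞) hy').mdifferentiableAt (by simp)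
    have h3 : HasMFDerivAt (𝓡 d) (𝓡 d) f (ψ y) (pull a x (ψ y)) :=
      (hf _ (he₁U h2)).hasMFDerivAt
    have h4 := h3.comp y hm.hasMFDerivAt
    refine h4.congr_mfderiv ?_
    ext1 v
    have h5 := mfderivWithin_extChartAt_symm_comp_mfderiv_extChartAt' (I := 𝓡 d) h1
    have hr : range (𝓡 d) = univ := by simp
    rw [hr, mfderivWithin_univ] at h5
    have h6 : a (ψ.symm (ψ y)) = a y := by rw [ψ.left_inv h1]
    change a (ψ.symm (ψ y)) _ = _
    rw [h6]
    exact congrArg (a y) (DFunLike.congr_fun h5 v)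

/-- The atlas of charts whose derivative is the coframe. -/
def flatAtlas (ha : IsClosedCoframe a) : FlatAtlas S (EuclideanSpace ℝ (Fin d)) where
  chart x := (ha.exists_chart x).choose
  mem_source x := (ha.exists_chart x).choose_spec.1
  compat x z hz := by
    have hx := (ha.exists_chart x).choose_spec.2.2.2
    obtain ⟨hz', -, -, hzz⟩ := (ha.exists_chart z).choose_spec
    -- Two charts have the same differential `a`, so their difference is locally constant.
    have := eventually_eq_of_hasMFDerivAt_zero (x := z)
      (f := fun y => (ha.exists_chart z).choose y - (ha.exists_chart x).choose y) (V := EuclideanSpace ℝ (Fin d)) (by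
        filter_upwards [(ha.exists_chart z).choose.open_source.mem_nhds hz',
          (ha.exists_chart x).choose.open_source.mem_nhds hz] with y h1 h2
        have := (hzz y h1).sub (hx y h2)
        refine this.congr_mfderiv ?_
        exact sub_self _)
    filter_upwards [this] with y hy
    rw [sub_eq_sub_iff_sub_eq_sub, hy]

theorem hasMFDerivAt_chart (ha : IsClosedCoframe a) {x y : S}
    (hy : y ∈ (ha.flatAtlas.chart x).source) :
    HasMFDerivAt (𝓡 d) (𝓡 d) (ha.flatAtlas.chart x) y (a y) :=
  (ha.exists_chart x).choose_spec.2.2.2 y hy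

theorem contMDiffOn_chart (ha : IsClosedCoframe a) (x : S) :
    ContMDiffOn (𝓡 d) (𝓡 d) ∞ (ha.flatAtlas.chart x) (ha.flatAtlas.chart x).source :=
  (ha.exists_chart x).choose_spec.2.1

theorem contMDiffOn_chart_symm (ha : IsClosedCoframe a) (x : S) :
    ContMDiffOn (𝓡 d) (𝓡 d) ∞ (ha.flatAtlas.chart x).symm (ha.flatAtlas.chart x).target :=
  (ha.exists_chart x).choose_spec.2.2.1

end IsClosedCoframe

end Coframe

/-! ### Flat metrics: curvature invariants and completeness -/

theorem hasDerivAt_of_hasMFDerivAt {W : Type*} [NormedAddCommGroup W] [NormedSpace ℝ W]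
    {f : ℝ → W} {t : ℝ} {f' : ℝ →L[ℝ] W} {w : W} (h : HasMFDerivAt 𝓘(ℝ, ℝ) 𝓘(ℝ, W) f t f')
    (hw : f' 1 = w) : HasDerivAt f w t := by
  have h' : HasFDerivAt f f' t := hasMFDerivAt_iff_hasFDerivAt.1 h
  exact hw ▸ h'.hasDerivAt

theorem eventually_eq_line {W : Type*} [NormedAddCommGroup W] [NormedSpace ℝ W]
    {f : ℝ → W} {t : ℝ} {w : W} (h : ∀ᶠ s in 𝓝 t, HasDerivAt f w s) :
    ∀ᶠ s in 𝓝 t, f s = f t + (s - t) • w := by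
  have h2 := eventually_eq_of_hasMFDerivAt_zero (V := ℝ) (x := t) (f := fun s => f s - s • w) (by
    filter_upwards [h] with s hs
    have h1 := hs.sub ((hasDerivAt_id s).smul_const w)
    rw [one_smul, sub_self] at h1
    refine h1.hasFDerivAt.hasMFDerivAt.congr_mfderiv ?_
    ext
    exact smul_zero _)
  filter_upwards [h2] with s hs
  rw [sub_eq_sub_iff_sub_eq_sub, sub_eq_iff_eq_add] at hs
  rw [hs]; module

section FlatMetric

variable {d : ℕ} {S : Type} [TopologicalSpace S] [ChartedSpace (EuclideanSpace ℝ (Fin d)) S]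

/-- The metric `g` is obtained from a closed coframe `a` and a locally constant bilinear form. -/
structure IsFlatMetric (g : MetricField d S)
    (a : S → EuclideanSpace ℝ (Fin d) →L[ℝ] EuclideanSpace ℝ (Fin d))
    (B : S → EuclideanSpace ℝ (Fin d) →L[ℝ] EuclideanSpace ℝ (Fin d) →L[ℝ] ℝ) : Prop where
  coframe : IsClosedCoframe a
  symm : ∀ x v w, B x v w = B x w v
  nondeg : ∀ x v, (∀ w, B x v w = 0) → v = 0
  locConst : IsLocallyConstant B
  eq : ∀ (x : S) (u v : TangentSpace (𝓡 d) x), g x u v = B x (a x u) (a x v)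

variable [IsManifold (𝓡 d) ∞ S]
  {g : MetricField d S} {a : S → EuclideanSpace ℝ (Fin d) →L[ℝ] EuclideanSpace ℝ (Fin d)}
  {B : S → EuclideanSpace ℝ (Fin d) →L[ℝ] EuclideanSpace ℝ (Fin d) →L[ℝ] ℝ}

namespace IsFlatMetric

theorem isClosedCoframeAt (h : IsFlatMetric g a B) (x : S) {y : EuclideanSpace ℝ (Fin d)}
    (hy : y ∈ (extChartAt (𝓡 d) x).target) :
    IsClosedCoframeAt (g.coord x) (B ((extChartAt (𝓡 d) x).symm y)) (pull a x) y where
  symm := h.symm _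
  nondeg := h.nondeg _
  eq := by
    have hc : ContinuousAt (extChartAt (𝓡 d) x).symm y := continuousAt_extChartAt_symm'' hy
    filter_upwards [hc.eventually (h.locConst.eventually_eq _)] with z hz i j
    rw [MetricField.coord, Matrix.of_apply, h.eq, hz]
    rfl
  eventually_contDiffAt := by
    filter_upwards [(isOpen_extChartAt_target x).mem_nhds hy] with z hz
    exact h.coframe.contDiffAt hz
  closed := by
    filter_upwards [(isOpen_extChartAt_target x).mem_nhds hy] with z hz
    exact h.coframe.closed hz
  injective := h.coframe.injective_pull hy

/-- The curvature vanishes, and invariance under the change of basis given by the coframe matrix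
replaces the metric by the Gram matrix of `B x`. The value therefore depends on `x` only through the
locally constant `B x`. -/
theorem curvatureInvariant_value (h : IsFlatMetric g a B) (q : CurvatureInvariant d) (x : S) :
    q.value g x = MvPolynomial.eval (curvatureValuation
      (Matrix.of fun i j => B x (EuclideanSpace.single i 1) (EuclideanSpace.single j 1))⁻¹
      0) q.poly := by
  have hx := h.isClosedCoframeAt x (mem_extChartAt_target x)
  rw [extChartAt_to_inv] at hx
  have hR : (fun i j k l => g.riemann x i j k l (extChartAt (𝓡 d) x x)) = 0 := by
    funext i j k l
    simp only [MetricField.riemann, riemannUp_eq_zero hx, mul_zero, Finset.sum_const_zero]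
    rfl
  have hsymm : (Matrix.of fun i j => B x (EuclideanSpace.single i 1)
      (EuclideanSpace.single j (1 : ℝ))).IsSymm := by
    ext i j
    exact h.symm _ _ _
  have := q.invariant _ _ 0 hx.isUnit_det_coframe hsymm hx.isUnit_det_form
  simp only [Pi.zero_apply, mul_zero, Finset.sum_const_zero] at this
  rw [CurvatureInvariant.value, hR, hx.coord_eq]
  exact this

/-- The velocity of a curve in the coframe `a`. -/
def _root_.EGravity.velocity (a : S → EuclideanSpace ℝ (Fin d) →L[ℝ] EuclideanSpace ℝ (Fin d))
    (γ : ℝ → S) (t : ℝ) : EuclideanSpace ℝ (Fin d) :=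
  a (γ t) (mfderiv 𝓘(ℝ, ℝ) (𝓡 d) γ t (1 : ℝ))

/-- The velocity of a geodesic is parallel and so is the coframe; hence the components of the one in
the other are constant, which makes geodesics straight lines of the flat atlas. -/
theorem hasDerivAt_velocity (h : IsFlatMetric g a B) {γ : ℝ → S} {J : Set ℝ} (hJ : IsOpen J)
    (hγ : g.IsGeodesicOn γ J) {t : ℝ} (ht : t ∈ J) : HasDerivAt (velocity a γ) 0 t := by
  set ψ := extChartAt (𝓡 d) (γ t) with hψ
  have hsm : ∀ s ∈ J, ContMDiffAt 𝓘(ℝ, ℝ) (𝓡 d) ∞ γ s := fun s hs =>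
    hγ.1.contMDiffAt (hJ.mem_nhds hs)
  have hsrc : ∀ᶠ s in 𝓝 t, γ s ∈ ψ.source :=
    (hsm t ht).continuousAt.eventually (extChartAt_source_mem_nhds (γ t))
  have hc : ContDiffAt ℝ ∞ (fun s => ψ (γ s)) t := by
    rw [← contMDiffAt_iff_contDiffAt]
    exact ContMDiffAt.comp t contMDiffAt_extChartAt (hsm t ht)
  have h1 : velocity a γ =ᶠ[𝓝 t] fun s => pull a (γ t) (ψ (γ s)) (deriv (fun s => ψ (γ s)) s) := by
    filter_upwards [hJ.mem_nhds ht, hsrc] with s hs hss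
    have := form_mfderiv_eq a (γ t) ((hsm s hs).mdifferentiableAt (by simp)) hss (1 : ℝ)
    rw [velocity, this]
    rfl
  refine HasDerivAt.congr_of_eventuallyEq ?_ h1
  have h2 : ContDiffAt ℝ 1 (deriv (fun s => ψ (γ s))) t := by
    have := hc.fderiv_right (m := 1) (one_add_one_eq_two.trans_le two_le_infty)
    exact this.clm_apply contDiffAt_const
  exact hasDerivAt_coframe_velocity (h.isClosedCoframeAt (γ t) (mem_extChartAt_target _))
    (hc.differentiableAt (by simp)) (h2.differentiableAt (by simp)) (hγ.2 t ht)

end IsFlatMetric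

theorem IsClosedCoframe.isLineAt (ha : IsClosedCoframe a) {γ : ℝ → S} {t : ℝ}
    {w : EuclideanSpace ℝ (Fin d)}
    (hγ : ∀ᶠ s in 𝓝 t, MDifferentiableAt 𝓘(ℝ, ℝ) (𝓡 d) γ s)
    (hv : ∀ᶠ s in 𝓝 t, velocity a γ s = w) : ha.flatAtlas.IsLineAt γ w t := by
  have hct := hγ.self_of_nhds.continuousAt
  refine ⟨hct, ?_⟩
  set e := ha.flatAtlas.chart (γ t) with he
  have hes : ∀ᶠ s in 𝓝 t, γ s ∈ e.source :=
    hct.eventually (e.open_source.mem_nhds (ha.flatAtlas.mem_source _))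
  refine eventually_eq_line ?_
  filter_upwards [hγ, hv, hes] with s h1 h2 h3
  exact hasDerivAt_of_hasMFDerivAt ((ha.hasMFDerivAt_chart h3).comp s h1.hasMFDerivAt) h2

theorem IsFlatMetric.isLineAt (h : IsFlatMetric g a B) {γ : ℝ → S} {J : Set ℝ} (hJ : IsOpen J)
    (hJc : IsPreconnected J) (hγ : g.IsGeodesicOn γ J) {t₀ : ℝ} (ht₀ : t₀ ∈ J) {t : ℝ}
    (ht : t ∈ J) : h.coframe.flatAtlas.IsLineAt γ (velocity a γ t₀) t := by
  have hconst : ∀ s ∈ J, velocity a γ s = velocity a γ t₀ := by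
    intro s hs
    refine hJ.is_const_of_deriv_eq_zero hJc ?_ ?_ hs ht₀
    · exact fun s hs => (h.hasDerivAt_velocity hJ hγ hs).differentiableAt.differentiableWithinAt
    · exact fun s hs => (h.hasDerivAt_velocity hJ hγ hs).deriv
  refine h.coframe.isLineAt ?_ ?_
  · filter_upwards [hJ.mem_nhds ht] with s hs
    exact (hγ.1.contMDiffAt (hJ.mem_nhds hs)).mdifferentiableAt (by simp)
  · filter_upwards [hJ.mem_nhds ht] with s hs using hconst s hs

/-- A maximally extended flat metric is geodesically complete. -/
theorem IsFlatMetric.complete [T2Space S] (h : IsFlatMetric g a B) (hg : g.IsMaximallyExtended) :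
    h.coframe.flatAtlas.Complete := by
  refine FlatAtlas.complete_of_forward fun x w => ?_
  have hsurj : Function.Surjective (a x) := (LinearMap.injective_iff_surjective
    (f := (a x).toLinearMap)).1 (h.coframe.injective x)
  obtain ⟨v, hv⟩ := hsurj w
  obtain ⟨γ, hγv, δ, hδ, hcase⟩ := hg ⟨x, v⟩
  have hx : γ 0 = x := congrArg TotalSpace.proj hγv
  have hvel : velocity a γ 0 = w := by
    have : ∀ p : TangentBundle (𝓡 d) S, p = ⟨x, v⟩ → a p.1 p.2 = w := by
      rintro p rfl; exact hv
    exact this _ hγv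
  refine ⟨γ, hx, δ, hδ, ?_⟩
  rcases hcase with hgeo | ⟨b, hb, hgeo, q, hq⟩
  · intro t ht
    rw [← hvel]
    exact h.isLineAt isOpen_Ioi isPreconnected_Ioi hgeo (show (0 : ℝ) ∈ Ioi (-δ) by simpa) ht
  -- The image of the geodesic is connected, so `B` and with it every curvature invariant is
  -- constant along it and cannot diverge. Only the alternative of infinite continuation remains.
  · exfalso
    have hcont : ContinuousOn γ (Ioo (-δ) b) := hgeo.1.continuousOn
    have hBc : ∀ t ∈ Ioo (-δ) b, B (γ t) = B (γ 0) := by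
      intro t ht
      have : IsPreconnected (γ '' Ioo (-δ) b) := isPreconnected_Ioo.image _ hcont
      exact h.locConst.apply_eq_of_isPreconnected this ⟨t, ht, rfl⟩
        ⟨0, ⟨by linarith, hb⟩, rfl⟩
    have hval : ∀ t ∈ Ioo (-δ) b, q.value g (γ t) = q.value g (γ 0) := by
      intro t ht
      rw [h.curvatureInvariant_value, h.curvatureInvariant_value, hBc t ht]
    have hev : ∀ᶠ t in 𝓝[<] b, |q.value g (γ t)| = |q.value g (γ 0)| := by
      filter_upwards [Ioo_mem_nhdsLT (show -δ < b by linarith)] with t ht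
      rw [hval t ht]
    have := (tendsto_const_nhds (x := |q.value g (γ 0)|)).congr' (hev.mono fun _ h => h.symm)
    exact not_tendsto_nhds_of_tendsto_atTop hq _ this

end FlatMetric

/-! ### From a primitive of the difference of two coframes to a diffeomorphism. -/

section Diffeomorphism

variable {d : ℕ} {S : Type} [TopologicalSpace S] [ChartedSpace (EuclideanSpace ℝ (Fin d)) S]
  [IsManifold (𝓡 d) ∞ S] [T2Space S]
  {a₀ a₁ : S → EuclideanSpace ℝ (Fin d) →L[ℝ] EuclideanSpace ℝ (Fin d)}

theorem IsClosedCoframe.eventually_hasMFDerivAt_chart (ha : IsClosedCoframe a₀) (x : S) :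
    ∀ᶠ y in 𝓝 x, HasMFDerivAt (𝓡 d) (𝓡 d) (ha.flatAtlas.chart x) y (a₀ y) := by
  filter_upwards [(ha.flatAtlas.chart x).open_source.mem_nhds (ha.flatAtlas.mem_source x)]
    with y hy using ha.hasMFDerivAt_chart hy

theorem FlatAtlas.contMDiffAt_move (ha : IsClosedCoframe a₀) (x y : S)
    {f : S → EuclideanSpace ℝ (Fin d)} (hf : ContMDiffAt (𝓡 d) (𝓡 d) ∞ f y) (hfy : f y = 0) :
    ContMDiffAt (𝓡 d) (𝓡 d) ∞ (fun z => ha.flatAtlas.move x (f z)) y := by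
  have h1 : ContMDiffAt (𝓡 d) (𝓡 d) ∞ (ha.flatAtlas.chart x).symm
      (ha.flatAtlas.chart x x + f y) := by
    rw [hfy, add_zero]
    exact (ha.contMDiffOn_chart_symm x).contMDiffAt
      ((ha.flatAtlas.chart x).open_target.mem_nhds
        ((ha.flatAtlas.chart x).map_source (ha.flatAtlas.mem_source x)))
  exact ContMDiffAt.comp (g := (ha.flatAtlas.chart x).symm)
    (f := fun z => ha.flatAtlas.chart x x + f z) y h1 (contMDiffAt_const.add hf)

theorem IsClosedCoframe.contMDiffAt_chart_sub (ha : IsClosedCoframe a₀) (x : S) :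
    ContMDiffAt (𝓡 d) (𝓡 d) ∞
      (fun y => ha.flatAtlas.chart x y - ha.flatAtlas.chart x x) x :=
  (((ha.contMDiffOn_chart x).contMDiffAt ((ha.flatAtlas.chart x).open_source.mem_nhds
    (ha.flatAtlas.mem_source x)))).sub contMDiffAt_const

/-- Two complete closed coframes that differ by an exact form are related by a
diffeomorphism. -/
theorem exists_diffeomorph_of_exact (h₀ : IsClosedCoframe a₀) (h₁ : IsClosedCoframe a₁)
    (hc₀ : h₀.flatAtlas.Complete) (hc₁ : h₁.flatAtlas.Complete)
    {lam : S → EuclideanSpace ℝ (Fin d)}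
    (hlam : ∀ x, HasMFDerivAt (𝓡 d) (𝓡 d) lam x (a₁ x - a₀ x)) :
    ∃ D : S ≃ₘ^∞⟮𝓡 d, 𝓡 d⟯ S, (∀ x, D x ∈ connectedComponent x) ∧
      ∀ (x : S) (u : TangentSpace (𝓡 d) x), a₁ (D x) (mfderiv (𝓡 d) (𝓡 d) D x u) = a₀ x u := by
  have hl : ∀ x, ∀ᶠ y in 𝓝 x, h₁.flatAtlas.chart x y - h₁.flatAtlas.chart x x - (lam y - lam x)
      = h₀.flatAtlas.chart x y - h₀.flatAtlas.chart x x := by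
    intro x
    have := eventually_eq_of_hasMFDerivAt_zero (x := x) (V := EuclideanSpace ℝ (Fin d))
      (f := fun y => h₁.flatAtlas.chart x y - lam y - h₀.flatAtlas.chart x y) (by
        filter_upwards [h₀.eventually_hasMFDerivAt_chart x,
          h₁.eventually_hasMFDerivAt_chart x] with y e0 e1
        refine ((e1.sub (hlam y)).sub e0).congr_mfderiv ?_
        change a₁ y - (a₁ y - a₀ y) - a₀ y = 0
        abel)
    filter_upwards [this] with y hy
    rw [← sub_eq_zero] at hy ⊢
    rw [← hy]; abel
  -- In flat coordinates this map is `chart₁ - lam`, whose differential is `a₁ - (a₁ - a₀) = a₀`.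
  -- Near each point `D` and its inverse are compositions of flat charts with translations, which
  -- gives smoothness in both directions.
  set D := FlatAtlas.shift hc₁ lam with hD
  have hbij : Function.Bijective D := FlatAtlas.shift_bijective hc₁ hl hc₀
  have hflat : FlatAtlas.IsFlatMap h₀.flatAtlas h₁.flatAtlas D := FlatAtlas.isFlatMap_shift hc₁ hl
  have hDmove : ∀ x, ∀ᶠ y in 𝓝 x, D y = h₁.flatAtlas.move (D x)
      (h₀.flatAtlas.chart x y - h₀.flatAtlas.chart x x) := by
    intro x
    filter_upwards [(hflat x).2, (hflat x).1.eventually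
      ((h₁.flatAtlas.chart (D x)).open_source.mem_nhds (h₁.flatAtlas.mem_source _))] with y e1 e2
    rw [← e1, FlatAtlas.move_chart_sub _ _ e2]
  have hDs : ContMDiff (𝓡 d) (𝓡 d) ∞ D := by
    intro x
    refine ContMDiffAt.congr_of_eventuallyEq ?_ (hDmove x)
    exact FlatAtlas.contMDiffAt_move h₁ (D x) x (h₀.contMDiffAt_chart_sub x) (sub_self _)
  set G := (Equiv.ofBijective D hbij).symm with hG
  have hGD : Function.LeftInverse G D := fun x => (Equiv.ofBijective D hbij).symm_apply_apply x
  have hDG : Function.RightInverse G D := fun x => (Equiv.ofBijective D hbij).apply_symm_apply x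
  have hGs : ContMDiff (𝓡 d) (𝓡 d) ∞ G := by
    intro y
    obtain ⟨x, rfl⟩ := hbij.2 y
    refine ContMDiffAt.congr_of_eventuallyEq ?_ (hflat.eventually_rightInverse hGD x)
    exact FlatAtlas.contMDiffAt_move h₀ x (D x) (h₁.contMDiffAt_chart_sub (D x)) (sub_self _)
  refine ⟨⟨Equiv.ofBijective D hbij, hDs, hGs⟩, fun x =>
    FlatAtlas.flow_mem_connectedComponent hc₁ _ _, fun x u => ?_⟩
  change a₁ (D x) (mfderiv (𝓡 d) (𝓡 d) D x u) = a₀ x u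
  have e1 := (h₁.eventually_hasMFDerivAt_chart (D x)).self_of_nhds.comp x
    ((hDs x).mdifferentiableAt (by simp)).hasMFDerivAt
  have e2 : (h₁.flatAtlas.chart (D x) ∘ D) =ᶠ[𝓝 x] fun y =>
      h₀.flatAtlas.chart x y + (h₁.flatAtlas.chart (D x) (D x) - h₀.flatAtlas.chart x x) := by
    filter_upwards [(hflat x).2] with y hy
    rw [sub_eq_iff_eq_add] at hy
    rw [Function.comp_apply, hy]; abel
  have e3 := ((h₀.eventually_hasMFDerivAt_chart x).self_of_nhds.add
    (hasMFDerivAt_const (h₁.flatAtlas.chart (D x) (D x) - h₀.flatAtlas.chart x x) x))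
  have e4 := (e3.congr_of_eventuallyEq e2).mfderiv.symm.trans e1.mfderiv
  have e5 := DFunLike.congr_fun e4 u
  refine Eq.trans e5.symm ?_
  change a₀ x u + 0 = a₀ x u
  rw [add_zero]

end Diffeomorphism

/-! ### Fields in a bundle of abelian Lie algebras -/

/-- A differentiable map with vanishing derivative is locally constant. -/
theorem eventually_eq_of_mfderiv_eq_zero {V : Type*} [NormedAddCommGroup V] [NormedSpace ℝ V]
    {N : Type*} [TopologicalSpace N] [ChartedSpace V N] [IsManifold 𝓘(ℝ, V) ∞ N]
    {W : Type*} [NormedAddCommGroup W] [NormedSpace ℝ W]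
    {M : Type*} [TopologicalSpace M] [ChartedSpace W M] [IsManifold 𝓘(ℝ, W) ∞ M]
    {f : N → M} (hf : MDifferentiable 𝓘(ℝ, V) 𝓘(ℝ, W) f)
    (h : ∀ x, mfderiv 𝓘(ℝ, V) 𝓘(ℝ, W) f x = 0) (x : N) : ∀ᶠ y in 𝓝 x, f y = f x := by
  have hs : ∀ᶠ y in 𝓝 x, f y ∈ (extChartAt 𝓘(ℝ, W) (f x)).source :=
    (hf x).continuousAt.eventually (extChartAt_source_mem_nhds (f x))
  have h1 := eventually_eq_of_hasMFDerivAt_zero (x := x)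
    (f := fun y => extChartAt 𝓘(ℝ, W) (f x) (f y)) (V := V) (by
      filter_upwards [hs] with y hy
      have hm : MDifferentiableAt 𝓘(ℝ, W) 𝓘(ℝ, W) (extChartAt 𝓘(ℝ, W) (f x)) (f y) := by
        refine (contMDiffAt_extChartAt' (n := ∞) ?_).mdifferentiableAt (by simp)
        rwa [extChartAt_source] at hy
      have h2 := (hf y).hasMFDerivAt
      rw [h y] at h2
      have h3 := hm.hasMFDerivAt.comp y h2
      rw [ContinuousLinearMap.comp_zero] at h3
      exact h3)
  filter_upwards [h1, hs] with y hy hys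
  exact (extChartAt 𝓘(ℝ, W) (f x)).injOn hys (mem_extChartAt_source _) hy

section Algebroid

variable {EM : Type*} [NormedAddCommGroup EM] [NormedSpace ℝ EM]
  {M : Type*} [TopologicalSpace M] [ChartedSpace EM M]
  {F : Type*} [NormedAddCommGroup F] [NormedSpace ℝ F] [FiniteDimensional ℝ F]
  {E : M → Type*} [TopologicalSpace (TotalSpace F E)] [∀ p, TopologicalSpace (E p)]
  [∀ p, AddCommGroup (E p)] [∀ p, Module ℝ (E p)]
  [∀ p, IsTopologicalAddGroup (E p)] [∀ p, ContinuousSMul ℝ (E p)]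
  [FiberBundle F E] [VectorBundle ℝ F E]

theorem finiteDimensional_fiber (F : Type*) [NormedAddCommGroup F] [NormedSpace ℝ F]
    [FiniteDimensional ℝ F] {E : M → Type*} [TopologicalSpace (TotalSpace F E)]
    [∀ p, TopologicalSpace (E p)] [∀ p, AddCommGroup (E p)] [∀ p, Module ℝ (E p)]
    [FiberBundle F E] [VectorBundle ℝ F E] (p : M) : FiniteDimensional ℝ (E p) :=
  Module.Finite.equiv ((trivializationAt F E p).linearEquivAt ℝ p
    (mem_baseSet_trivializationAt F E p)).symm

/-- Fibrewise linear functions of a smooth map into `E` are smooth where its base point is locally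
constant. -/
theorem contMDiffAt_fiberwise {V' : Type*} [NormedAddCommGroup V'] [NormedSpace ℝ V']
    {H : Type*} [TopologicalSpace H] {I : ModelWithCorners ℝ V' H}
    {N : Type*} [TopologicalSpace N] [ChartedSpace H N]
    {W : Type*} [NormedAddCommGroup W] [NormedSpace ℝ W] (l : ∀ q, E q →ₗ[ℝ] W)
    {h : N → TotalSpace F E} {n : N} (hh : ContMDiffAt I (𝓘(ℝ, EM).prod 𝓘(ℝ, F)) ∞ h n)
    (hp : ∀ᶠ m in 𝓝 n, (h m).proj = (h n).proj) :
    ContMDiffAt I 𝓘(ℝ, W) ∞ (fun m => l (h m).proj (h m).2) n := by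
  set p := (h n).proj with hpn
  set e := trivializationAt F E p with he
  set L : F →L[ℝ] W := LinearMap.toContinuousLinearMap
    ((l p).comp (e.linearEquivAt ℝ p (mem_baseSet_trivializationAt F E p)).symm.toLinearMap) with hL
  have h1 := (contMDiffAt_totalSpace.1 hh).2
  have h2 : ContMDiffAt I 𝓘(ℝ, W) ∞ (fun m => L (e (h m)).2) n :=
    ContMDiffAt.comp (g := L) n L.contMDiff.contMDiffAt h1
  refine h2.congr_of_eventuallyEq ?_
  filter_upwards [hp] with m hm
  have key : ∀ z : TotalSpace F E, z.proj = p → l z.proj z.2 = L (e z).2 := by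
    rintro ⟨q, v⟩ hq
    obtain rfl : q = p := hq
    rw [hL]
    change l p v = l p ((e.linearEquivAt ℝ p _).symm ((e.linearEquivAt ℝ p
      (mem_baseSet_trivializationAt F E p)) v))
    rw [LinearEquiv.symm_apply_apply]
  exact key _ hm

variable [IsManifold 𝓘(ℝ, EM) ∞ M]

/-- A `Frame` consists of global sections, so a local frame is multiplied by a bump function
supported in the trivialising set, and `U` is shrunk to where this function is `1`. -/
theorem exists_frame [FiniteDimensional ℝ EM] [T2Space M] [ContMDiffVectorBundle ∞ F E 𝓘(ℝ, EM)]
    (p : M) : ∃ b : Frame EM F E, p ∈ b.U := by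
  set e := trivializationAt F E p with he
  set B := Module.finBasis ℝ F with hB
  have hp : p ∈ e.baseSet := mem_baseSet_trivializationAt F E p
  obtain ⟨f, -, hf⟩ := (SmoothBumpFunction.nhds_basis_tsupport (I := 𝓘(ℝ, EM)) p).mem_iff.1
    (e.open_baseSet.mem_nhds hp)
  have hsm : ∀ I, ContMDiff 𝓘(ℝ, EM) (𝓘(ℝ, EM).prod 𝓘(ℝ, F)) ∞
      (fun q => TotalSpace.mk' F q (f q • e.localFrame B I q)) := fun I =>
    ContMDiffOn.smul_section_of_tsupport (s := e.localFrame B I) f.contMDiff.contMDiffOn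
      e.open_baseSet hf (e.contMDiffOn_localFrame_baseSet ∞ B I)
  refine ⟨⟨interior {q | f q = 1} ∩ e.baseSet, isOpen_interior.inter e.open_baseSet,
    fun I => ⟨fun q => f q • e.localFrame B I q, hsm I⟩, ?_⟩, ?_, hp⟩
  · refine ((e.isLocalFrameOn_localFrame_baseSet 𝓘(ℝ, EM) ∞ B).mono inter_subset_right).congr ?_
    intro I q hq
    have h1 : f q = 1 := interior_subset (s := {q | f q = 1}) hq.1
    change _ = f q • e.localFrame B I q
    rw [h1, one_smul]
  · rw [mem_interior_iff_mem_nhds]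
    exact f.eventuallyEq_one

theorem Frame.sum_comp (b : Frame EM F E) {p : M} (hp : p ∈ b.U) (v : E p) :
    v = ∑ I, b.comp I p v • b.sec I p := by
  classical
  have := b.isFrame.coeff_sum_eq (Function.update (fun q => (0 : E q)) p v) hp
  simp only [Function.update_self] at this
  exact this

variable {L : LieAlgebroid EM F E} {T : SymTensor EM F E}

theorem LieAlgebroid.IsAbelianBundle.structureFun_eq_zero (hL : L.IsAbelianBundle)
    (b : Frame EM F E) (J K I : Fin (Module.finrank ℝ F)) (p : M) :
    L.structureFun b J K I p = 0 := by
  rw [LieAlgebroid.structureFun, hL.2]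
  exact map_zero _

variable {d : ℕ} {S : Type} [TopologicalSpace S] [ChartedSpace (EuclideanSpace ℝ (Fin d)) S]
  [IsManifold (𝓡 d) ∞ S] {φ : BundleField EM F E d S}

theorem BundleField.contMDiff_base (φ : BundleField EM F E d S) :
    ContMDiff (𝓡 d) 𝓘(ℝ, EM) ∞ φ.base := by
  have h1 : ContMDiff (𝓡 d) (𝓡 d).tangent ∞
      (zeroSection (EuclideanSpace ℝ (Fin d)) (TangentSpace (𝓡 d) : S → Type _)) :=
    contMDiff_zeroSection ℝ _
  exact (contMDiff_proj E).comp (φ.contMDiff.comp h1)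

theorem LieAlgebroid.IsSolution.isLocallyConstant_base (hL : L.IsAbelianBundle)
    (hφ : L.IsSolution φ) : IsLocallyConstant φ.base := by
  rw [IsLocallyConstant.iff_eventually_eq]
  refine eventually_eq_of_mfderiv_eq_zero (φ.contMDiff_base.mdifferentiable (by simp)) fun x => ?_
  ext v
  rw [hφ.1 x v, hL.1]; rfl

/-- The image of the one-form of a field under linear maps from the fibres to `ℝ^d`. -/
def BundleField.coframe (φ : BundleField EM F E d S)
    (l : ∀ q, E q →ₗ[ℝ] EuclideanSpace ℝ (Fin d)) (x : S) :
    EuclideanSpace ℝ (Fin d) →L[ℝ] EuclideanSpace ℝ (Fin d) :=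
  LinearMap.toContinuousLinearMap ((l (φ.base x)).comp (φ.form x).toLinearMap)

/-- The curve of vectors is the tangent map of the inverse chart applied to a constant section,
which exhibits it as smooth into the tangent bundle. -/
theorem contMDiffAt_chartVec (x : S) (w : EuclideanSpace ℝ (Fin d))
    {y : EuclideanSpace ℝ (Fin d)} (hy : y ∈ (extChartAt (𝓡 d) x).target) :
    ContMDiffAt (𝓡 d) (𝓡 d).tangent ∞
      (fun y => (⟨(extChartAt (𝓡 d) x).symm y, chartVec x y w⟩ : TangentBundle (𝓡 d) S)) y := by
  have ht := isOpen_extChartAt_target (I := 𝓡 d) x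
  have h1 : ContMDiff (𝓡 d) (𝓡 d).tangent ∞ (fun y : EuclideanSpace ℝ (Fin d) =>
      (⟨y, w⟩ : TangentBundle (𝓡 d) (EuclideanSpace ℝ (Fin d)))) := by
    intro y
    rw [contMDiffAt_totalSpace]
    refine ⟨contMDiffAt_id, ?_⟩
    simpa using contMDiffAt_const
  have h2 := (contMDiffOn_extChartAt_symm (n := ∞) (I := 𝓡 d) x).contMDiffOn_tangentMapWithin
    (m := ∞) le_rfl ht.uniqueMDiffOn
  have h3 : ContMDiffAt (𝓡 d).tangent (𝓡 d).tangent ∞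
      (tangentMapWithin (𝓡 d) (𝓡 d) (extChartAt (𝓡 d) x).symm (extChartAt (𝓡 d) x).target)
      (⟨y, w⟩ : TangentBundle (𝓡 d) (EuclideanSpace ℝ (Fin d))) :=
    h2.contMDiffAt ((ht.preimage (FiberBundle.continuous_proj _ _)).mem_nhds hy)
  refine (ContMDiffAt.comp y h3 h1.contMDiffAt).congr_of_eventuallyEq ?_
  filter_upwards [ht.mem_nhds hy] with z hz
  simp only [Function.comp_apply, tangentMapWithin]
  rw [mfderivWithin_of_isOpen ht hz]
  rfl

theorem contDiffAt_form_chartVec (hφ : IsLocallyConstant φ.base) {W : Type*}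
    [NormedAddCommGroup W] [NormedSpace ℝ W] (l : ∀ q, E q →ₗ[ℝ] W) (x : S)
    (w : EuclideanSpace ℝ (Fin d))
    {y : EuclideanSpace ℝ (Fin d)} (hy : y ∈ (extChartAt (𝓡 d) x).target) :
    ContDiffAt ℝ ∞ (fun y => l _ (φ.form _ (chartVec x y w))) y := by
  rw [← contMDiffAt_iff_contDiffAt]
  refine contMDiffAt_fiberwise (EM := EM) (F := F) l
    (h := fun y => ⟨φ.base ((extChartAt (𝓡 d) x).symm y), φ.form _ (chartVec x y w)⟩) ?_ ?_
  · exact ContMDiffAt.comp y (φ.contMDiff _) (contMDiffAt_chartVec x w hy)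
  · exact (continuousAt_extChartAt_symm'' hy).eventually (hφ.eventually_eq _)

/-- Since the base point is locally constant, `l` and the frame vectors are locally fixed, and the
form is a combination of the `A^I` with constant coefficients. The structure functions vanish, so
`dA^I = 0`. -/
theorem LieAlgebroid.IsSolution.isClosedCoframe [FiniteDimensional ℝ EM] [T2Space M]
    [ContMDiffVectorBundle ∞ F E 𝓘(ℝ, EM)] (hL : L.IsAbelianBundle)
    (hφ : L.IsSolution φ) (l : ∀ q, E q →ₗ[ℝ] EuclideanSpace ℝ (Fin d))
    (hinj : ∀ x, Function.Injective (φ.coframe l x)) : IsClosedCoframe (φ.coframe l) := by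
  have hb := hφ.isLocallyConstant_base hL
  have hcd : ∀ x, ∀ y ∈ (extChartAt (𝓡 d) x).target,
      ContDiffAt ℝ ∞ (pull (φ.coframe l) x) y := by
    intro x y hy
    have : ContDiffOn ℝ ∞ (pull (φ.coframe l) x) (extChartAt (𝓡 d) x).target :=
      contDiffOn_clm_apply.2 fun w y hy =>
        (contDiffAt_form_chartVec hb l x w hy).contDiffWithinAt
    exact this.contDiffAt ((isOpen_extChartAt_target x).mem_nhds hy)
  refine ⟨fun x y hy => (hcd x y hy).contDiffWithinAt, fun x v w => ?_, hinj⟩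
  have hyt := mem_extChartAt_target (I := 𝓡 d) x
  set y := extChartAt (𝓡 d) x x with hy
  obtain ⟨b, hbU⟩ := exists_frame (E := E) (EM := EM) (F := F) (φ.base x)
  have hA : ∀ I w, DifferentiableAt ℝ (fun y => b.comp I _ (φ.form _ (chartVec x y w))) y :=
    fun I w => (contDiffAt_form_chartVec hb (b.comp I) x w hyt).differentiableAt (by simp)
  have hloc : ∀ᶠ z in 𝓝 y, φ.base ((extChartAt (𝓡 d) x).symm z) = φ.base x := by
    have h1 : Tendsto (extChartAt (𝓡 d) x).symm (𝓝 y) (𝓝 x) := by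
      have := (continuousAt_extChartAt_symm (I := 𝓡 d) x).tendsto
      rwa [extChartAt_to_inv] at this
    exact h1.eventually (hb.eventually_eq x)
  have hsum : ∀ w, (fun z => pull (φ.coframe l) x z w) =ᶠ[𝓝 y] fun z =>
      ∑ I, b.comp I _ (φ.form _ (chartVec x z w)) • l (φ.base x) (b.sec I (φ.base x)) := by
    intro w
    filter_upwards [hloc] with z hz
    have key : ∀ q (hq : q = φ.base x) (u : E q),
        l q u = ∑ I, b.comp I q u • l (φ.base x) (b.sec I (φ.base x)) := by
      rintro q rfl u
      conv_lhs => rw [b.sum_comp hbU u]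
      simp
    exact key _ hz _
  have hder : ∀ v w, fderiv ℝ (pull (φ.coframe l) x) y v w
      = ∑ I, fderiv ℝ (fun z => b.comp I _ (φ.form _ (chartVec x z w))) y v •
        l (φ.base x) (b.sec I (φ.base x)) := by
    intro v w
    have h1 := ((hcd x y hyt).differentiableAt (by simp)).hasFDerivAt.clm_apply
      (hasFDerivAt_const w y)
    have h2 : HasFDerivAt (fun z => ∑ I, b.comp I _ (φ.form _ (chartVec x z w)) •
        l (φ.base x) (b.sec I (φ.base x))) _ y :=
      HasFDerivAt.fun_sum fun I _ => (hA I w).hasFDerivAt.smul_const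
        (l (φ.base x) (b.sec I (φ.base x)))
    have h3 := (h1.congr_of_eventuallyEq (hsum w).symm).unique h2
    have h4 := DFunLike.congr_fun h3 v
    simpa using h4
  rw [hder, hder]
  refine Finset.sum_congr rfl fun I _ => ?_
  have h5 := hφ.2 b x hbU I v w
  simp only [hL.structureFun_eq_zero, zero_mul, Finset.sum_const_zero, mul_zero, add_zero] at h5
  rw [extDerivOneForm, sub_eq_zero] at h5
  rw [h5]

end Algebroid

/-! ### Reduction of the symmetric form modulo its kernel, and exact solutions. -/

section Algebroid

variable {EM : Type*} [NormedAddCommGroup EM] [NormedSpace ℝ EM]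
  {M : Type*} [TopologicalSpace M] [ChartedSpace EM M]
  {F : Type*} [NormedAddCommGroup F] [NormedSpace ℝ F] [FiniteDimensional ℝ F]
  {E : M → Type*} [TopologicalSpace (TotalSpace F E)] [∀ p, TopologicalSpace (E p)]
  [∀ p, AddCommGroup (E p)] [∀ p, Module ℝ (E p)]
  [∀ p, IsTopologicalAddGroup (E p)] [∀ p, ContinuousSMul ℝ (E p)]
  [FiberBundle F E] [VectorBundle ℝ F E]

/-- A symmetric bilinear form of constant rank `d` factors through a nondegenerate one on
`ℝ^d`. -/
theorem SymTensor.exists_factorization {d : ℕ} (T : SymTensor EM F E) (p : M)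
    (h : Module.finrank ℝ (T.toFun p).range = d) :
    ∃ (l : E p →ₗ[ℝ] EuclideanSpace ℝ (Fin d))
      (B : EuclideanSpace ℝ (Fin d) →L[ℝ] EuclideanSpace ℝ (Fin d) →L[ℝ] ℝ),
      Function.Surjective l ∧ (∀ v w, B v w = B w v) ∧ (∀ v, (∀ w, B v w = 0) → v = 0) ∧
      ∀ u v, T.toFun p u v = B (l u) (l v) := by
  have := finiteDimensional_fiber F (E := E) p
  -- The quotient of `E p` by the kernel is isomorphic to the image, hence has dimension `d`. Below,
  -- `B` is read off through a section `s` of the quotient map; symmetry makes the choice of `s`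
  -- irrelevant.
  set K := LinearMap.ker (T.toFun p).toLinearMap with hK
  have hfr : Module.finrank ℝ (E p ⧸ K) = Module.finrank ℝ (EuclideanSpace ℝ (Fin d)) := by
    rw [finrank_euclideanSpace_fin, ← h]
    exact (T.toFun p).toLinearMap.quotKerEquivRange.finrank_eq
  set i := LinearEquiv.ofFinrankEq _ _ hfr with hi
  set l : E p →ₗ[ℝ] EuclideanSpace ℝ (Fin d) :=
    i.toLinearMap.comp K.mkQ with hl
  have hls : Function.Surjective l := i.surjective.comp K.mkQ_surjective
  obtain ⟨s, hs⟩ := LinearMap.exists_rightInverse_of_surjective l (LinearMap.range_eq_top.2 hls)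
  have hls' : ∀ v, l (s v) = v := fun v => DFunLike.congr_fun hs v
  have hker : ∀ u u', l u = l u' → T.toFun p u = T.toFun p u' := by
    intro u u' huu
    have h1 : K.mkQ u = K.mkQ u' := i.injective huu
    have h2 : u - u' ∈ K := (Submodule.Quotient.eq K).1 h1
    have h3 : T.toFun p (u - u') = 0 := h2
    rwa [map_sub, sub_eq_zero] at h3
  have hT : ∀ u v, T.toFun p (s (l u)) (s (l v)) = T.toFun p u v := by
    intro u v
    rw [hker (s (l u)) u (hls' _), T.symm, hker (s (l v)) v (hls' _), T.symm]
  set B₀ : EuclideanSpace ℝ (Fin d) →ₗ[ℝ] EuclideanSpace ℝ (Fin d) →ₗ[ℝ] ℝ :=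
    LinearMap.mk₂ ℝ (fun v w => T.toFun p (s v) (s w)) (by simp) (by simp) (by simp) (by simp)
  refine ⟨l, LinearMap.toContinuousLinearMap
    ((LinearMap.toContinuousLinearMap : _ ≃ₗ[ℝ] (EuclideanSpace ℝ (Fin d) →L[ℝ] ℝ)).toLinearMap.comp
      B₀), hls, ?_, ?_, ?_⟩
  · intro v w
    exact T.symm _ _ _
  · intro v hv
    have h0 : T.toFun p (s v) = T.toFun p 0 := by
      ext u
      rw [map_zero]
      have h1 : T.toFun p (s v) (s (l u)) = 0 := hv (l u)
      have h2 := hT (s v) u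
      rw [hls'] at h2
      rw [← h2, h1]; rfl
    have h1 : l (s v) = l 0 := by
      have h2 : s v - 0 ∈ K := by
        rw [sub_zero]
        exact h0.trans (map_zero _)
      exact congrArg i ((Submodule.Quotient.eq K).2 h2)
    rw [← hls' v, h1, map_zero]
  · intro u v
    exact (hT u v).symm

/-! ### Exact fields with constant base map -/

section ExactField

variable {G : Type*} [NormedAddCommGroup G] [NormedSpace ℝ G] [FiniteDimensional ℝ G]

theorem contMDiff_const_fiber {V' : Type*} [NormedAddCommGroup V'] [NormedSpace ℝ V']
    {H : Type*} [TopologicalSpace H] {I : ModelWithCorners ℝ V' H}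
    {N : Type*} [TopologicalSpace N] [ChartedSpace H N] (p : M) (s : G →ₗ[ℝ] E p)
    {f : N → G} (hf : ContMDiff I 𝓘(ℝ, G) ∞ f) :
    ContMDiff I (𝓘(ℝ, EM).prod 𝓘(ℝ, F)) ∞ (fun n => (⟨p, s (f n)⟩ : TotalSpace F E)) := by
  intro n
  rw [contMDiffAt_totalSpace]
  refine ⟨contMDiffAt_const, ?_⟩
  set L : G →L[ℝ] F := LinearMap.toContinuousLinearMap
    (((trivializationAt F E p).linearEquivAt ℝ p
      (mem_baseSet_trivializationAt F E p)).toLinearMap.comp s)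
  exact ContMDiffAt.comp (g := L) n L.contMDiff.contMDiffAt (hf n)

variable {d : ℕ}

theorem contMDiff_tangentBundle_euclidean_snd :
    ContMDiff (𝓡 d).tangent (𝓡 d) ∞
      (fun v : TangentBundle (𝓡 d) (EuclideanSpace ℝ (Fin d)) =>
        (v.2 : EuclideanSpace ℝ (Fin d))) := by
  intro v
  have h := contMDiffAt_id (I := (𝓡 d).tangent) (n := ∞) (x := v)
  rw [contMDiffAt_totalSpace] at h
  simpa using h.2

variable [IsManifold 𝓘(ℝ, EM) ∞ M]

/-- The field on `ℝ^d` with constant base map `p` and one-form `s (dY)`. -/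
def exactField (p : M) (s : G →ₗ[ℝ] E p) (Y : EuclideanSpace ℝ (Fin d) → G)
    (hY : ContDiff ℝ ∞ Y) : BundleField EM F E d (EuclideanSpace ℝ (Fin d)) where
  base _ := p
  form x := (LinearMap.toContinuousLinearMap s).comp (fderiv ℝ Y x)
  contMDiff := by
    have h1 : ContMDiff (𝓡 d).tangent 𝓘(ℝ, G) ∞
        (fun v : TangentBundle (𝓡 d) (EuclideanSpace ℝ (Fin d)) =>
          fderiv ℝ Y v.1 (v.2 : EuclideanSpace ℝ (Fin d))) := by
      have h2 : ContMDiff (𝓡 d) 𝓘(ℝ, EuclideanSpace ℝ (Fin d) →L[ℝ] G) ∞ (fderiv ℝ Y) :=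
        (hY.fderiv_right (m := ∞) le_rfl).contMDiff
      exact (h2.comp (contMDiff_proj (TangentSpace (𝓡 d)))).clm_apply
        contMDiff_tangentBundle_euclidean_snd
    exact contMDiff_const_fiber p s h1

theorem chartVec_euclidean (x y w : EuclideanSpace ℝ (Fin d)) : chartVec x y w = w := by
  have key : ∀ f : EuclideanSpace ℝ (Fin d) → EuclideanSpace ℝ (Fin d), f = id →
      (mfderiv (𝓡 d) (𝓡 d) f y w : EuclideanSpace ℝ (Fin d)) = w := by
    rintro f rfl
    exact DFunLike.congr_fun mfderiv_id w
  exact key (extChartAt (𝓡 d) x).symm (by simp; rfl)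

theorem exactField_isSolution {L : LieAlgebroid EM F E} (hL : L.IsAbelianBundle) (p : M)
    (s : G →ₗ[ℝ] E p) (Y : EuclideanSpace ℝ (Fin d) → G) (hY : ContDiff ℝ ∞ Y) :
    L.IsSolution (exactField p s Y hY) := by
  constructor
  · intro x v
    rw [hL.1]
    exact DFunLike.congr_fun
      (mfderiv_const : mfderiv (𝓡 d) 𝓘(ℝ, EM) (fun _ : EuclideanSpace ℝ (Fin d) => p) x = 0) v
  · intro b x hx I w₁ w₂
    simp only [hL.structureFun_eq_zero, zero_mul, Finset.sum_const_zero, mul_zero, add_zero]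
    set m : G →L[ℝ] ℝ := LinearMap.toContinuousLinearMap ((b.comp I p).comp s) with hm
    have hd : DifferentiableAt ℝ (fderiv ℝ Y) x :=
      ((hY.fderiv_right (m := ∞) le_rfl).differentiable (by simp)) x
    have h1 : ∀ w v, fderiv ℝ (fun y => m (fderiv ℝ Y y w)) x v
        = m (fderiv ℝ (fderiv ℝ Y) x v w) := by
      intro w v
      have h2 := m.hasFDerivAt.comp x (hd.hasFDerivAt.clm_apply (hasFDerivAt_const w x))
      have h3 := h2.fderiv
      rw [Function.comp_def] at h3
      rw [h3]
      simp
    have h2 : ∀ w, (fun y => b.comp I ((exactField (EM := EM) (F := F) p s Y hY).base ((extChartAt (𝓡 d) x).symm y))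
        ((exactField (EM := EM) (F := F) p s Y hY).form ((extChartAt (𝓡 d) x).symm y) (chartVec x y w)))
        = fun y => m (fderiv ℝ Y y w) := by
      intro w
      funext y
      rw [chartVec_euclidean]
      rfl
    rw [extDerivOneForm, h2, h2]
    change fderiv ℝ _ x w₁ - fderiv ℝ _ x w₂ = 0
    rw [h1, h1, sub_eq_zero]
    exact congrArg m ((hY.contDiffAt.isSymmSndFDerivAt (by simpa using two_le_infty)) w₁ w₂)

end ExactField

end Algebroid

/-- Differentiation under the integral sign for a jointly smooth function. -/
theorem hasFDerivAt_integral_of_contDiffOn {V W : Type*} [NormedAddCommGroup V] [NormedSpace ℝ V]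
    [FiniteDimensional ℝ V] [NormedAddCommGroup W] [NormedSpace ℝ W]
    {f : ℝ × V → W} {U : Set V} (hU : IsOpen U) (hf : ContDiffOn ℝ ∞ f (univ ×ˢ U)) {y : V}
    (hy : y ∈ U) :
    HasFDerivAt (fun z => ∫ t in (0 : ℝ)..1, f (t, z))
      (∫ t in (0 : ℝ)..1, fderiv ℝ (fun z => f (t, z)) y) y ∧
    Continuous fun t => fderiv ℝ (fun z => f (t, z)) y := by
  have hUo : IsOpen ((univ : Set ℝ) ×ˢ U) := isOpen_univ.prod hU
  set f' : ℝ × V → V →L[ℝ] W := fun q => (fderiv ℝ f q).comp (ContinuousLinearMap.inr ℝ ℝ V)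
    with hf'
  have hder : ∀ t, ∀ z ∈ U, HasFDerivAt (fun z => f (t, z)) (f' (t, z)) z := by
    intro t z hz
    have h1 : DifferentiableAt ℝ f (t, z) :=
      (hf.contDiffAt (hUo.mem_nhds ⟨trivial, hz⟩)).differentiableAt (by simp)
    exact h1.hasFDerivAt.comp z (hasFDerivAt_prodMk_right t z)
  have hcont : ContinuousOn f' (univ ×ˢ U) := by
    have h1 : ContinuousOn (fderiv ℝ f) (univ ×ˢ U) :=
      hf.continuousOn_fderiv_of_isOpen hUo (by simp)
    exact h1.clm_comp continuousOn_const
  obtain ⟨r, hr, hb⟩ := Metric.nhds_basis_closedBall.mem_iff.1 (hU.mem_nhds hy)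
  -- Compactness of `[0, 1]` times a closed ball supplies the constant that dominates the
  -- derivative.
  obtain ⟨C, hC⟩ := (isCompact_Icc.prod (isCompact_closedBall y r)).exists_bound_of_continuousOn
    (hcont.mono (prod_mono (subset_univ (Icc (0 : ℝ) 1)) hb))
  have hslice : ∀ z ∈ U, Continuous fun t => f (t, z) := fun z hz =>
    continuousOn_univ.1 (hf.continuousOn.comp (by fun_prop) fun t _ => ⟨trivial, hz⟩)
  have hslice' : Continuous fun t => f' (t, y) :=
    continuousOn_univ.1 (hcont.comp (by fun_prop) fun t _ => ⟨trivial, hy⟩)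
  have heq : ∀ t, fderiv ℝ (fun z => f (t, z)) y = f' (t, y) := fun t => (hder t y hy).fderiv
  simp only [heq]
  refine ⟨?_, hslice'⟩
  refine intervalIntegral.hasFDerivAt_integral_of_dominated_of_fderiv_le (bound := fun _ => C)
    (F := fun z t => f (t, z)) (F' := fun z t => f' (t, z))
    (Metric.closedBall_mem_nhds y hr) ?_ ?_ ?_ ?_ ?_ ?_
  · filter_upwards [hU.mem_nhds hy] with z hz
    exact (hslice z hz).aestronglyMeasurable
  · exact (hslice y hy).intervalIntegrable _ _
  · exact hslice'.aestronglyMeasurable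
  · refine Eventually.of_forall fun t ht z hz => hC (t, z) ⟨?_, hz⟩
    rw [uIoc_of_le zero_le_one] at ht
    exact ⟨ht.1.le, ht.2⟩
  · exact intervalIntegrable_const
  · exact Eventually.of_forall fun t _ z hz => hder t z (hb hz)

/-! ### Gauge equivalence as exactness, and sufficiency of rank `d`. -/

section Algebroid

variable {EM : Type*} [NormedAddCommGroup EM] [NormedSpace ℝ EM]
  {M : Type*} [TopologicalSpace M] [ChartedSpace EM M]
  {F : Type*} [NormedAddCommGroup F] [NormedSpace ℝ F] [FiniteDimensional ℝ F]
  {E : M → Type*} [TopologicalSpace (TotalSpace F E)] [∀ p, TopologicalSpace (E p)]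
  [∀ p, AddCommGroup (E p)] [∀ p, Module ℝ (E p)]
  [∀ p, IsTopologicalAddGroup (E p)] [∀ p, ContinuousSMul ℝ (E p)]
  [FiberBundle F E] [VectorBundle ℝ F E]
  [FiniteDimensional ℝ EM] [IsManifold 𝓘(ℝ, EM) ∞ M] [T2Space M]
  [ContMDiffVectorBundle ∞ F E 𝓘(ℝ, EM)]
  {L : LieAlgebroid EM F E} {T : SymTensor EM F E}
  {d : ℕ} {S : Type} [TopologicalSpace S] [ChartedSpace (EuclideanSpace ℝ (Fin d)) S]
  [IsManifold (𝓡 d) ∞ S]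

/-- The forms of two gauge equivalent fields have the same base map and differ by an exact
form. -/
theorem GaugeEquivalent.exists_primitive (hL : L.IsAbelianBundle) {φ₁ φ₂ : BundleField EM F E d S}
    (h : GaugeEquivalent L T φ₁ φ₂) (l : ∀ q, E q →ₗ[ℝ] EuclideanSpace ℝ (Fin d)) :
    φ₂.base = φ₁.base ∧ ∃ lam : S → EuclideanSpace ℝ (Fin d),
      ∀ x, HasMFDerivAt (𝓡 d) (𝓡 d) lam x (φ₂.coframe l x - φ₁.coframe l x) := by
  obtain ⟨φ, ε, rfl, rfl, hφs, hεs, hsol, hbase, hform⟩ := h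
  have hb0 := ((hsol 0).1).isLocallyConstant_base hL
  -- The anchor vanishes, so the gauge path does not move the base points.
  have hbt : ∀ t x, (φ t).base x = (φ 0).base x := by
    intro t x
    have hsm : ContMDiff 𝓘(ℝ, ℝ) 𝓘(ℝ, EM) ∞ (fun s : ℝ => (φ s).base x) := by
      have h1 : ContMDiff 𝓘(ℝ, ℝ) (𝓘(ℝ, ℝ).prod (𝓡 d)) ∞ (fun s : ℝ => (s, x)) :=
        contMDiff_id.prodMk contMDiff_const
      exact (contMDiff_proj E).comp (hεs.comp h1)
    have h2 : IsLocallyConstant (fun s : ℝ => (φ s).base x) := by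
      rw [IsLocallyConstant.iff_eventually_eq]
      refine eventually_eq_of_mfderiv_eq_zero (hsm.mdifferentiable (by simp)) fun s => ?_
      refine ContinuousLinearMap.ext_ring ((hbase s x).trans ?_)
      rw [hL.1]; rfl
    exact h2.apply_eq_of_preconnectedSpace t 0
  refine ⟨funext (hbt 1), ?_⟩
  set e : ℝ × S → EuclideanSpace ℝ (Fin d) := fun q => l ((φ q.1).base q.2) (ε q.1 q.2) with he
  have hloc : ∀ q : ℝ × S, ∀ᶠ q' in 𝓝 q, (φ q'.1).base q'.2 = (φ q.1).base q.2 := by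
    intro q
    filter_upwards [continuous_snd.continuousAt.eventually (hb0.eventually_eq q.2)] with q' hq'
    exact (hbt _ _).trans (hq'.trans (hbt _ _).symm)
  have hes : ∀ q, ContMDiffAt (𝓘(ℝ, ℝ).prod (𝓡 d)) (𝓡 d) ∞ e q := fun q =>
    contMDiffAt_fiberwise (EM := EM) (F := F) l
      (h := fun q : ℝ × S => ⟨(φ q.1).base q.2, ε q.1 q.2⟩) (hεs q) (hloc q)
  have hslice : ∀ t : ℝ, ContMDiff (𝓡 d) (𝓘(ℝ, ℝ).prod (𝓡 d)) ∞ (fun x : S => (t, x)) := fun t =>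
    (contMDiff_const : ContMDiff (𝓡 d) 𝓘(ℝ, ℝ) ∞ fun _ : S => t).prodMk contMDiff_id
  -- Expanding in a frame around the common base point turns the gauge law, whose bracket term is
  -- zero, into `∂_t (l A) = d(l ε)`.
  have hder : ∀ (x : S) (v : EuclideanSpace ℝ (Fin d)) (t : ℝ),
      HasDerivAt (fun s => (φ s).coframe l x v)
        (mfderiv (𝓡 d) (𝓡 d) (fun x' => e (t, x')) x v : EuclideanSpace ℝ (Fin d)) t := by
    intro x v t
    obtain ⟨b, hbU⟩ := exists_frame (E := E) (EM := EM) (F := F) ((φ 0).base x)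
    set p := (φ 0).base x with hp
    have key : ∀ q (hq : q = p) (u : E q),
        l q u = ∑ I, b.comp I q u • l p (b.sec I p) := by
      rintro q rfl u
      conv_lhs => rw [b.sum_comp hbU u]
      simp
    have h1 : ∀ s, (φ s).coframe l x v
        = ∑ I, b.comp I ((φ s).base x) ((φ s).form x v) • l p (b.sec I p) := fun s =>
      key _ (hbt s x) _
    have h2 := HasDerivAt.fun_sum (u := Finset.univ) fun I _ =>
      (hform b t x (by rw [hbt]; exact hbU) I v).smul_const (l p (b.sec I p))
    have hcd : ∀ I, MDifferentiableAt (𝓡 d) 𝓘(ℝ, ℝ)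
        (fun x' => b.comp I ((φ t).base x') (ε t x')) x := by
      intro I
      have h3 : ContMDiffAt (𝓡 d) 𝓘(ℝ, ℝ) ∞
          (fun x' => b.comp I ((φ t).base x') (ε t x')) x :=
        contMDiffAt_fiberwise (EM := EM) (F := F) (b.comp I)
          (h := fun x' : S => ⟨(φ t).base x', ε t x'⟩) ((hεs.comp (hslice t)) x)
          ((hslice t).continuous.continuousAt.eventually (hloc (t, x)))
      exact h3.mdifferentiableAt (by simp)
    have h4 : (fun x' => e (t, x')) =ᶠ[𝓝 x] fun x' =>
        (∑ I, fun x' => b.comp I ((φ t).base x') (ε t x') • l p (b.sec I p) :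
          S → EuclideanSpace ℝ (Fin d)) x' := by
      filter_upwards [hb0.eventually_eq x] with x' hx'
      refine (key _ ((hbt t x').trans hx') _).trans ?_
      rw [Finset.sum_apply]
    have h5 : HasMFDerivAt (𝓡 d) (𝓡 d)
        (∑ I, fun x' => b.comp I ((φ t).base x') (ε t x') • l p (b.sec I p)) x
        (∑ I, (ContinuousLinearMap.toSpanSingleton ℝ (l p (b.sec I p))).comp
          (mfderiv (𝓡 d) 𝓘(ℝ, ℝ) (fun x' => b.comp I ((φ t).base x') (ε t x')) x) :
          EuclideanSpace ℝ (Fin d) →L[ℝ] EuclideanSpace ℝ (Fin d)) := by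
      refine HasMFDerivAt.sum fun I _ => ?_
      have h6 : HasMFDerivAt 𝓘(ℝ, ℝ) (𝓡 d) (fun r : ℝ => r • l p (b.sec I p))
          (b.comp I ((φ t).base x) (ε t x))
          (ContinuousLinearMap.toSpanSingleton ℝ (l p (b.sec I p))) := by
        refine HasFDerivAt.hasMFDerivAt ?_
        exact (ContinuousLinearMap.toSpanSingleton ℝ (l p (b.sec I p))).hasFDerivAt
      exact HasMFDerivAt.comp (g := fun r : ℝ => r • l p (b.sec I p)) x h6 (hcd I).hasMFDerivAt
    have h7 := (h5.congr_of_eventuallyEq h4).mfderiv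
    simp only [h1]
    refine h2.congr_deriv ?_
    have h8 := DFunLike.congr_fun h7 v
    refine Eq.trans ?_ h8.symm
    simp only [hL.structureFun_eq_zero, zero_mul, Finset.sum_const_zero, dirDeriv]
    have key₂ : ∀ (c : Fin (Module.finrank ℝ F) → EuclideanSpace ℝ (Fin d) →L[ℝ] ℝ)
        (u : Fin (Module.finrank ℝ F) → EuclideanSpace ℝ (Fin d)),
        ∑ I, c I v • u I
          = (∑ I, (ContinuousLinearMap.toSpanSingleton ℝ (u I)).comp (c I) :
            EuclideanSpace ℝ (Fin d) →L[ℝ] EuclideanSpace ℝ (Fin d)) v := by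
      intro c u
      simp
    refine Eq.trans (Finset.sum_congr rfl fun I _ => congrArg (· • l p (b.sec I p)) (add_zero _))
      ?_
    exact key₂ (fun I => mfderiv (𝓡 d) 𝓘(ℝ, ℝ)
      (fun x' => b.comp I ((φ t).base x') (ε t x')) x) _
  -- Integrating `∂_t (l A) = d(l ε)` over the path and exchanging `d` with the integral makes the
  -- time average of `l ε` a primitive.
  refine ⟨fun x => ∫ t in (0 : ℝ)..1, e (t, x), fun x => ?_⟩
  set ψ := extChartAt (𝓡 d) x with hψ
  have hto : IsOpen ψ.target := isOpen_extChartAt_target x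
  have hcd : ContDiffOn ℝ ∞ (fun q : ℝ × EuclideanSpace ℝ (Fin d) => e (q.1, ψ.symm q.2))
      (univ ×ˢ ψ.target) := by
    rintro ⟨t, y⟩ ⟨-, hy⟩
    refine ContDiffAt.contDiffWithinAt ?_
    rw [← contMDiffAt_iff_contDiffAt, modelWithCornersSelf_prod, ← chartedSpaceSelf_prod]
    have h1 : ContMDiffAt (𝓡 d) (𝓡 d) ∞ ψ.symm y :=
      (contMDiffOn_extChartAt_symm (n := ∞) x).contMDiffAt (hto.mem_nhds hy)
    have h2 : ContMDiffAt (𝓘(ℝ, ℝ).prod (𝓡 d)) (𝓘(ℝ, ℝ).prod (𝓡 d)) ∞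
        (fun q : ℝ × EuclideanSpace ℝ (Fin d) => (q.1, ψ.symm q.2)) (t, y) :=
      contMDiffAt_fst.prodMk (ContMDiffAt.comp (g := ψ.symm) (t, y) h1 contMDiffAt_snd)
    have h3 : ContMDiffAt (𝓘(ℝ, ℝ).prod (𝓡 d)) (𝓡 d) ∞
        (fun q : ℝ × EuclideanSpace ℝ (Fin d) => e (q.1, ψ.symm q.2)) (t, y) :=
      ContMDiffAt.comp (t, y) (hes _) h2
    exact h3
  obtain ⟨h1, h2⟩ := hasFDerivAt_integral_of_contDiffOn hto hcd (mem_extChartAt_target x)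
  simp only [← hψ] at h1 h2
  have hmf : ∀ t, (mfderiv (𝓡 d) (𝓡 d) (fun x' => e (t, x')) x :
      EuclideanSpace ℝ (Fin d) →L[ℝ] EuclideanSpace ℝ (Fin d))
      = fderiv ℝ (fun z => e (t, ψ.symm z)) (ψ x) := by
    intro t
    have h3 : MDifferentiableAt (𝓡 d) (𝓡 d) (fun x' => e (t, x')) x :=
      (ContMDiffAt.comp x (hes (t, x)) (hslice t x)).mdifferentiableAt (by simp)
    rw [h3.mfderiv]
    have hr : range (𝓡 d) = univ := by simp
    rw [hr, fderivWithin_univ]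
    rfl
  have h3 : (∫ t in (0 : ℝ)..1, fderiv ℝ (fun z => e (t, ψ.symm z)) (ψ x))
      = (φ 1).coframe l x - (φ 0).coframe l x := by
    ext1 v
    refine (ContinuousLinearMap.intervalIntegral_apply (h2.intervalIntegrable (μ := MeasureTheory.volume) 0 1) v).trans ?_
    refine intervalIntegral.integral_eq_sub_of_hasDerivAt (f := fun s => (φ s).coframe l x v)
      (fun t _ => ?_) ?_
    · rw [← hmf]; exact hder x v t
    · exact (h2.clm_apply continuous_const).intervalIntegrable _ _
  rw [h3] at h1
  refine ⟨?_, ?_⟩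
  · have h4 : ContinuousAt (fun z => ∫ t in (0 : ℝ)..1, e (t, ψ.symm z)) (ψ x) := h1.continuousAt
    have h5 := ContinuousAt.comp (f := ψ) h4 (continuousAt_extChartAt x)
    refine h5.congr ?_
    filter_upwards [extChartAt_source_mem_nhds (I := 𝓡 d) x] with y hy
    simp only [Function.comp_apply]
    rw [ψ.left_inv hy]
  · exact h1.hasFDerivWithinAt

/-- If `𝒮` has constant rank `d`, then gauge equivalent maximally extended solutions are
related by a diffeomorphism. -/
theorem exists_diffeomorph_of_gaugeEquivalent [T2Space S] (hL : L.IsAbelianBundle)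
    (hT : ∀ p : M, Module.finrank ℝ (T.toFun p).range = d) {φ₁ φ₂ : BundleField EM F E d S}
    (hs₁ : L.IsSolution φ₁) (hs₂ : L.IsSolution φ₂)
    (hn₁ : (T.metric φ₁).Nondegenerate) (hn₂ : (T.metric φ₂).Nondegenerate)
    (hm₁ : (T.metric φ₁).IsMaximallyExtended) (hm₂ : (T.metric φ₂).IsMaximallyExtended)
    (h : GaugeEquivalent L T φ₁ φ₂) :
    ∃ D : S ≃ₘ^∞⟮𝓡 d, 𝓡 d⟯ S, ∀ (x : S) (u v : TangentSpace (𝓡 d) x),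
      T.metric φ₁ x u v
        = T.metric φ₂ (D x) (mfderiv (𝓡 d) (𝓡 d) D x u) (mfderiv (𝓡 d) (𝓡 d) D x v) := by
  -- The factorization is chosen at each point separately; no smoothness in `p` is needed because
  -- base maps are locally constant.
  choose l B _ hBs hBn hlB using fun p => T.exists_factorization p (hT p)
  have hflat : ∀ φ : BundleField EM F E d S, L.IsSolution φ → (T.metric φ).Nondegenerate →
      IsFlatMetric (T.metric φ) (φ.coframe l) (fun x => B (φ.base x)) := by
    intro φ hs hn
    have heq : ∀ (x : S) (u v : TangentSpace (𝓡 d) x), T.metric φ x u v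
        = B (φ.base x) (φ.coframe l x u) (φ.coframe l x v) := fun x u v => hlB _ _ _
    refine ⟨hs.isClosedCoframe hL l fun x => ?_, fun x => hBs _, fun x => hBn _,
      (hs.isLocallyConstant_base hL).comp B, heq⟩
    refine (injective_iff_map_eq_zero (φ.coframe l x)).2 fun v hv => ?_
    refine hn x v fun u => ?_
    refine (heq x v u).trans ?_
    have h0 : φ.coframe l x v = 0 := hv
    have key : ∀ w : EuclideanSpace ℝ (Fin d), w = 0 → B (φ.base x) w (φ.coframe l x u) = 0 := by
      rintro w rfl; simp
    exact key _ h0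
  have hf₁ := hflat φ₁ hs₁ hn₁
  have hf₂ := hflat φ₂ hs₂ hn₂
  obtain ⟨hbase, lam, hlam⟩ := h.exists_primitive hL l
  obtain ⟨D, hDc, hD⟩ := exists_diffeomorph_of_exact hf₁.coframe hf₂.coframe (hf₁.complete hm₁)
    (hf₂.complete hm₂) hlam
  refine ⟨D, fun x u v => ?_⟩
  -- The form `B` depends on the base point, so it matters that `D` preserves connected components,
  -- on which the base point is constant.
  have hb : φ₁.base (D x) = φ₁.base x :=
    (hs₁.isLocallyConstant_base hL).apply_eq_of_isPreconnected isPreconnected_connectedComponent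
      (hDc x) mem_connectedComponent
  rw [hf₁.eq, hf₂.eq]
  erw [hD, hD]
  rw [hbase, hb]

/-- If `𝒮` has constant rank `d`, then there is a nondegenerate solution through each point. -/
theorem exists_solution_of_rank_eq (hL : L.IsAbelianBundle) (p : M)
    (hT : Module.finrank ℝ (T.toFun p).range = d) :
    ∃ φ : BundleField EM F E d (EuclideanSpace ℝ (Fin d)),
      L.IsSolution φ ∧ p ∈ range φ.base ∧ (T.metric φ).Nondegenerate := by
  obtain ⟨l, B, hl, hBs, hBn, hlB⟩ := T.exists_factorization p hT
  obtain ⟨s, hs⟩ := LinearMap.exists_rightInverse_of_surjective l (LinearMap.range_eq_top.2 hl)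
  have hls : ∀ v, l (s v) = v := fun v => DFunLike.congr_fun hs v
  -- For a section `s` of `l` the constant one-form `s` induces the constant metric `B` on `ℝ^d`.
  refine ⟨exactField p s id contDiff_id, exactField_isSolution hL p s id contDiff_id,
    ⟨0, rfl⟩, fun x v hv => hBn v fun w => ?_⟩
  have hid : ∀ v : EuclideanSpace ℝ (Fin d), fderiv ℝ id x v = v := fun v => by
    rw [fderiv_id]; rfl
  have key : ∀ v : EuclideanSpace ℝ (Fin d),
      T.toFun p (s (fderiv ℝ id x v)) (s (fderiv ℝ id x w)) = B v w := fun v => by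
    rw [hid, hid, hlB, hls, hls]
  exact (key v).symm.trans (hv w)

end Algebroid

/-! ### Orthogonal vectors with prescribed squares. -/

section BilinearForms

variable {V : Type*} [AddCommGroup V] [Module ℝ V] [FiniteDimensional ℝ V]

/-- A symmetric bilinear form of rank at least `m` admits `m` orthogonal vectors of square
`±1`. -/
theorem exists_orthogonal_vectors (B : V →ₗ[ℝ] V →ₗ[ℝ] ℝ) (hB : ∀ u v, B u v = B v u) {m : ℕ}
    (hm : m ≤ Module.finrank ℝ (LinearMap.range B)) :
    ∃ (f : Fin m → V) (ε : Fin m → ℝ), (∀ i, ε i = 1 ∨ ε i = -1) ∧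
      ∀ i j, B (f i) (f j) = if i = j then ε i else 0 := by
  obtain ⟨v, hv⟩ := LinearMap.BilinForm.exists_orthogonal_basis (B := B) ⟨hB⟩
  set N := {i // B (v i) (v i) ≠ 0} with hN
  have hcard : m ≤ Fintype.card N := by
    -- In an orthogonal basis, a basis vector of square zero lies in the kernel; the functionals `B
    -- (v i)` of the others span the range, so there are at least `m` of them.
    have hle : LinearMap.range B ≤ Submodule.span ℝ (range fun i : N => B (v i)) := by
      rw [← Submodule.map_top, ← v.span_eq, Submodule.map_span, Submodule.span_le]
      rintro _ ⟨_, ⟨i, rfl⟩, rfl⟩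
      by_cases hi : B (v i) (v i) = 0
      · have h0 : B (v i) = 0 := by
          refine v.ext fun j => ?_
          rcases eq_or_ne i j with rfl | hij
          · exact hi
          · exact hv hij
        rw [h0]; exact Submodule.zero_mem _
      · exact Submodule.subset_span ⟨⟨i, hi⟩, rfl⟩
    exact hm.trans ((Submodule.finrank_mono hle).trans (finrank_range_le_card _))
  obtain ⟨e⟩ : Nonempty (Fin m ↪ N) := Function.Embedding.nonempty_of_card_le (by simpa using hcard)
  set q : N → ℝ := fun i => B (v i) (v i) with hq
  have hq0 : ∀ i, q i ≠ 0 := fun i => i.2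
  have hsq : ∀ i, Real.sqrt |q i| * Real.sqrt |q i| = |q i| := fun i =>
    Real.mul_self_sqrt (abs_nonneg _)
  refine ⟨fun i => (Real.sqrt |q (e i)|)⁻¹ • v (e i), fun i => q (e i) / |q (e i)|, fun i => ?_,
    fun i j => ?_⟩
  · rcases lt_or_gt_of_ne (hq0 (e i)) with h | h
    · right; change q (e i) / |q (e i)| = -1; rw [abs_of_neg h, div_neg, div_self h.ne]
    · left; change q (e i) / |q (e i)| = 1; rw [abs_of_pos h, div_self h.ne']
  · split_ifs with hij
    · subst hij
      simp only [map_smul, LinearMap.smul_apply, smul_eq_mul]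
      rw [← mul_assoc, ← mul_inv, hsq, mul_comm, div_eq_mul_inv]
    · have h0 : B (v (e i)) (v (e j)) = 0 := hv fun h => hij (e.injective (Subtype.ext h))
      simp [h0]

/-- A symmetric bilinear form of rank at least `n + 3` admits `n + 3` orthogonal vectors of
square `±1`, where the first two have the same square. -/
theorem exists_orthogonal_vectors_eq (B : V →ₗ[ℝ] V →ₗ[ℝ] ℝ) (hB : ∀ u v, B u v = B v u) {n : ℕ}
    (hm : n + 3 ≤ Module.finrank ℝ (LinearMap.range B)) :
    ∃ (f : Fin (n + 3) → V) (ε : Fin (n + 3) → ℝ), (∀ i, ε i = 1 ∨ ε i = -1) ∧ ε 0 = ε 1 ∧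
      ∀ i j, B (f i) (f j) = if i = j then ε i else 0 := by
  obtain ⟨f, ε, hε, hf⟩ := exists_orthogonal_vectors B hB hm
  -- Among three signs two agree; a transposition moves such a pair to the first two places.
  have key : ∃ w : Equiv.Perm (Fin (n + 3)), ε (w 0) = ε (w 1) := by
    by_cases h01 : ε 0 = ε 1
    · exact ⟨1, h01⟩
    have h10 : (1 : Fin (n + 3)) ≠ 0 := by simp
    have h20 : (2 : Fin (n + 3)) ≠ 0 := by simp [Fin.ext_iff, Nat.mod_eq_of_lt (show 2 < n + 3 by omega)]
    have h21 : (2 : Fin (n + 3)) ≠ 1 := by simp [Fin.ext_iff, Nat.mod_eq_of_lt (show 2 < n + 3 by omega)]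
    by_cases h02 : ε 0 = ε 2
    · refine ⟨Equiv.swap 1 2, ?_⟩
      rw [Equiv.swap_apply_of_ne_of_ne h10.symm h20.symm, Equiv.swap_apply_left, h02]
    · refine ⟨Equiv.swap 0 2, ?_⟩
      rw [Equiv.swap_apply_left, Equiv.swap_apply_of_ne_of_ne h10 h21.symm]
      rcases hε 0 with h | h <;> rcases hε 1 with h' | h' <;> rcases hε 2 with h'' | h'' <;>
        simp_all
  obtain ⟨w, hw⟩ := key
  refine ⟨f ∘ w, ε ∘ w, fun i => hε _, hw, fun i j => ?_⟩
  simp [hf]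

end BilinearForms

/-! ### Lower bound for the rank, and gauge equivalence of exact fields. -/

section Algebroid

variable {EM : Type*} [NormedAddCommGroup EM] [NormedSpace ℝ EM]
  {M : Type*} [TopologicalSpace M] [ChartedSpace EM M]
  {F : Type*} [NormedAddCommGroup F] [NormedSpace ℝ F] [FiniteDimensional ℝ F]
  {E : M → Type*} [TopologicalSpace (TotalSpace F E)] [∀ p, TopologicalSpace (E p)]
  [∀ p, AddCommGroup (E p)] [∀ p, Module ℝ (E p)]
  [∀ p, IsTopologicalAddGroup (E p)] [∀ p, ContinuousSMul ℝ (E p)]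
  [FiberBundle F E] [VectorBundle ℝ F E] [IsManifold 𝓘(ℝ, EM) ∞ M]
  {L : LieAlgebroid EM F E} {T : SymTensor EM F E} {d : ℕ}

/-- The symmetric tensor at `p` as an algebraic bilinear form. -/
def SymTensor.bilin (T : SymTensor EM F E) (p : M) : E p →ₗ[ℝ] E p →ₗ[ℝ] ℝ :=
  LinearMap.mk₂ ℝ (fun u v => T.toFun p u v) (by simp) (by simp) (by simp) (by simp)

/-- One map takes values in the algebraic dual and the other in the continuous dual, so the ranks
are compared through the common kernel. -/
theorem SymTensor.finrank_range_bilin (T : SymTensor EM F E) (p : M) :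
    Module.finrank ℝ (LinearMap.range (T.bilin p)) = Module.finrank ℝ (T.toFun p).range := by
  have hk : LinearMap.ker (T.bilin p) = LinearMap.ker (T.toFun p).toLinearMap := by
    ext u
    rw [LinearMap.mem_ker, LinearMap.mem_ker, DFunLike.ext_iff]
    exact (DFunLike.ext_iff (f := T.toFun p u) (g := 0)).symm
  have h1 := (T.bilin p).quotKerEquivRange.finrank_eq
  rw [hk] at h1
  exact h1.symm.trans (T.toFun p).toLinearMap.quotKerEquivRange.finrank_eq

/-- A nondegenerate metric at one point bounds the rank of `𝒮` from below. -/
theorem le_finrank_of_nondegenerate {S : Type} [TopologicalSpace S]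
    [ChartedSpace (EuclideanSpace ℝ (Fin d)) S] [IsManifold (𝓡 d) ∞ S]
    {φ : BundleField EM F E d S} (h : (T.metric φ).Nondegenerate) (x : S) :
    d ≤ Module.finrank ℝ (T.toFun (φ.base x)).range := by
  have := finiteDimensional_fiber F (E := E) (φ.base x)
  rw [← T.finrank_range_bilin]
  set A : EuclideanSpace ℝ (Fin d) →ₗ[ℝ] E (φ.base x) := (φ.form x).toLinearMap
  set R : EuclideanSpace ℝ (Fin d) →ₗ[ℝ] LinearMap.range (T.bilin (φ.base x)) :=
    (T.bilin (φ.base x)).rangeRestrict.comp A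
  have hR : Function.Injective R := by
    refine (injective_iff_map_eq_zero R).2 fun v hv => h x v fun u => ?_
    have h1 : T.bilin (φ.base x) (A v) = 0 := congrArg Subtype.val hv
    exact DFunLike.congr_fun h1 (A u)
  simpa using LinearMap.finrank_le_finrank_of_injective hR

section Exact

variable {G : Type*} [NormedAddCommGroup G] [NormedSpace ℝ G] [FiniteDimensional ℝ G]

theorem exactField_congr (p : M) (s : G →ₗ[ℝ] E p) {Y Y' : EuclideanSpace ℝ (Fin d) → G}
    (h : Y = Y') (hY : ContDiff ℝ ∞ Y) (hY' : ContDiff ℝ ∞ Y') :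
    exactField (EM := EM) (F := F) p s Y hY = exactField p s Y' hY' := by
  subst h; rfl

/-- Exact fields with the same constant base map are gauge equivalent if the segment between
them consists of nondegenerate fields. -/
theorem gaugeEquivalent_exactField (hL : L.IsAbelianBundle) (p : M) (s : G →ₗ[ℝ] E p)
    {Y₀ Y₁ : EuclideanSpace ℝ (Fin d) → G} (h₀ : ContDiff ℝ ∞ Y₀) (h₁ : ContDiff ℝ ∞ Y₁)
    (hY : ∀ τ : ℝ, ContDiff ℝ ∞ fun x => Y₀ x + τ • (Y₁ x - Y₀ x))
    (hn : ∀ τ ∈ Icc (0 : ℝ) 1,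
      (T.metric (exactField p s (fun x => Y₀ x + τ • (Y₁ x - Y₀ x)) (hY τ))).Nondegenerate) :
    GaugeEquivalent L T (exactField p s Y₀ h₀) (exactField p s Y₁ h₁) := by
  set Y : ℝ → EuclideanSpace ℝ (Fin d) → G := fun τ x => Y₀ x + τ • (Y₁ x - Y₀ x) with hYdef
  -- A gauge path must consist of non-degenerate solutions for every real time. The smooth
  -- transition keeps the path parameter in `[0, 1]`, where non-degeneracy is known.
  set σ : ℝ → ℝ := Real.smoothTransition with hσ
  have hσs : ContDiff ℝ ∞ σ := Real.smoothTransition.contDiff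
  have hfd : ∀ τ x v, fderiv ℝ (Y τ) x v
      = fderiv ℝ Y₀ x v + τ • (fderiv ℝ Y₁ x v - fderiv ℝ Y₀ x v) := by
    intro τ x v
    have e0 := (h₀.differentiable (by simp) x).hasFDerivAt
    have e1 := (h₁.differentiable (by simp) x).hasFDerivAt
    have h3 : fderiv ℝ (Y τ) x = _ := (e0.add ((e1.sub e0).const_smul τ)).fderiv
    rw [h3]; rfl
  have hD : ∀ {Z : EuclideanSpace ℝ (Fin d) → G}, ContDiff ℝ ∞ Z →
      ContMDiff (𝓘(ℝ, ℝ).prod (𝓡 d).tangent) 𝓘(ℝ, G) ∞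
        (fun q : ℝ × TangentBundle (𝓡 d) (EuclideanSpace ℝ (Fin d)) =>
          fderiv ℝ Z q.2.1 (q.2.2 : EuclideanSpace ℝ (Fin d))) := by
    intro Z hZ
    have h2 : ContMDiff (𝓡 d) 𝓘(ℝ, EuclideanSpace ℝ (Fin d) →L[ℝ] G) ∞ (fderiv ℝ Z) :=
      (hZ.fderiv_right (m := ∞) le_rfl).contMDiff
    exact ((h2.comp (contMDiff_proj (TangentSpace (𝓡 d)))).comp contMDiff_snd).clm_apply
      (contMDiff_tangentBundle_euclidean_snd.comp contMDiff_snd)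
  -- The gauge parameter is the velocity `σ' • (Y₁ - Y₀)` of the map `Y`; its differential is the
  -- velocity of the one-form.
  refine ⟨fun t => exactField p s (Y (σ t)) (hY _),
    fun t x => s (deriv σ t • (Y₁ x - Y₀ x)), ?_, ?_, ?_, ?_, ?_, ?_, ?_⟩
  · exact exactField_congr p s (by funext x; simp [hYdef, hσ]) _ _
  · exact exactField_congr p s (by funext x; simp [hYdef, hσ]) _ _
  · refine contMDiff_const_fiber p s (f := fun q : ℝ × TangentBundle (𝓡 d) _ =>
      fderiv ℝ (Y (σ q.1)) q.2.1 (q.2.2 : EuclideanSpace ℝ (Fin d))) ?_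
    exact ((hD h₀).add ((hσs.contMDiff.comp contMDiff_fst).smul ((hD h₁).sub (hD h₀)))).congr
      fun q => hfd _ _ _
  · refine contMDiff_const_fiber p s
      (f := fun q : ℝ × EuclideanSpace ℝ (Fin d) => deriv σ q.1 • (Y₁ q.2 - Y₀ q.2)) ?_
    have hσ' : ContDiff ℝ ∞ (deriv σ) := hσs.deriv'
    exact (hσ'.contMDiff.comp contMDiff_fst).smul
      ((h₁.contMDiff.comp contMDiff_snd).sub (h₀.contMDiff.comp contMDiff_snd))
  · exact fun t => ⟨exactField_isSolution hL p s _ _,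
      hn _ ⟨Real.smoothTransition.nonneg t, Real.smoothTransition.le_one t⟩⟩
  · intro t x
    rw [hL.1]
    exact DFunLike.congr_fun
      (mfderiv_const : mfderiv 𝓘(ℝ, ℝ) 𝓘(ℝ, EM) (fun _ : ℝ => p) t = 0) 1
  · intro b t x hx I v
    simp only [hL.structureFun_eq_zero, zero_mul, Finset.sum_const_zero, add_zero]
    set m : G →L[ℝ] ℝ := LinearMap.toContinuousLinearMap ((b.comp I p).comp s) with hm
    have e0 := (h₀.differentiable (by simp) x).hasFDerivAt
    have e1 := (h₁.differentiable (by simp) x).hasFDerivAt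
    have key : ∀ v : EuclideanSpace ℝ (Fin d),
        HasDerivAt (fun t' => m (fderiv ℝ (Y (σ t')) x v))
          (fderiv ℝ (fun x' => m (deriv σ t • (Y₁ x' - Y₀ x'))) x v) t := by
      intro v
      have h2 : fderiv ℝ (fun x' => m (deriv σ t • (Y₁ x' - Y₀ x'))) x = _ :=
        (m.hasFDerivAt.comp x ((e1.sub e0).const_smul (deriv σ t))).fderiv
      rw [h2]
      simp only [hfd]
      have h4 := (((hσs.differentiable (by simp) t).hasDerivAt.smul_const
        (fderiv ℝ Y₁ x v - fderiv ℝ Y₀ x v)).const_add (fderiv ℝ Y₀ x v))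
      exact m.hasFDerivAt.comp_hasDerivAt t h4
    have h5 := key v
    rw [← mfderiv_eq_fderiv] at h5
    exact h5

end Exact

end Algebroid

/-! ### Geodesics of diagonal metrics that depend on one coordinate. -/

section DiagonalMetric

variable {m : ℕ}

theorem hasDerivAt_toLp {a : Fin m → ℝ → ℝ} {a' : Fin m → ℝ} {t : ℝ}
    (h : ∀ i, HasDerivAt (a i) (a' i) t) :
    HasDerivAt (fun t => (WithLp.toLp 2 fun i => a i t : EuclideanSpace ℝ (Fin m)))
      (WithLp.toLp 2 a') t :=
  (PiLp.continuousLinearEquiv 2 ℝ fun _ : Fin m => ℝ).symm.toContinuousLinearMap.hasFDerivAt.comp_hasDerivAt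
    t (hasDerivAt_pi.2 h)

/-- The metric `∑ D_i (x⁰) (dx^i)²` on Euclidean space. -/
def diagMetric (D : ℝ → Fin (m + 1) → ℝ) : MetricField (m + 1) (EuclideanSpace ℝ (Fin (m + 1))) :=
  fun (x u v : EuclideanSpace ℝ (Fin (m + 1))) => ∑ i, D (x 0) i * u i * v i

variable {D : ℝ → Fin (m + 1) → ℝ}

theorem diagMetric_apply (x u v : EuclideanSpace ℝ (Fin (m + 1))) :
    diagMetric D x u v = ∑ i, D (x 0) i * u i * v i := rfl

theorem diagMetric_single (x v : EuclideanSpace ℝ (Fin (m + 1))) (i : Fin (m + 1)) :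
    diagMetric D x v (EuclideanSpace.single i (1 : ℝ) : EuclideanSpace ℝ (Fin (m + 1)))
      = D (x 0) i * v i := by
  rw [diagMetric_apply, Finset.sum_eq_single i]
  · simp
  · intro j _ hj; simp [hj]
  · simp

theorem diagMetric_nondegenerate (hD : ∀ s i, D s i ≠ 0) : (diagMetric D).Nondegenerate := by
  have key : ∀ x v : EuclideanSpace ℝ (Fin (m + 1)),
      (∀ u : EuclideanSpace ℝ (Fin (m + 1)), diagMetric D x v u = 0) → v = 0 := by
    intro x v h
    ext i
    have h1 := h (EuclideanSpace.single i (1 : ℝ))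
    rw [diagMetric_single] at h1
    simpa [hD] using h1
  exact key

theorem diagMetric_coord (x₀ y : EuclideanSpace ℝ (Fin (m + 1))) :
    (diagMetric D).coord x₀ y = Matrix.diagonal (D (y 0)) := by
  ext i j
  rw [MetricField.coord, Matrix.of_apply, chartVec_euclidean, chartVec_euclidean]
  refine (diagMetric_single y (EuclideanSpace.single i 1) j).trans ?_
  rcases eq_or_ne i j with rfl | hij
  · simp
  · rw [Matrix.diagonal_apply_ne _ hij]; simp [hij.symm]

theorem partialD_diagMetric_coord {D' : ℝ → Fin (m + 1) → ℝ}
    (hD : ∀ s i, HasDerivAt (fun s => D s i) (D' s i) s)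
    (x₀ y : EuclideanSpace ℝ (Fin (m + 1))) (l i j : Fin (m + 1)) :
    partialD l (fun z => (diagMetric D).coord x₀ z i j) y
      = if l = 0 then (if i = j then D' (y 0) i else 0) else 0 := by
  simp only [diagMetric_coord, partialD]
  rcases eq_or_ne i j with rfl | hij
  · simp only [Matrix.diagonal_apply_eq, if_true]
    have h1 : HasFDerivAt (fun z : EuclideanSpace ℝ (Fin (m + 1)) => D (z 0) i)
        (D' (y 0) i • (EuclideanSpace.proj 0 : EuclideanSpace ℝ (Fin (m + 1)) →L[ℝ] ℝ)) y :=
      HasDerivAt.comp_hasFDerivAt (f := fun z : EuclideanSpace ℝ (Fin (m + 1)) => z 0) y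
        (hD (y 0) i) (EuclideanSpace.proj 0 : EuclideanSpace ℝ (Fin (m + 1)) →L[ℝ] ℝ).hasFDerivAt
    rw [h1.fderiv]
    simp [eq_comm]
  · simp [Matrix.diagonal_apply_ne _ hij, hij]

theorem diagMetric_christoffel {D' : ℝ → Fin (m + 1) → ℝ} (hD0 : ∀ s i, D s i ≠ 0)
    (hD : ∀ s i, HasDerivAt (fun s => D s i) (D' s i) s)
    (x₀ y : EuclideanSpace ℝ (Fin (m + 1))) (k i j : Fin (m + 1)) :
    (diagMetric D).christoffel x₀ k i j y
      = (D (y 0) k)⁻¹ / 2 * ((if i = 0 then (if j = k then D' (y 0) k else 0) else 0)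
        + (if j = 0 then (if i = k then D' (y 0) k else 0) else 0)
        - (if k = 0 then (if i = j then D' (y 0) i else 0) else 0)) := by
  have hinv : (Matrix.diagonal (D (y 0)))⁻¹ = Matrix.diagonal fun i => (D (y 0) i)⁻¹ := by
    refine Matrix.inv_eq_right_inv ?_
    rw [Matrix.diagonal_mul_diagonal, ← Matrix.diagonal_one]
    congr 1; funext i; exact mul_inv_cancel₀ (hD0 _ _)
  rw [MetricField.christoffel, diagMetric_coord, hinv, Finset.sum_eq_single k]
  · simp only [partialD_diagMetric_coord hD, Matrix.diagonal_apply_eq]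
    have e : ∀ a : Fin (m + 1), (if a = k then D' (y 0) a else 0) = if a = k then D' (y 0) k else 0 := by
      intro a; split_ifs with h
      · rw [h]
      · rfl
    rw [e, e]; ring
  · intro l _ hl
    rw [Matrix.diagonal_apply_ne _ hl.symm, zero_mul]
  · simp

/-- The geodesic equation of a diagonal metric that only depends on `x⁰`. -/
theorem diagMetric_isGeodesicOn {D' : ℝ → Fin (m + 1) → ℝ} (hD0 : ∀ s i, D s i ≠ 0)
    (hD : ∀ s i, HasDerivAt (fun s => D s i) (D' s i) s) {c c' c'' : Fin (m + 1) → ℝ → ℝ}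
    (hs : ∀ i, ContDiff ℝ ∞ (c i)) (hc : ∀ i t, HasDerivAt (c i) (c' i t) t)
    (hc' : ∀ i t, HasDerivAt (c' i) (c'' i t) t)
    (h : ∀ k t, D (c 0 t) k * c'' k t + D' (c 0 t) k * c' 0 t * c' k t
      = if k = 0 then (∑ i, D' (c 0 t) i * c' i t ^ 2) / 2 else 0) (J : Set ℝ) :
    (diagMetric D).IsGeodesicOn
      (fun t => (WithLp.toLp 2 fun i => c i t : EuclideanSpace ℝ (Fin (m + 1)))) J := by
  set γ : ℝ → EuclideanSpace ℝ (Fin (m + 1)) := fun t => WithLp.toLp 2 fun i => c i t with hγ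
  have hvec : ∀ {a a' : Fin (m + 1) → ℝ → ℝ}, (∀ i t, HasDerivAt (a i) (a' i t) t) → ∀ t,
      HasDerivAt (fun t => (WithLp.toLp 2 fun i => a i t : EuclideanSpace ℝ (Fin (m + 1))))
        (WithLp.toLp 2 fun i => a' i t) t := by
    intro a a' ha t
    exact hasDerivAt_toLp fun i => ha i t
  have hd1 : deriv γ = fun t => WithLp.toLp 2 fun i => c' i t := by
    funext t; exact (hvec hc t).deriv
  have hd2 : ∀ t, deriv (deriv γ) t = WithLp.toLp 2 fun i => c'' i t := by
    intro t; rw [hd1]; exact (hvec hc' t).deriv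
  constructor
  · have : ContDiff ℝ ∞ γ := contDiff_euclidean.2 hs
    exact this.contMDiff.contMDiffOn
  · intro t _ k
    have hext : ∀ x z : EuclideanSpace ℝ (Fin (m + 1)), extChartAt (𝓡 (m + 1)) x z = z := by
      intro x z; rfl
    simp only [hext]
    change (deriv (deriv γ) t) k + ∑ i, ∑ j, (diagMetric D).christoffel (γ t) k i j (γ t)
      * (deriv γ t) i * (deriv γ t) j = 0
    rw [hd2, hd1]
    simp only [diagMetric_christoffel hD0 hD]
    have e0 : γ t 0 = c 0 t := rfl
    rw [e0]
    have hk := h k t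
    set r := (D (c 0 t) k)⁻¹ / 2 with hr
    have hr2 : D (c 0 t) k * r = 1 / 2 := by
      rw [hr, mul_div_assoc', mul_inv_cancel₀ (hD0 _ _)]
    -- The first two delta terms contribute equally, whence the factor `2`; the third survives only
    -- in the equation for `x⁰`.
    have hsum : ∑ i, ∑ j, r * ((if i = 0 then (if j = k then D' (c 0 t) k else 0) else 0)
        + (if j = 0 then (if i = k then D' (c 0 t) k else 0) else 0)
        - (if k = 0 then (if i = j then D' (c 0 t) i else 0) else 0)) * c' i t * c' j t
        = r * (2 * (D' (c 0 t) k * c' 0 t * c' k t)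
          - if k = 0 then ∑ i, D' (c 0 t) i * c' i t ^ 2 else 0) := by
      simp only [mul_sub, mul_add, sub_mul, add_mul, Finset.sum_add_distrib,
        Finset.sum_sub_distrib]
      simp only [mul_ite, ite_mul, mul_zero, zero_mul, Finset.sum_ite_eq, Finset.sum_ite_eq',
        Finset.mem_univ, if_true, Finset.sum_ite_irrel, Finset.sum_const_zero]
      split_ifs
      · rw [Finset.mul_sum]
        congr 1
        · ring
        · exact Finset.sum_congr rfl fun i _ => by ring
      · ring
    refine (congrArg (c'' k t + ·) hsum).trans ?_
    refine mul_left_cancel₀ (hD0 (c 0 t) k) ?_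
    split_ifs at hk ⊢ with h0
    · linear_combination hk + (2 * (D' (c 0 t) k * c' 0 t * c' k t)
        - ∑ i, D' (c 0 t) i * c' i t ^ 2) * hr2
    · linear_combination hk + (2 * (D' (c 0 t) k * c' 0 t * c' k t)) * hr2

/-- If there are solutions of the geodesic equation for all initial values, then the metric is
maximally extended. -/
theorem diagMetric_isMaximallyExtended {D' : ℝ → Fin (m + 1) → ℝ} (hD0 : ∀ s i, D s i ≠ 0)
    (hD : ∀ s i, HasDerivAt (fun s => D s i) (D' s i) s)
    (h : ∀ x v : Fin (m + 1) → ℝ, ∃ c c' c'' : Fin (m + 1) → ℝ → ℝ,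
      (∀ i, ContDiff ℝ ∞ (c i)) ∧ (∀ i t, HasDerivAt (c i) (c' i t) t) ∧
      (∀ i t, HasDerivAt (c' i) (c'' i t) t) ∧ (∀ i, c i 0 = x i) ∧ (∀ i, c' i 0 = v i) ∧
      ∀ k t, D (c 0 t) k * c'' k t + D' (c 0 t) k * c' 0 t * c' k t
        = if k = 0 then (∑ i, D' (c 0 t) i * c' i t ^ 2) / 2 else 0) :
    (diagMetric D).IsMaximallyExtended := by
  rintro ⟨x, v⟩
  change EuclideanSpace ℝ (Fin (m + 1)) at x
  obtain ⟨c, c', c'', hs, hc, hc', hx, hv, hg⟩ := h x (show EuclideanSpace ℝ (Fin (m + 1)) from v)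
  refine ⟨fun t => (WithLp.toLp 2 fun i => c i t : EuclideanSpace ℝ (Fin (m + 1))), ?_, 1,
    one_pos, Or.inl (diagMetric_isGeodesicOn hD0 hD hs hc hc' hg _)⟩
  have h0 : (WithLp.toLp 2 fun i => c i 0 : EuclideanSpace ℝ (Fin (m + 1))) = x := by
    ext i; exact hx i
  have h1 : HasDerivAt (fun t => (WithLp.toLp 2 fun i => c i t : EuclideanSpace ℝ (Fin (m + 1))))
      (show EuclideanSpace ℝ (Fin (m + 1)) from v) 0 := by
    refine hasDerivAt_toLp fun i => ?_
    rw [← hv i]; exact hc i 0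
  have h2 : mfderiv 𝓘(ℝ, ℝ) (𝓡 (m + 1))
      (fun t => (WithLp.toLp 2 fun i => c i t : EuclideanSpace ℝ (Fin (m + 1)))) 0 (1 : ℝ)
      = (show EuclideanSpace ℝ (Fin (m + 1)) from v) := by
    rw [mfderiv_eq_fderiv]
    exact h1.deriv
  refine Bundle.TotalSpace.ext h0 (heq_of_eq ?_)
  exact h2

/-- Constant diagonal metrics are maximally extended. -/
theorem diagMetric_const_isMaximallyExtended {a : Fin (m + 1) → ℝ} (ha : ∀ i, a i ≠ 0) :
    (diagMetric fun _ => a).IsMaximallyExtended := by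
  refine diagMetric_isMaximallyExtended (D' := fun _ _ => 0) (fun _ => ha)
    (fun s i => hasDerivAt_const s _) fun x v =>
    ⟨fun i t => x i + t * v i, fun i _ => v i, fun _ _ => 0, fun i => by fun_prop,
      fun i t => ?_, fun i t => hasDerivAt_const _ _, fun i => by simp, fun i => rfl, fun k t => by simp⟩
  simpa using ((hasDerivAt_id t).mul_const (v i)).const_add (x i)

end DiagonalMetric

/-! ### A complete curved surface with explicit geodesics. -/

section Profile

theorem exists_primitive {f : ℝ → ℝ} (hf : ContDiff ℝ ∞ f) (a : ℝ) :
    ∃ g : ℝ → ℝ, ContDiff ℝ ∞ g ∧ (∀ t, HasDerivAt g (f t) t) ∧ g 0 = a := by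
  have h1 : ∀ t, HasDerivAt (fun t => a + ∫ s in (0 : ℝ)..t, f s) (f t) t := fun t =>
    (intervalIntegral.integral_hasDerivAt_right (hf.continuous.intervalIntegrable _ _)
      hf.continuous.aestronglyMeasurable.stronglyMeasurableAtFilter
      hf.continuous.continuousAt).const_add a
  refine ⟨_, ?_, h1, by simp⟩
  rw [contDiff_infty_iff_deriv]
  refine ⟨fun t => (h1 t).differentiableAt, ?_⟩
  rwa [funext fun t => (h1 t).deriv]

/-- The solutions of `S'' = L² sinh S / cosh³ S`. -/
theorem exists_radial_motion (s₀ v₀ L : ℝ) :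
    ∃ S S' S'' : ℝ → ℝ, ContDiff ℝ ∞ S ∧ (∀ t, HasDerivAt S (S' t) t) ∧
      (∀ t, HasDerivAt S' (S'' t) t) ∧ S 0 = s₀ ∧ S' 0 = v₀ ∧
      ∀ t, S'' t = L ^ 2 * Real.sinh (S t) / Real.cosh (S t) ^ 3 := by
  set C := Real.cosh s₀ with hC
  set A := Real.sinh s₀ with hA
  have hCpos : 0 < C := Real.cosh_pos _
  have hCA : C ^ 2 = A ^ 2 + 1 := Real.cosh_sq _
  -- The quantity `k²` is the conserved energy `S'² + L² / cosh² S`. The substitution `w = sinh S`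
  -- makes the equation linear, `w'' = k² w`, so solutions exist for all time.
  set k := Real.sqrt (v₀ ^ 2 + L ^ 2 / C ^ 2) with hk
  have hk2 : k ^ 2 = v₀ ^ 2 + L ^ 2 / C ^ 2 := Real.sq_sqrt (by positivity)
  -- This gives `w'(0) = cosh(s₀) v₀`. If `k = 0`, then `v₀ = 0` and any `B` will do.
  obtain ⟨B, hB⟩ : ∃ B, B * k = C * v₀ := by
    by_cases h0 : k = 0
    · refine ⟨0, ?_⟩
      have h1 : v₀ ^ 2 = 0 := by
        have : 0 ≤ L ^ 2 / C ^ 2 := by positivity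
        rw [h0] at hk2
        nlinarith [sq_nonneg v₀]
      rw [pow_eq_zero_iff (two_ne_zero)] at h1
      rw [h1]; ring
    · exact ⟨C * v₀ / k, div_mul_cancel₀ _ h0⟩
  have hkC : k ^ 2 * C ^ 2 = v₀ ^ 2 * C ^ 2 + L ^ 2 := by
    rw [hk2]; field_simp
  set w : ℝ → ℝ := fun t => A * Real.cosh (k * t) + B * Real.sinh (k * t) with hw
  set w' : ℝ → ℝ := fun t => k * (A * Real.sinh (k * t) + B * Real.cosh (k * t)) with hw'
  have hlin : ∀ t, HasDerivAt (fun t => k * t) k t := fun t => by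
    simpa using (hasDerivAt_id t).const_mul k
  have d1 : ∀ t, HasDerivAt w (w' t) t := fun t => by
    refine (((hlin t).cosh.const_mul A).add ((hlin t).sinh.const_mul B)).congr_deriv ?_
    simp only [hw']; ring
  have d2 : ∀ t, HasDerivAt w' (k ^ 2 * w t) t := fun t => by
    refine ((((hlin t).sinh.const_mul A).add ((hlin t).cosh.const_mul B)).const_mul k).congr_deriv ?_
    simp only [hw]; ring
  have hw2 : ∀ t, w' t ^ 2 = k ^ 2 * (1 + w t ^ 2) - L ^ 2 := by
    intro t
    simp only [hw, hw']
    have e1 := Real.cosh_sq (k * t)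
    have e2 : B ^ 2 * k ^ 2 = C ^ 2 * v₀ ^ 2 := by rw [← mul_pow, hB, mul_pow]
    linear_combination (k ^ 2 * B ^ 2 - k ^ 2 * A ^ 2) * e1 + e2 - hkC + k ^ 2 * hCA
  set q : ℝ → ℝ := fun t => Real.sqrt (1 + w t ^ 2) with hq
  have hqpos : ∀ t, 0 < q t := fun t => Real.sqrt_pos.2 (by positivity)
  have hq2 : ∀ t, q t ^ 2 = 1 + w t ^ 2 := fun t => Real.sq_sqrt (by positivity)
  have dq : ∀ t, HasDerivAt q (w t * w' t / q t) t := fun t => by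
    refine ((((d1 t).fun_pow 2).const_add 1).sqrt (by positivity)).congr_deriv ?_
    have := (hqpos t).ne'
    simp only [hq] at this ⊢
    field_simp
    push_cast
    ring
  refine ⟨fun t => Real.arsinh (w t), fun t => w' t / q t, _, ?_, fun t => ?_,
    fun t => ((d2 t).div (dq t) (hqpos t).ne'), ?_, ?_, fun t => ?_⟩
  · exact Real.contDiff_arsinh.comp (by simp only [hw]; fun_prop)
  · refine (d1 t).arsinh.congr_deriv ?_
    exact (div_eq_inv_mul _ _).symm
  · simp [hw, hA]
  · have hwz : w 0 = A := by simp [hw]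
    have hw'z : w' 0 = C * v₀ := by simp [hw', ← hB, mul_comm]
    have hqz : q 0 = C := by
      simp only [hq, hwz]
      rw [add_comm, ← hCA, Real.sqrt_sq hCpos.le]
    change w' 0 / q 0 = v₀
    rw [hw'z, hqz, mul_div_cancel_left₀ _ hCpos.ne']
  · rw [Real.sinh_arsinh, Real.cosh_arsinh]
    change _ = L ^ 2 * w t / q t ^ 3
    have := (hqpos t).ne'
    field_simp
    linear_combination (w t * k ^ 2) * hq2 t - w t * hw2 t

/-- The inverse square of the radius of the curved surface. -/
def profile (σ s : ℝ) : ℝ := 2 + σ / Real.cosh s ^ 2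

variable {σ : ℝ}

theorem one_le_profile (hσ : σ = 1 ∨ σ = -1) (s : ℝ) : 1 ≤ profile σ s := by
  have h1 : 1 ≤ Real.cosh s ^ 2 := one_le_pow₀ (Real.one_le_cosh s)
  have h2 : 1 / Real.cosh s ^ 2 ≤ 1 := (div_le_one (by positivity)).2 h1
  have h3 : 0 ≤ 1 / Real.cosh s ^ 2 := by positivity
  rw [profile]
  rcases hσ with rfl | rfl
  · linarith
  · rw [neg_div]; linarith

theorem hasDerivAt_profile (s : ℝ) :
    HasDerivAt (profile σ) (-(2 * σ * Real.sinh s / Real.cosh s ^ 3)) s := by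
  have hc := (Real.cosh_pos s).ne'
  refine (((hasDerivAt_const s σ).div ((Real.hasDerivAt_cosh s).fun_pow 2)
    (by positivity)).const_add 2).congr_deriv ?_
  field_simp
  ring

theorem contDiff_profile : ContDiff ℝ ∞ (profile σ) := by
  unfold profile
  exact contDiff_const.add (contDiff_const.div (Real.contDiff_cosh.pow 2)
    fun s => by have := Real.cosh_pos s; positivity)

/-- The diagonal components of the metric of the curved surface. -/
def curvedDiag {n : ℕ} (κ α σ : ℝ) (a : Fin n → ℝ) (s : ℝ) : Fin (n + 1 + 1) → ℝ :=
  Fin.cons κ (Fin.cons (α * (profile σ s)⁻¹) a)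

theorem hasDerivAt_curvedDiag {n : ℕ} {κ α : ℝ} {a : Fin n → ℝ} (hσ : σ = 1 ∨ σ = -1) (s : ℝ)
    (i : Fin (n + 1 + 1)) :
    HasDerivAt (fun s => curvedDiag κ α σ a s i)
      ((Fin.cons 0 (Fin.cons (α * (2 * σ * Real.sinh s / Real.cosh s ^ 3 / profile σ s ^ 2)) 0) :
        Fin (n + 1 + 1) → ℝ) i) s := by
  have h := one_le_profile hσ s
  refine Fin.cases ?_ (fun i => Fin.cases ?_ (fun i => ?_) i) i
  · exact hasDerivAt_const s κ
  · refine (((hasDerivAt_profile (σ := σ) s).inv (by positivity)).const_mul α).congr_deriv ?_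
    simp
  · exact hasDerivAt_const s (a i)

/-- Clairaut's relation: the angular velocity is `L` times the profile, `L` being conserved. The
profile is chosen so that the squared profile cancels in the radial equation and `α σ = κ σ² = κ`
removes the signs, leaving `S'' = L² sinh S / cosh³ S` in every signature. The remaining directions
are linear. -/
theorem curvedDiag_isMaximallyExtended {n : ℕ} {κ α : ℝ} {a : Fin n → ℝ} (hσ : σ = 1 ∨ σ = -1)
    (hκ : κ ≠ 0) (hα : α = σ * κ) (ha : ∀ i, a i ≠ 0) :
    (diagMetric (curvedDiag κ α σ a)).IsMaximallyExtended := by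
  have hP : ∀ s, 0 < profile σ s := fun s => one_pos.trans_le (one_le_profile hσ s)
  have hσ2 : σ ^ 2 = 1 := by rcases hσ with rfl | rfl <;> norm_num
  have hα0 : α ≠ 0 := by
    rw [hα]; refine mul_ne_zero ?_ hκ
    rcases hσ with rfl | rfl <;> norm_num
  refine diagMetric_isMaximallyExtended (D' := fun s => Fin.cons 0 (Fin.cons
    (α * (2 * σ * Real.sinh s / Real.cosh s ^ 3 / profile σ s ^ 2)) 0)) ?_
    (hasDerivAt_curvedDiag hσ) fun x v => ?_
  · intro s i
    refine Fin.cases hκ (fun i => Fin.cases ?_ ha i) i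
    exact mul_ne_zero hα0 (inv_ne_zero (hP s).ne')
  -- The value of the conserved angular momentum fixed by the initial data.
  set L := v 1 / profile σ (x 0) with hL
  obtain ⟨S, S', S'', hS, hS1, hS2, hS0, hS0', hSe⟩ := exists_radial_motion (x 0) (v 0) L
  obtain ⟨Θ, hΘ, hΘ1, hΘ0⟩ := exists_primitive (f := fun t => L * profile σ (S t))
    (contDiff_const.mul (contDiff_profile.comp hS)) (x 1)
  have hΘ2 : ∀ t, HasDerivAt (fun t => L * profile σ (S t))
      (L * (-(2 * σ * Real.sinh (S t) / Real.cosh (S t) ^ 3) * S' t)) t := fun t =>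
    ((hasDerivAt_profile (S t)).comp t (hS1 t)).const_mul L
  refine ⟨Fin.cons S (Fin.cons Θ fun i t => x i.succ.succ + t * v i.succ.succ),
    Fin.cons S' (Fin.cons (fun t => L * profile σ (S t)) fun i _ => v i.succ.succ),
    Fin.cons S'' (Fin.cons (fun t => L * (-(2 * σ * Real.sinh (S t) / Real.cosh (S t) ^ 3) * S' t))
      fun _ _ => 0), fun i => ?_, fun i t => ?_, fun i t => ?_, fun i => ?_, fun i => ?_,
      fun i t => ?_⟩
  · refine Fin.cases hS (fun i => Fin.cases hΘ (fun i => ?_) i) i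
    simp only [Fin.cons_succ]; fun_prop
  · refine Fin.cases (hS1 t) (fun i => Fin.cases (hΘ1 t) (fun i => ?_) i) i
    simpa using ((hasDerivAt_id t).mul_const (v i.succ.succ)).const_add (x i.succ.succ)
  · exact Fin.cases (hS2 t) (fun i => Fin.cases (hΘ2 t) (fun i => hasDerivAt_const t _) i) i
  · exact Fin.cases hS0 (fun i => Fin.cases hΘ0 (fun i => by simp) i) i
  · refine Fin.cases hS0' (fun i => Fin.cases ?_ (fun i => rfl) i) i
    change L * profile σ (S 0) = v 1
    rw [hS0, hL, div_mul_cancel₀ _ (hP _).ne']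
  · have hp := (hP (S t)).ne'
    have hc := (Real.cosh_pos (S t)).ne'
    refine Fin.cases ?_ (fun i => Fin.cases ?_ (fun i => ?_) i) i
    · simp only [Fin.cons_zero, curvedDiag, if_true, Fin.sum_univ_succ, Fin.cons_succ,
        Pi.zero_apply, zero_mul, Finset.sum_const_zero, zero_add, add_zero]
      rw [hSe, hα]
      field_simp
      linear_combination (-(L ^ 2 * Real.sinh (S t))) * hσ2
    · simp only [Fin.cons_zero, curvedDiag, Fin.cons_succ, Fin.succ_ne_zero, if_false]
      field_simp
      ring
    · simp [curvedDiag, Fin.cons_succ, Fin.succ_ne_zero]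

end Profile

/-! ### An obstruction to being the pullback of a constant metric. -/

section Isometry

set_option synthInstance.maxHeartbeats 200000 in
/-- If the pullback of a constant symmetric form `η` along `D` has derivative
`ρ(x⁰) dx⁰ (dx¹)²`, where `ρ(0) = 0`, then `ρ'(0) = 0`. -/
theorem deriv_eq_zero_of_pullback {V : Type*} [NormedAddCommGroup V] [NormedSpace ℝ V]
    {η : V →L[ℝ] V →L[ℝ] ℝ} (hηs : ∀ u v, η u v = η v u) {D : V → V} (hD : ContDiff ℝ ∞ D)
    (hsurj : Function.Surjective (fderiv ℝ D 0)) {p q : V →L[ℝ] ℝ} {ρ : ℝ → ℝ} {c : ℝ}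
    (hρ0 : ρ 0 = 0) (hρ : HasDerivAt ρ c 0)
    (hg : ∀ x u v, HasFDerivAt (fun x => η (fderiv ℝ D x u) (fderiv ℝ D x v))
      ((ρ (p x) * q u * q v) • p) x)
    {e₀ e₁ : V} (h00 : p e₀ = 1) (h01 : q e₀ = 0) (h10 : p e₁ = 0) (h11 : q e₁ = 1) : c = 0 := by
  set D1 : V → V →L[ℝ] V := fderiv ℝ D with hD1
  have hD1s : ContDiff ℝ ∞ D1 := hD.fderiv_right le_rfl
  set D2 : V → V →L[ℝ] V →L[ℝ] V := fderiv ℝ D1 with hD2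
  have hD2s : ContDiff ℝ ∞ D2 := hD1s.fderiv_right le_rfl
  have hD1d : ∀ x, HasFDerivAt D1 (D2 x) x := fun x => (hD1s.differentiable (by simp) x).hasFDerivAt
  have hD2d : ∀ x, HasFDerivAt D2 (fderiv ℝ D2 x) x := fun x =>
    (hD2s.differentiable (by simp) x).hasFDerivAt
  have hsymm : ∀ x u v, D2 x u v = D2 x v u := fun x u v =>
    (hD.contDiffAt.isSymmSndFDerivAt (by simpa using two_le_infty)) u v
  have hsymm3 : ∀ x u v w, fderiv ℝ D2 x u v w = fderiv ℝ D2 x v u w := fun x u v w =>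
    DFunLike.congr_fun
      ((hD1s.contDiffAt.isSymmSndFDerivAt (by simpa using two_le_infty)) u v) w
  have hfirst : ∀ x u v w : V, η (D2 x w u) (D1 x v) + η (D1 x u) (D2 x w v)
      = ρ (p x) * p w * q u * q v := by
    intro x u v w
    have e1 : HasFDerivAt (fun x => η (D1 x u) (D1 x v)) _ x :=
      (η.hasFDerivAt.comp x ((hD1d x).clm_apply (hasFDerivAt_const u x))).clm_apply
        ((hD1d x).clm_apply (hasFDerivAt_const v x))
    have e4 := DFunLike.congr_fun (e1.unique (hg x u v)) w
    simp at e4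
    linear_combination e4
  -- The Koszul combination of the three first-order identities isolates the second derivative of
  -- `D`. Since `ρ` vanishes at `0` and the derivative of `D` there is onto, all second derivatives
  -- at `0` are `η`-orthogonal to everything, so products of them drop out of the next
  -- differentiation.
  have hkoszul : ∀ x u v w : V, η (D2 x u v) (D1 x w)
      = ρ (p x) * ((p u * q v * q w + p v * q u * q w - p w * q u * q v) / 2) := by
    intro x u v w
    have e1 := hfirst x v w u
    have e2 := hfirst x u w v
    have e3 := hfirst x u v w
    rw [hηs (D1 x v)] at e1
    rw [hηs (D1 x u), hsymm x v u] at e2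
    rw [hηs (D1 x u), hsymm x w u, hsymm x w v] at e3
    linear_combination e1 / 2 + e2 / 2 - e3 / 2
  have hzero : ∀ u v w : V, η (D2 0 u v) w = 0 := by
    intro u v w
    obtain ⟨w, rfl⟩ := hsurj w
    rw [hkoszul, map_zero, hρ0, zero_mul]
  have hsecond : ∀ u v w z : V, η (fderiv ℝ D2 0 z u v) (D1 0 w)
      = c * ((p u * q v * q w + p v * q u * q w - p w * q u * q v) / 2) * p z := by
    intro u v w z
    have e1 : HasFDerivAt (fun x => η (D2 x u v) (D1 x w)) _ 0 :=
      (η.hasFDerivAt.comp 0 (((hD2d 0).clm_apply (hasFDerivAt_const u 0)).clm_apply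
        (hasFDerivAt_const v 0))).clm_apply ((hD1d 0).clm_apply (hasFDerivAt_const w 0))
    have hρK : HasDerivAt
        (fun s => ρ s * ((p u * q v * q w + p v * q u * q w - p w * q u * q v) / 2))
        (c * ((p u * q v * q w + p v * q u * q w - p w * q u * q v) / 2)) (p 0) := by
      rw [map_zero]; exact hρ.mul_const _
    have e2 : HasFDerivAt (fun x => η (D2 x u v) (D1 x w)) _ 0 :=
      (HasDerivAt.comp_hasFDerivAt (f := p) (0 : V) hρK p.hasFDerivAt).congr_of_eventuallyEq (Eventually.of_forall fun x => hkoszul x u v w)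
    have e3 := DFunLike.congr_fun (e1.unique e2) z
    simpa [hzero] using e3
  -- Symmetry of the third derivative in its first two arguments is flatness in disguise: the order
  -- `e₀, e₁, e₁` yields `-c / 2`, the order `e₁, e₀, e₁` yields `0`.
  have e1 := hsecond e₁ e₁ e₀ e₀
  have e2 := hsecond e₀ e₁ e₀ e₁
  rw [hsymm3, e2, h00, h01, h10, h11] at e1
  linarith

variable {n : ℕ}

/-- The curved diagonal metric is not isometric to a constant one. -/
theorem not_isometric_curvedDiag {κ α σ : ℝ} {a : Fin n → ℝ} {e : Fin (n + 1 + 1) → ℝ}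
    (hσ : σ = 1 ∨ σ = -1) (hκ : κ ≠ 0) (hα : α ≠ 0) (ha : ∀ i, a i ≠ 0)
    {D : EuclideanSpace ℝ (Fin (n + 1 + 1)) → EuclideanSpace ℝ (Fin (n + 1 + 1))}
    (hD : ContDiff ℝ ∞ D)
    (h : ∀ x u v : EuclideanSpace ℝ (Fin (n + 1 + 1)), diagMetric (curvedDiag κ α σ a) x u v
      = diagMetric (fun _ => e) (D x)
        (fderiv ℝ D x u : EuclideanSpace ℝ (Fin (n + 1 + 1)))
        (fderiv ℝ D x v : EuclideanSpace ℝ (Fin (n + 1 + 1)))) : False := by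
  have hP : ∀ s, 0 < profile σ s := fun s => one_pos.trans_le (one_le_profile hσ s)
  set pr : ∀ i, EuclideanSpace ℝ (Fin (n + 1 + 1)) →L[ℝ] ℝ := fun i => EuclideanSpace.proj i
    with hpr
  have hpre : ∀ i u, pr i u = u i := fun i u => rfl
  set η : EuclideanSpace ℝ (Fin (n + 1 + 1)) →L[ℝ] EuclideanSpace ℝ (Fin (n + 1 + 1)) →L[ℝ] ℝ :=
    ∑ i, e i • (pr i).smulRight (pr i) with hη
  have hηe : ∀ u v, η u v = ∑ i, e i * u i * v i := by
    intro u v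
    simp [hη, mul_assoc, hpre]
  have hg : ∀ x u v, η (fderiv ℝ D x u) (fderiv ℝ D x v)
      = ∑ i, curvedDiag κ α σ a (x 0) i * u i * v i := fun x u v =>
    (hηe _ _).trans (h x u v).symm
  have hinj : Function.Injective (fderiv ℝ D 0).toLinearMap := by
    refine (injective_iff_map_eq_zero _).2 fun v hv => ?_
    have hv' : fderiv ℝ D 0 v = 0 := hv
    have hD0 : ∀ s i, curvedDiag κ α σ a s i ≠ 0 := fun s i =>
      Fin.cases hκ (fun i => Fin.cases (mul_ne_zero hα (inv_ne_zero (hP s).ne')) ha i) i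
    refine diagMetric_nondegenerate hD0 (0 : EuclideanSpace ℝ (Fin (n + 1 + 1))) v fun u => ?_
    refine (hg 0 v u).symm.trans ?_
    rw [hv']; simp
  -- Only the angular component varies, with derivative `ρ`. It is stationary at `s = 0` because
  -- `sinh 0 = 0`, while its second derivative `c` there is not zero.
  have hc := deriv_eq_zero_of_pullback (η := η) (p := pr 0) (q := pr 1)
    (ρ := fun s => α * (2 * σ * Real.sinh s / Real.cosh s ^ 3 / profile σ s ^ 2))
    (c := α * (2 * σ / profile σ 0 ^ 2))
    (e₀ := EuclideanSpace.single 0 1) (e₁ := EuclideanSpace.single 1 1)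
    (fun u v => by rw [hηe, hηe]; exact Finset.sum_congr rfl fun i _ => by ring) hD
    (LinearMap.injective_iff_surjective.1 hinj) (by simp) ?_ (fun x u v => ?_) (by simp [hpre])
    (by simp [hpre]) (by simp [hpre]) (by simp [hpre])
  · have hσ0 : σ ≠ 0 := by rcases hσ with rfl | rfl <;> norm_num
    have hp := (hP 0).ne'
    exact (mul_ne_zero hα (div_ne_zero (mul_ne_zero two_ne_zero hσ0) (pow_ne_zero 2 hp))) hc
  · have hp := (hP 0).ne'
    have f4 := ((((Real.hasDerivAt_sinh 0).const_mul (2 * σ)).fun_div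
      ((Real.hasDerivAt_cosh 0).fun_pow 3) (by simp)).fun_div
      ((hasDerivAt_profile (σ := σ) 0).fun_pow 2) (by positivity)).const_mul α
    refine f4.congr_deriv ?_
    simp
    left
    field_simp
  · simp only [hg]
    have e2 : HasFDerivAt (fun x : EuclideanSpace ℝ (Fin (n + 1 + 1)) =>
        ∑ i, curvedDiag κ α σ a (x 0) i * u i * v i) _ x :=
      HasFDerivAt.fun_sum fun i _ => ((((hasDerivAt_curvedDiag (κ := κ) (α := α) (a := a) hσ
        (x 0) i).comp_hasFDerivAt (f := fun x : EuclideanSpace ℝ (Fin (n + 1 + 1)) => x 0) x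
          (pr 0).hasFDerivAt).mul_const (u i)).mul_const (v i))
    refine e2.congr_fderiv ?_
    ext w
    simp [Fin.sum_univ_succ, hpre]
    ring

end Isometry

/-! ### Surfaces of revolution as maps to a vector space. -/

section Surface

variable {n : ℕ}

/-- The product of a surface of revolution with profile curve `(r, z)` and a plane. -/
def surface (r z : ℝ → ℝ) (x : EuclideanSpace ℝ (Fin (n + 1 + 1))) : Fin (n + 1 + 1 + 1) → ℝ :=
  Fin.cons (r (x 0) * Real.cos (x 1)) (Fin.cons (r (x 0) * Real.sin (x 1))
    (Fin.cons (z (x 0)) fun k => x k.succ.succ))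

theorem contDiff_surface {r z : ℝ → ℝ} (hr : ContDiff ℝ ∞ r) (hz : ContDiff ℝ ∞ z) :
    ContDiff ℝ ∞ (surface (n := n) r z) := by
  have hx : ∀ i, ContDiff ℝ ∞ fun x : EuclideanSpace ℝ (Fin (n + 1 + 1)) => x i := fun i =>
    (EuclideanSpace.proj i : EuclideanSpace ℝ (Fin (n + 1 + 1)) →L[ℝ] ℝ).contDiff
  rw [contDiff_pi]
  refine fun i => Fin.cases ?_ (fun i => Fin.cases ?_ (fun i => Fin.cases ?_ (fun i => ?_) i) i) i
  · exact (hr.comp (hx 0)).mul (Real.contDiff_cos.comp (hx 1))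
  · exact (hr.comp (hx 0)).mul (Real.contDiff_sin.comp (hx 1))
  · exact hz.comp (hx 0)
  · exact hx i.succ.succ

theorem fderiv_surface {r z : ℝ → ℝ} (hr : Differentiable ℝ r) (hz : Differentiable ℝ z)
    (x u : EuclideanSpace ℝ (Fin (n + 1 + 1))) :
    fderiv ℝ (surface (n := n) r z) x u
      = Fin.cons (deriv r (x 0) * u 0 * Real.cos (x 1) - r (x 0) * (Real.sin (x 1) * u 1))
        (Fin.cons (deriv r (x 0) * u 0 * Real.sin (x 1) + r (x 0) * (Real.cos (x 1) * u 1))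
          (Fin.cons (deriv z (x 0) * u 0) fun k => u k.succ.succ)) := by
  set pr : ∀ i, EuclideanSpace ℝ (Fin (n + 1 + 1)) →L[ℝ] ℝ := fun i => EuclideanSpace.proj i
    with hpr
  have hpre : ∀ i u, pr i u = u i := fun i u => rfl
  have hx : ∀ i, HasFDerivAt (fun x : EuclideanSpace ℝ (Fin (n + 1 + 1)) => x i) (pr i) x :=
    fun i => (pr i).hasFDerivAt
  have hr' := ((hr (x 0)).hasDerivAt).comp_hasFDerivAt
    (f := fun x : EuclideanSpace ℝ (Fin (n + 1 + 1)) => x 0) x (hx 0)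
  have hz' := ((hz (x 0)).hasDerivAt).comp_hasFDerivAt
    (f := fun x : EuclideanSpace ℝ (Fin (n + 1 + 1)) => x 0) x (hx 0)
  have hd : DifferentiableAt ℝ (surface (n := n) r z) x := by
    rw [differentiableAt_pi]
    refine fun i =>
      Fin.cases ?_ (fun i => Fin.cases ?_ (fun i => Fin.cases ?_ (fun i => ?_) i) i) i
    · exact hr'.differentiableAt.mul (hx 1).cos.differentiableAt
    · exact hr'.differentiableAt.mul (hx 1).sin.differentiableAt
    · exact hz'.differentiableAt
    · exact (hx _).differentiableAt
  have hc := hasFDerivAt_pi'.1 hd.hasFDerivAt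
  have key : ∀ i (g : EuclideanSpace ℝ (Fin (n + 1 + 1)) →L[ℝ] ℝ),
      HasFDerivAt (fun x => surface (n := n) r z x i) g x →
      fderiv ℝ (surface (n := n) r z) x u i = g u := fun i g hg =>
    DFunLike.congr_fun ((hc i).unique hg) u
  funext i
  refine Fin.cases ?_ (fun i => Fin.cases ?_ (fun i => Fin.cases ?_ (fun i => ?_) i) i) i
  · refine (key 0 _ (hr'.mul (hx 1).cos)).trans ?_
    simp [hpre]; ring
  · refine (key (Fin.succ 0) _ (hr'.mul (hx 1).sin)).trans ?_
    simp [hpre]; ring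
  · refine (key (Fin.succ (Fin.succ 0)) _ hz').trans ?_
    simp only [ContinuousLinearMap.smul_apply, hpre, smul_eq_mul, Fin.cons_succ, Fin.cons_zero]
  · exact key i.succ.succ.succ _ (hx i.succ.succ)

/-- The profile curve of the curved surface, parametrized by arc length. -/
theorem exists_profile_curve {σ : ℝ} (hσ : σ = 1 ∨ σ = -1) :
    ∃ r z : ℝ → ℝ, ContDiff ℝ ∞ r ∧ ContDiff ℝ ∞ z ∧ (∀ s, 0 < r s) ∧
      (∀ s, r s ^ 2 = (profile σ s)⁻¹) ∧ (∀ s, 0 < deriv z s) ∧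
      ∀ s, deriv z s ^ 2 + σ * deriv r s ^ 2 = 1 := by
  have h1 := one_le_profile hσ
  have hP : ∀ s, 0 < profile σ s := fun s => one_pos.trans_le (h1 s)
  have hσ2 : σ ^ 2 = 1 := by rcases hσ with rfl | rfl <;> norm_num
  set r : ℝ → ℝ := fun s => (Real.sqrt (profile σ s))⁻¹ with hr
  have hrs : ContDiff ℝ ∞ r :=
    (contDiff_profile.sqrt fun s => (hP s).ne').inv fun s => (Real.sqrt_pos.2 (hP s)).ne'
  have hr2 : ∀ s, r s ^ 2 = (profile σ s)⁻¹ := fun s => by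
    simp only [hr]; rw [inv_pow, Real.sq_sqrt (hP s).le]
  -- Needed for a real `z` when `σ = 1`. Differentiating `r² = 1 / profile` gives `r'² cosh⁶
  -- profile³ = sinh²`, and `sinh² < cosh² ≤ cosh⁶ profile³`.
  have hlt : ∀ s, deriv r s ^ 2 < 1 := by
    intro s
    have hp := hP s
    have hc := Real.cosh_pos s
    have e1 := ((hrs.differentiable (by simp) s).hasDerivAt.fun_pow 2)
    have e2 := (hasDerivAt_profile (σ := σ) s).inv hp.ne'
    have e3 := e1.unique (e2.congr_of_eventuallyEq (Eventually.of_forall hr2))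
    have e4 : r s * deriv r s * (Real.cosh s ^ 3 * profile σ s ^ 2) = σ * Real.sinh s := by
      have : 2 * (r s * deriv r s) = 2 * σ * Real.sinh s / Real.cosh s ^ 3 / profile σ s ^ 2 := by
        rw [neg_neg] at e3; rw [← e3]; push_cast; ring
      field_simp at this
      linear_combination this
    have e5 : deriv r s ^ 2 * (Real.cosh s ^ 6 * profile σ s ^ 3) = Real.sinh s ^ 2 := by
      have e6 : r s ^ 2 * profile σ s = 1 := by rw [hr2, inv_mul_cancel₀ hp.ne']
      linear_combination (r s * deriv r s * (Real.cosh s ^ 3 * profile σ s ^ 2)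
        + σ * Real.sinh s) * e4 + Real.sinh s ^ 2 * hσ2
        - (deriv r s ^ 2 * (Real.cosh s ^ 6 * profile σ s ^ 3)) * e6
    have e7 : 1 ≤ profile σ s ^ 3 := one_le_pow₀ (h1 s)
    have e8 : Real.cosh s ^ 2 ≤ Real.cosh s ^ 6 :=
      pow_le_pow_right₀ (Real.one_le_cosh s) (by norm_num)
    have e9 := Real.cosh_sq s
    by_contra! hge
    have e10 : Real.cosh s ^ 6 * 1 ≤ Real.cosh s ^ 6 * profile σ s ^ 3 := by gcongr
    have e11 : 1 * (Real.cosh s ^ 6 * profile σ s ^ 3)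
        ≤ deriv r s ^ 2 * (Real.cosh s ^ 6 * profile σ s ^ 3) := by gcongr
    linarith
  have hpos : ∀ s, 0 < 1 - σ * deriv r s ^ 2 := by
    intro s
    have := hlt s
    rcases hσ with rfl | rfl
    · linarith
    · nlinarith [sq_nonneg (deriv r s)]
  have hr's : ContDiff ℝ ∞ (deriv r) := hrs.deriv'
  obtain ⟨z, hz, hzd, -⟩ := exists_primitive (f := fun s => Real.sqrt (1 - σ * deriv r s ^ 2))
    ((contDiff_const.sub (contDiff_const.mul (hr's.pow 2))).sqrt fun s => (hpos s).ne') 0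
  refine ⟨r, z, hrs, hz, fun s => inv_pos.2 (Real.sqrt_pos.2 (hP s)), hr2, fun s => ?_,
    fun s => ?_⟩
  · rw [(hzd s).deriv]; exact Real.sqrt_pos.2 (hpos s)
  · rw [(hzd s).deriv, Real.sq_sqrt (hpos s).le]; ring

end Surface

/-! ### Gauge equivalent solutions that are not isometric. -/

section Algebroid

variable {EM : Type*} [NormedAddCommGroup EM] [NormedSpace ℝ EM]
  {M : Type*} [TopologicalSpace M] [ChartedSpace EM M]
  {F : Type*} [NormedAddCommGroup F] [NormedSpace ℝ F] [FiniteDimensional ℝ F]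
  {E : M → Type*} [TopologicalSpace (TotalSpace F E)] [∀ p, TopologicalSpace (E p)]
  [∀ p, AddCommGroup (E p)] [∀ p, Module ℝ (E p)]
  [∀ p, IsTopologicalAddGroup (E p)] [∀ p, ContinuousSMul ℝ (E p)]
  [FiberBundle F E] [VectorBundle ℝ F E] [IsManifold 𝓘(ℝ, EM) ∞ M]
  {L : LieAlgebroid EM F E} {T : SymTensor EM F E} {n : ℕ}

/-- The metric induced on a surface of revolution. -/
theorem metric_surface {p : M} {f : Fin (n + 1 + 1 + 1) → E p} {ε : Fin (n + 1 + 1 + 1) → ℝ}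
    (h01 : ε 0 = ε 1) (hf : ∀ i j, T.toFun p (f i) (f j) = if i = j then ε i else 0)
    {r z : ℝ → ℝ} (hr : ContDiff ℝ ∞ r) (hz : ContDiff ℝ ∞ z)
    (hY : ContDiff ℝ ∞ (surface (n := n) r z)) {D : ℝ → Fin (n + 1 + 1) → ℝ}
    (hD : ∀ s, D s = Fin.cons (ε 0 * deriv r s ^ 2 + ε 2 * deriv z s ^ 2)
      (Fin.cons (ε 0 * r s ^ 2) fun k => ε k.succ.succ.succ)) :
    T.metric (exactField (EM := EM) (F := F) p (Fintype.linearCombination ℝ f)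
      (surface r z) hY) = diagMetric D := by
  have hbil : ∀ y y' : Fin (n + 1 + 1 + 1) → ℝ,
      T.toFun p (Fintype.linearCombination ℝ f y) (Fintype.linearCombination ℝ f y')
        = ∑ i, ε i * y i * y' i := by
    intro y y'
    simp only [Fintype.linearCombination_apply, map_sum, map_smul, ContinuousLinearMap.sum_apply,
      ContinuousLinearMap.smul_apply, hf, smul_eq_mul]
    refine Finset.sum_congr rfl fun i _ => ?_
    simp
    ring
  have key : ∀ x u v : EuclideanSpace ℝ (Fin (n + 1 + 1)),
      T.toFun p (Fintype.linearCombination ℝ f (fderiv ℝ (surface (n := n) r z) x u))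
        (Fintype.linearCombination ℝ f (fderiv ℝ (surface (n := n) r z) x v))
        = diagMetric D x u v := by
    intro x u v
    have hrd : Differentiable ℝ r := hr.differentiable (by simp)
    have hzd : Differentiable ℝ z := hz.differentiable (by simp)
    rw [hbil, diagMetric_apply, hD, fderiv_surface hrd hzd, fderiv_surface hrd hzd]
    have h2 : (Fin.succ (Fin.succ 0) : Fin (n + 1 + 1 + 1)) = 2 := rfl
    have h1 : (Fin.succ 0 : Fin (n + 1 + 1 + 1)) = 1 := rfl
    have h1' : (Fin.succ 0 : Fin (n + 1 + 1)) = 1 := rfl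
    simp only [Fin.sum_univ_succ, Fin.cons_zero, Fin.cons_succ]
    rw [h2, h1, h1', ← h01]
    -- The equality `ε 0 = ε 1` is what lets the rotation angle disappear from the metric.
    have := Real.sin_sq_add_cos_sq (x 1)
    linear_combination (ε 0 * (deriv r (x 0) ^ 2 * u 0 * v 0 + r (x 0) ^ 2 * u 1 * v 1)) * this
  funext x u v
  exact key x u v

/-- If the rank of `𝒮` at a point exceeds `n + 2`, then there are gauge equivalent maximally
extended solutions on `ℝ^(n + 2)` that are not isometric. -/
theorem exists_nonisometric (hL : L.IsAbelianBundle) (p : M)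
    (hT : n + 1 + 1 + 1 ≤ Module.finrank ℝ (T.toFun p).range) :
    ∃ φ₁ φ₂ : BundleField EM F E (n + 1 + 1) (EuclideanSpace ℝ (Fin (n + 1 + 1))),
      L.IsSolution φ₁ ∧ L.IsSolution φ₂ ∧
      (T.metric φ₁).Nondegenerate ∧ (T.metric φ₂).Nondegenerate ∧
      (T.metric φ₁).IsMaximallyExtended ∧ (T.metric φ₂).IsMaximallyExtended ∧
      GaugeEquivalent L T φ₁ φ₂ ∧
      ∀ D : EuclideanSpace ℝ (Fin (n + 1 + 1)) → EuclideanSpace ℝ (Fin (n + 1 + 1)),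
        ContDiff ℝ ∞ D → ¬ ∀ x u v : EuclideanSpace ℝ (Fin (n + 1 + 1)),
          T.metric φ₁ x u v = T.metric φ₂ (D x) (fderiv ℝ D x u : EuclideanSpace ℝ _)
            (fderiv ℝ D x v : EuclideanSpace ℝ _) := by
  have := finiteDimensional_fiber F (E := E) p
  rw [← T.finrank_range_bilin] at hT
  obtain ⟨f, ε, hε, h01, hf⟩ := exists_orthogonal_vectors_eq (T.bilin p) (fun u v => T.symm p u v) hT
  have hε2 : ∀ i, ε i ^ 2 = 1 := fun i => by rcases hε i with h | h <;> rw [h] <;> norm_num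
  have hε0 : ∀ i, ε i ≠ 0 := fun i h => by simpa [h] using hε2 i
  -- The relative sign of the rotation plane and the axis. It decides the arc length condition `z'²
  -- + σ r'² = 1`, under which the `x⁰` component of the metric is `ε 2`.
  set σ := ε 0 * ε 2 with hσdef
  have hσ : σ = 1 ∨ σ = -1 := by
    rw [hσdef]
    rcases hε 0 with h | h <;> rcases hε 2 with h' | h' <;> rw [h, h'] <;> norm_num
  have hασ : ε 0 = σ * ε 2 := by rw [hσdef]; linear_combination (-ε 0) * hε2 2
  obtain ⟨r, z, hr, hz, hr0, hr2, hz0, hrz⟩ := exists_profile_curve hσ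
  set a : Fin n → ℝ := fun k => ε k.succ.succ.succ with ha
  have hY₁ := contDiff_surface (n := n) hr hz
  -- The comparison surface is the cylinder of radius `1`, whose metric is constant. The angle runs
  -- over all of `ℝ`, so both solutions live on Euclidean space.
  have hY₂ := contDiff_surface (n := n) (r := fun _ => 1) (z := id) contDiff_const contDiff_id
  have hm₁ : T.metric (exactField (EM := EM) (F := F) p (Fintype.linearCombination ℝ f) _ hY₁)
      = diagMetric (curvedDiag (ε 2) (ε 0) σ a) := by
    refine metric_surface h01 hf hr hz hY₁ fun s => ?_
    have e : ε 0 * deriv r s ^ 2 + ε 2 * deriv z s ^ 2 = ε 2 := by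
      linear_combination ε 2 * hrz s + deriv r s ^ 2 * hασ
    rw [e, hr2]; rfl
  set b : Fin (n + 1 + 1) → ℝ := Fin.cons (ε 2) (Fin.cons (ε 0) a) with hb
  have hb0 : ∀ i, b i ≠ 0 := fun i =>
    Fin.cases (hε0 2) (fun i => Fin.cases (hε0 0) (fun i => hε0 _) i) i
  have hm₂ : T.metric (exactField (EM := EM) (F := F) p (Fintype.linearCombination ℝ f) _ hY₂)
      = diagMetric fun _ => b := by
    refine metric_surface h01 hf contDiff_const contDiff_id hY₂ fun s => ?_
    simp [hb, ha]
  -- The linear homotopy acts on the profile curve alone, so each intermediate map is again a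
  -- surface of revolution and its metric is diagonal.
  have hpath : ∀ τ : ℝ, (fun x => surface (n := n) r z x
      + τ • (surface (n := n) (fun _ => 1) id x - surface (n := n) r z x))
      = surface (n := n) (fun s => r s + τ * (1 - r s)) (fun s => z s + τ * (s - z s)) := by
    intro τ
    funext x i
    refine Fin.cases ?_ (fun i => Fin.cases ?_ (fun i => Fin.cases ?_ (fun i => ?_) i) i) i <;>
      simp only [surface, Pi.add_apply, Pi.smul_apply, Pi.sub_apply, smul_eq_mul, Fin.cons_zero,
        Fin.cons_succ, id] <;> ring
  have hrτ : ∀ τ : ℝ, ContDiff ℝ ∞ fun s => r s + τ * (1 - r s) := fun τ =>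
    hr.add (contDiff_const.mul (contDiff_const.sub hr))
  have hzτ : ∀ τ : ℝ, ContDiff ℝ ∞ fun s => z s + τ * (s - z s) := fun τ =>
    hz.add (contDiff_const.mul (contDiff_id.sub hz))
  have hYτ : ∀ τ : ℝ, ContDiff ℝ ∞ (fun x => surface (n := n) r z x
      + τ • (surface (n := n) (fun _ => 1) id x - surface (n := n) r z x)) := fun τ => by
    rw [hpath]; exact contDiff_surface (hrτ τ) (hzτ τ)
  have hn : ∀ τ ∈ Icc (0 : ℝ) 1, (T.metric (exactField (EM := EM) (F := F) p
      (Fintype.linearCombination ℝ f) _ (hYτ τ))).Nondegenerate := by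
    rintro τ ⟨hτ0, hτ1⟩
    rw [exactField_congr p _ (hpath τ) (hYτ τ) (contDiff_surface (hrτ τ) (hzτ τ)),
      metric_surface h01 hf (hrτ τ) (hzτ τ) (contDiff_surface (hrτ τ) (hzτ τ)) fun s => rfl]
    refine diagMetric_nondegenerate fun s i => ?_
    have hrd := (hr.differentiable (by simp) s).hasDerivAt
    have hzd := (hz.differentiable (by simp) s).hasDerivAt
    refine Fin.cases ?_ (fun i => Fin.cases ?_ (fun i => hε0 _) i) i
    · have e1 : deriv (fun s => r s + τ * (1 - r s)) s = (1 - τ) * deriv r s :=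
        ((hrd.add ((hrd.const_sub 1).const_mul τ)).congr_deriv (by ring)).deriv
      have e2 : deriv (fun s => z s + τ * (s - z s)) s = (1 - τ) * deriv z s + τ :=
        ((hzd.add (((hasDerivAt_id s).sub hzd).const_mul τ)).congr_deriv (by ring)).deriv
      rw [Fin.cons_zero, e1, e2]
      -- By the arc length condition the coefficient is `ε 2` times a sum of non-negative terms;
      -- this uses `z' > 0`. The two squares `(1 - τ)²` and `τ²` never vanish together.
      have e3 : ε 0 * ((1 - τ) * deriv r s) ^ 2 + ε 2 * ((1 - τ) * deriv z s + τ) ^ 2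
          = ε 2 * ((1 - τ) ^ 2 + 2 * (τ * (1 - τ) * deriv z s) + τ ^ 2) := by
        linear_combination ((1 - τ) * deriv r s) ^ 2 * hασ + ε 2 * (1 - τ) ^ 2 * hrz s
      rw [e3]
      refine mul_ne_zero (hε0 2) ?_
      have e4 : 0 ≤ τ * (1 - τ) * deriv z s :=
        mul_nonneg (mul_nonneg hτ0 (by linarith)) (hz0 s).le
      exact (by nlinarith [sq_nonneg (1 - 2 * τ)] : _ < _).ne'
    · rw [Fin.cons_succ, Fin.cons_zero]
      refine mul_ne_zero (hε0 0) (pow_ne_zero 2 ?_)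
      have h := hr0 s
      rcases hτ0.eq_or_lt with rfl | hτ
      · simpa using h.ne'
      · exact (by nlinarith : 0 < r s + τ * (1 - r s)).ne'
  have hge := gaugeEquivalent_exactField (T := T) hL p (Fintype.linearCombination ℝ f) hY₁ hY₂ hYτ hn
  refine ⟨_, _, exactField_isSolution hL p _ _ hY₁, exactField_isSolution hL p _ _ hY₂, ?_, ?_, ?_,
    ?_, hge, ?_⟩
  · have := hn 0 ⟨le_rfl, zero_le_one⟩
    rwa [exactField_congr p _ (by funext x; simp) (hYτ 0) hY₁] at this
  · rw [hm₂]; exact diagMetric_nondegenerate fun _ => hb0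
  · rw [hm₁]; exact curvedDiag_isMaximallyExtended hσ (hε0 2) hασ fun i => hε0 _
  · rw [hm₂]; exact diagMetric_const_isMaximallyExtended hb0
  · intro D hD h
    rw [hm₁, hm₂] at h
    exact not_isometric_curvedDiag hσ (hε0 2) (hε0 0) (fun i => hε0 _) hD h

end Algebroid

end EGravity

end

/-! ### The equivalence. -/

theorem mainTheorem5
    {EM : Type*} [NormedAddCommGroup EM] [NormedSpace ℝ EM] [FiniteDimensional ℝ EM]
    {M : Type*} [TopologicalSpace M] [ChartedSpace EM M] [IsManifold 𝓘(ℝ, EM) ∞ M]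
    [T2Space M] [SecondCountableTopology M]
    {F : Type*} [NormedAddCommGroup F] [NormedSpace ℝ F] [FiniteDimensional ℝ F]
    {E : M → Type*} [TopologicalSpace (TotalSpace F E)] [∀ p, TopologicalSpace (E p)]
    [∀ p, AddCommGroup (E p)] [∀ p, Module ℝ (E p)]
    [∀ p, IsTopologicalAddGroup (E p)] [∀ p, ContinuousSMul ℝ (E p)]
    [FiberBundle F E] [VectorBundle ℝ F E] [ContMDiffVectorBundle ∞ F E 𝓘(ℝ, EM)]
    (d : ℕ) (hd : 2 ≤ d)
    (L : EGravity.LieAlgebroid EM F E) (hL : L.IsAbelianBundle)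
    (T : EGravity.SymTensor EM F E) :
    EGravity.IsReasonable d L T ↔
      ∀ p : M, Module.finrank ℝ (T.toFun p).range = d := by
  constructor
  · rintro ⟨h₁, h₂⟩ p
    obtain ⟨φ, -, ⟨x, rfl⟩, hφ⟩ := h₁ p
    -- The existence condition alone bounds the rank from below; uniqueness up to diffeomorphism is
    -- used only for the upper bound.
    refine le_antisymm ?_ (EGravity.le_finrank_of_nondegenerate hφ x)
    by_contra! hlt
    -- Two dimensions carry the surface and `n = d - 2` the plane factor; a rank above `d` provides
    -- the one additional ambient dimension.
    obtain ⟨n, rfl⟩ := Nat.exists_eq_add_of_le' hd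
    obtain ⟨φ₁, φ₂, hs₁, hs₂, hn₁, hn₂, hm₁, hm₂, hge, hno⟩ :=
      EGravity.exists_nonisometric (n := n) hL (φ.base x) hlt
    obtain ⟨D, hD⟩ := h₂ _ φ₁ φ₂ hs₁ hs₂ hn₁ hn₂ hm₁ hm₂ hge
    refine hno D D.contMDiff.contDiff fun x u v => ?_
    have h := hD x u v
    rw [mfderiv_eq_fderiv] at h
    exact h
  · exact fun hT => ⟨fun p => EGravity.exists_solution_of_rank_eq hL p (hT p),
      fun S _ _ _ _ _ φ₁ φ₂ hs₁ hs₂ hn₁ hn₂ hm₁ hm₂ hge =>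
        EGravity.exists_diffeomorph_of_gaugeEquivalent hL hT hs₁ hs₂ hn₁ hn₂ hm₁ hm₂ hge⟩
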